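/- Let $A$ be a C*-algebra. For $n\in\{0,1,2,\dots\}$, say that $A$ has \emph{nuclear dimension} $n$ if $n$ is the smallest natural number for which there are a directed set $\Lambda$, finite-dimensional C*-algebras $F^i_\lambda$ ($i=0,\dots,n$, $\lambda\in\Lambda$) and completely positive contractions $\psi^i_\lambda\colon A\to F^i_\lambda$ and $\phi^i_\lambda\colon F^i_\lambda\to A$ such that every $\phi^i_\lambda$ has order zero (i.e. $\phi^i_\lambda(a)\phi^i_\lambda(b)=0$ whenever $a,b\ge 0$ and $ab=0$) and $\lim_\lambda\sum_{i=0}^n\phi^i_\lambda\psi^i_\lambda(a)=a$ for all $a\in A$. Let $Cu(A)=W(A\otimes\mathcal K)$ be the stabilized Cuntz semigroup of $A$. Here $\mathcal K$ is the algebra of compact operators on a separable infinite-dimensional Hilbert space, and, for a C*-algebra $B$, $W(B)$ is the set of positive elements of the matrix algebras $M_m(B)$, $m\ge 0$, modulo Cuntz equivalence, with addition $[a]+[b]=[a\oplus b]$ and with the order given by $[a]\le[b]$ if and only if $x_k^*bx_k\to a$ for some sequence of rectangular matrices $x_k$ over $B$ (Cuntz equivalence means that $[a]\le[b]$ and $[b]\le[a]$).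 If $A$ has nuclear dimension $n$, then $Cu(A)$ has the $n$-comparison property: if $x,y_0,\dots,y_n\in Cu(A)$ are such that for each $i=0,\dots,n$ there is an integer $k_i\ge 1$ with $(k_i+1)x\le k_iy_i$, then $x\le y_0+\dots+y_n$. More strongly, if $x,y_0,\dots,y_n\in Cu(A)$ are such that for each $i=0,\dots,n$ there is an integer $k_i\ge 1$ with $k_ix\le k_iy_i$, then $x\le y_0+\dots+y_n$. -/

import Mathlib

noncomputable section

open Filter Topology

universe u

/-! ### The stabilization `A ⊗ 𝒦` -/

/-- The infinite matrices over `A`, indexed by `ℕ × ℕ`, that vanish outside of a finite corner. -/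
def finSuppSubmodule (A : Type u) [NonUnitalCStarAlgebra A] : Submodule ℂ (ℕ → ℕ → A) where
  carrier := {x | ∃ N : ℕ, ∀ i j, N ≤ i ∨ N ≤ j → x i j = 0}
  zero_mem' := ⟨0, fun _ _ _ => rfl⟩
  add_mem' := by
    rintro x y ⟨N, hN⟩ ⟨M, hM⟩
    refine ⟨max N M, fun i j h => ?_⟩
    have h1 : x i j = 0 := hN i j (by omega)
    have h2 : y i j = 0 := hM i j (by omega)
    simp [h1, h2]
  smul_mem' := by
    rintro c x ⟨N, hN⟩
    exact ⟨N, fun i j h => by simp [hN i j h]⟩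

/-- The *-algebra `M_∞(A) = ⋃ₙ Mₙ(A)`, where `Mₙ(A)` is the upper left corner of `Mₙ₊₁(A)`. -/
def FinSuppMatrix (A : Type u) [NonUnitalCStarAlgebra A] : Type u := finSuppSubmodule A

namespace FinSuppMatrix

section Algebra

variable {A : Type u} [NonUnitalCStarAlgebra A]

instance : AddCommGroup (FinSuppMatrix A) := inferInstanceAs (AddCommGroup (finSuppSubmodule A))

instance : Module ℂ (FinSuppMatrix A) := inferInstanceAs (Module ℂ (finSuppSubmodule A))

/-- The entry of a matrix at position `(i, j)`. -/
def entry (x : FinSuppMatrix A) (i j : ℕ) : A := x.1 i j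

/-- `x` lies in the upper left `N × N` corner. -/
def SuppLE (x : FinSuppMatrix A) (N : ℕ) : Prop := ∀ i j, N ≤ i ∨ N ≤ j → x.entry i j = 0

theorem exists_suppLE (x : FinSuppMatrix A) : ∃ N, x.SuppLE N := x.2

theorem SuppLE.mono {x : FinSuppMatrix A} {N M : ℕ} (h : x.SuppLE N) (hNM : N ≤ M) :
    x.SuppLE M := fun i j hij => h i j (by omega)

@[ext]
theorem ext {x y : FinSuppMatrix A} (h : ∀ i j, x.entry i j = y.entry i j) : x = y :=
  Subtype.ext (funext fun i => funext fun j => h i j)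

theorem entry_add (x y : FinSuppMatrix A) (i j : ℕ) :
    (x + y).entry i j = x.entry i j + y.entry i j := rfl

theorem entry_zero (i j : ℕ) : (0 : FinSuppMatrix A).entry i j = 0 := rfl

theorem entry_smul (c : ℂ) (x : FinSuppMatrix A) (i j : ℕ) :
    (c • x).entry i j = c • x.entry i j := rfl

theorem sum_aux {x : FinSuppMatrix A} {N : ℕ} (hx : x.SuppLE N) (y : FinSuppMatrix A) (i j : ℕ) :
    ∑ᶠ k, x.entry i k * y.entry k j = ∑ k : Fin N, x.entry i k * y.entry k j := by
  rw [Fin.sum_univ_eq_sum_range (fun k => x.entry i k * y.entry k j)]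
  refine finsum_eq_sum_of_support_subset _ fun k hk => ?_
  by_contra hk'
  refine hk ?_
  have : N ≤ k := by simpa using hk'
  simp [hx i k (Or.inr this)]

/-- Matrix multiplication. -/
instance : Mul (FinSuppMatrix A) where
  mul x y := ⟨fun i j => ∑ᶠ k, x.entry i k * y.entry k j, by
    obtain ⟨N, hN⟩ := x.exists_suppLE
    obtain ⟨M, hM⟩ := y.exists_suppLE
    refine ⟨max N M, fun i j h => ?_⟩
    change ∑ᶠ k, x.entry i k * y.entry k j = 0
    rw [sum_aux hN]
    refine Finset.sum_eq_zero fun k _ => ?_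
    rcases h with h | h
    · rw [hN i k (Or.inl (by omega)), zero_mul]
    · rw [hM k j (Or.inr (by omega)), mul_zero]⟩

/-- The conjugate transpose. -/
instance : Star (FinSuppMatrix A) where
  star x := ⟨fun i j => star (x.entry j i), by
    obtain ⟨N, hN⟩ := x.exists_suppLE
    exact ⟨N, fun i j h => by simp [hN j i h.symm]⟩⟩

theorem entry_star (x : FinSuppMatrix A) (i j : ℕ) :
    (star x).entry i j = star (x.entry j i) := rfl

theorem entry_mul {x : FinSuppMatrix A} {N : ℕ} (hx : x.SuppLE N) (y : FinSuppMatrix A)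
    (i j : ℕ) : (x * y).entry i j = ∑ k : Fin N, x.entry i k * y.entry k j :=
  sum_aux hx y i j

theorem SuppLE.add {x y : FinSuppMatrix A} {N : ℕ} (hx : x.SuppLE N) (hy : y.SuppLE N) :
    (x + y).SuppLE N := fun i j h => by rw [entry_add, hx i j h, hy i j h, add_zero]

theorem SuppLE.smul {x : FinSuppMatrix A} {N : ℕ} (hx : x.SuppLE N) (c : ℂ) :
    (c • x).SuppLE N := fun i j h => by rw [entry_smul, hx i j h, smul_zero]

theorem SuppLE.star {x : FinSuppMatrix A} {N : ℕ} (hx : x.SuppLE N) :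
    (star x).SuppLE N := fun i j h => by rw [entry_star, hx j i h.symm, star_zero]

theorem SuppLE.mul {x y : FinSuppMatrix A} {N : ℕ} (hx : x.SuppLE N) (hy : y.SuppLE N) :
    (x * y).SuppLE N := fun i j h => by
  rw [entry_mul hx]
  refine Finset.sum_eq_zero fun k _ => ?_
  rcases h with h | h
  · rw [hx i k (Or.inl h), zero_mul]
  · rw [hy k j (Or.inr h), mul_zero]

/-- The upper left `N × N` corner of a matrix. -/
def corner (N : ℕ) (x : FinSuppMatrix A) : CStarMatrix (Fin N) (Fin N) A :=
  CStarMatrix.ofMatrix fun i j => x.entry i j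

theorem corner_apply (N : ℕ) (x : FinSuppMatrix A) (i j : Fin N) :
    corner N x i j = x.entry i j := rfl

theorem corner_mul {x : FinSuppMatrix A} {N : ℕ} (hx : x.SuppLE N) (y : FinSuppMatrix A) :
    corner N (x * y) = corner N x * corner N y := by
  ext i j
  rw [corner_apply, entry_mul hx, CStarMatrix.mul_apply]
  rfl

theorem corner_add (N : ℕ) (x y : FinSuppMatrix A) :
    corner N (x + y) = corner N x + corner N y := rfl

theorem corner_smul (N : ℕ) (c : ℂ) (x : FinSuppMatrix A) :
    corner N (c • x) = c • corner N x := rfl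

theorem corner_zero (N : ℕ) : corner N (0 : FinSuppMatrix A) = 0 := rfl

theorem corner_star (N : ℕ) (x : FinSuppMatrix A) :
    corner N (star x) = star (corner N x) := by
  ext i j
  rw [CStarMatrix.star_apply]
  rfl

theorem ext_corner {x y : FinSuppMatrix A} {N : ℕ} (hx : x.SuppLE N) (hy : y.SuppLE N)
    (h : corner N x = corner N y) : x = y := by
  ext i j
  by_cases hij : N ≤ i ∨ N ≤ j
  · rw [hx i j hij, hy i j hij]
  · push Not at hij
    exact congrFun (congrFun h ⟨i, hij.1⟩) ⟨j, hij.2⟩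

theorem exists_suppLE₃ (x y z : FinSuppMatrix A) :
    ∃ N, x.SuppLE N ∧ y.SuppLE N ∧ z.SuppLE N := by
  obtain ⟨N, hN⟩ := x.exists_suppLE
  obtain ⟨M, hM⟩ := y.exists_suppLE
  obtain ⟨K, hK⟩ := z.exists_suppLE
  exact ⟨max N (max M K), hN.mono (by omega), hM.mono (by omega), hK.mono (by omega)⟩

instance : NonUnitalRing (FinSuppMatrix A) where
  left_distrib x y z := by
    obtain ⟨N, hx, hy, hz⟩ := exists_suppLE₃ x y z
    refine ext_corner (hx.mul (hy.add hz)) ((hx.mul hy).add (hx.mul hz)) ?_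
    simp only [corner_mul hx, corner_add, mul_add]
  right_distrib x y z := by
    obtain ⟨N, hx, hy, hz⟩ := exists_suppLE₃ x y z
    refine ext_corner ((hx.add hy).mul hz) ((hx.mul hz).add (hy.mul hz)) ?_
    simp only [corner_mul hx, corner_mul hy, corner_mul (hx.add hy), corner_add, add_mul]
  zero_mul x := by
    ext i j
    rw [entry_mul (N := 0) (fun _ _ _ => rfl)]
    rfl
  mul_zero x := by
    obtain ⟨N, hx, -, -⟩ := exists_suppLE₃ x x x
    ext i j
    rw [entry_mul hx]
    simp [entry_zero]
  mul_assoc x y z := by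
    obtain ⟨N, hx, hy, hz⟩ := exists_suppLE₃ x y z
    refine ext_corner ((hx.mul hy).mul hz) (hx.mul (hy.mul hz)) ?_
    simp only [corner_mul hx, corner_mul hy, corner_mul (hx.mul hy), mul_assoc]

instance : StarRing (FinSuppMatrix A) where
  star_involutive x := by ext i j; simp only [entry_star, star_star]
  star_add x y := by ext i j; simp only [entry_star, entry_add, star_add]
  star_mul x y := by
    obtain ⟨N, hx, hy, -⟩ := exists_suppLE₃ x y y
    refine ext_corner (hx.mul hy).star (hy.star.mul hx.star) ?_
    simp only [corner_mul hx, corner_mul hy.star, corner_star, star_mul]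

instance : StarModule ℂ (FinSuppMatrix A) where
  star_smul c x := by ext i j; simp only [entry_star, entry_smul, star_smul]

instance : IsScalarTower ℂ (FinSuppMatrix A) (FinSuppMatrix A) where
  smul_assoc c x y := by
    obtain ⟨N, hx, hy, -⟩ := exists_suppLE₃ x y y
    ext i j
    simp only [smul_eq_mul, entry_mul (hx.smul c), entry_smul, entry_mul hx, Finset.smul_sum,
      smul_mul_assoc]

instance : SMulCommClass ℂ (FinSuppMatrix A) (FinSuppMatrix A) where
  smul_comm c x y := by
    obtain ⟨N, hx, hy, -⟩ := exists_suppLE₃ x y y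
    ext i j
    simp only [smul_eq_mul, entry_smul, entry_mul hx, Finset.smul_sum, mul_smul_comm]

/-- An `N × N` matrix, placed in the upper left corner of an infinite matrix. -/
def ofCorner {N : ℕ} (a : CStarMatrix (Fin N) (Fin N) A) : FinSuppMatrix A :=
  ⟨fun i j => if h : i < N ∧ j < N then a ⟨i, h.1⟩ ⟨j, h.2⟩ else 0,
    N, fun i j hij => dif_neg (by omega)⟩

theorem ofCorner_suppLE {N : ℕ} (a : CStarMatrix (Fin N) (Fin N) A) : (ofCorner a).SuppLE N :=
  fun _ _ hij => dif_neg (by omega)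

theorem corner_ofCorner {N : ℕ} (a : CStarMatrix (Fin N) (Fin N) A) :
    corner N (ofCorner a) = a := by
  ext i j
  exact dif_pos ⟨i.2, j.2⟩

theorem ofCorner_corner {N : ℕ} {x : FinSuppMatrix A} (hx : x.SuppLE N) :
    ofCorner (corner N x) = x :=
  ext_corner (ofCorner_suppLE _) hx (corner_ofCorner _)

/-- The inclusion of `M_N(A)` in `M_M(A)` as the upper left corner, for `N ≤ M`. -/
def cornerIncl {N M : ℕ} (h : N ≤ M) :
    CStarMatrix (Fin N) (Fin N) A →⋆ₙₐ[ℂ] CStarMatrix (Fin M) (Fin M) A where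
  toFun a := corner M (ofCorner a)
  map_smul' c a := by
    rw [← corner_smul]
    congr 1
    refine ext_corner (ofCorner_suppLE _) ((ofCorner_suppLE _).smul c) ?_
    rw [corner_ofCorner, corner_smul, corner_ofCorner]
    rfl
  map_zero' := by
    have h0 : (0 : FinSuppMatrix A).SuppLE N := fun _ _ _ => rfl
    have h1 : ofCorner (0 : CStarMatrix (Fin N) (Fin N) A) = 0 :=
      ext_corner (ofCorner_suppLE _) h0 (by rw [corner_ofCorner, corner_zero])
    rw [h1, corner_zero]
  map_add' a b := by
    rw [← corner_add]
    congr 1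
    refine ext_corner (ofCorner_suppLE _) ((ofCorner_suppLE _).add (ofCorner_suppLE _)) ?_
    rw [corner_ofCorner, corner_add, corner_ofCorner, corner_ofCorner]
  map_mul' a b := by
    rw [← corner_mul ((ofCorner_suppLE a).mono h)]
    congr 1
    refine ext_corner (ofCorner_suppLE _) ((ofCorner_suppLE _).mul (ofCorner_suppLE _)) ?_
    rw [corner_ofCorner, corner_mul (ofCorner_suppLE _), corner_ofCorner, corner_ofCorner]
  map_star' a := by
    rw [← corner_star]
    congr 1
    refine ext_corner (ofCorner_suppLE _) (ofCorner_suppLE _).star ?_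
    rw [corner_ofCorner, corner_star, corner_ofCorner]

theorem cornerIncl_injective {N M : ℕ} (h : N ≤ M) :
    Function.Injective (cornerIncl (A := A) h) := by
  intro a b hab
  have := ext_corner ((ofCorner_suppLE a).mono h) ((ofCorner_suppLE b).mono h) hab
  rw [← corner_ofCorner a, ← corner_ofCorner b, this]

end Algebra

section Norm

variable {A : Type u} [NonUnitalCStarAlgebra A] [PartialOrder A] [StarOrderedRing A]

/-- The C*-norm on `M_∞(A)`: the norm of `x` in any of the C*-algebras `M_N(A)` that contain it. -/
instance : Norm (FinSuppMatrix A) where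
  norm x := ‖corner x.exists_suppLE.choose x‖

theorem norm_corner_of_le {x : FinSuppMatrix A} {N M : ℕ} (hx : x.SuppLE N) (h : N ≤ M) :
    ‖corner M x‖ = ‖corner N x‖ := by
  rw [← NonUnitalStarAlgHom.norm_map (cornerIncl h) (cornerIncl_injective h) (corner N x)]
  change _ = ‖corner M (ofCorner (corner N x))‖
  rw [ofCorner_corner hx]

theorem norm_eq {x : FinSuppMatrix A} {N : ℕ} (hx : x.SuppLE N) : ‖x‖ = ‖corner N x‖ := by
  have hc : x.SuppLE _ := x.exists_suppLE.choose_spec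
  change ‖corner _ x‖ = _
  rw [← norm_corner_of_le hc (le_max_left _ N), ← norm_corner_of_le hx (le_max_right _ N)]

theorem normedSpaceCore : NormedSpace.Core ℂ (FinSuppMatrix A) where
  norm_nonneg x := norm_nonneg (corner _ x)
  norm_smul c x := by
    obtain ⟨N, hx⟩ := x.exists_suppLE
    rw [norm_eq hx, norm_eq (hx.smul c), corner_smul, norm_smul]
  norm_triangle x y := by
    obtain ⟨N, hx, hy, -⟩ := exists_suppLE₃ x y y
    rw [norm_eq hx, norm_eq hy, norm_eq (hx.add hy), corner_add]
    exact norm_add_le _ _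
  norm_eq_zero_iff x := by
    obtain ⟨N, hx⟩ := x.exists_suppLE
    rw [norm_eq hx, norm_eq_zero]
    exact ⟨fun h => ext_corner hx (fun _ _ _ => rfl) h, fun h => by rw [h]; rfl⟩

instance : NormedAddCommGroup (FinSuppMatrix A) := .ofCore normedSpaceCore

instance : NormedSpace ℂ (FinSuppMatrix A) := .ofCore normedSpaceCore

instance : NonUnitalNormedRing (FinSuppMatrix A) where
  __ : NonUnitalRing (FinSuppMatrix A) := inferInstance
  __ : NormedAddCommGroup (FinSuppMatrix A) := inferInstance
  norm_mul_le x y := by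
    obtain ⟨N, hx, hy, -⟩ := exists_suppLE₃ x y y
    rw [norm_eq hx, norm_eq hy, norm_eq (hx.mul hy), corner_mul hx]
    exact norm_mul_le _ _

instance : CStarRing (FinSuppMatrix A) where
  norm_mul_self_le x := by
    obtain ⟨N, hx⟩ := x.exists_suppLE
    rw [norm_eq hx, norm_eq (hx.star.mul hx), corner_mul hx.star, corner_star]
    exact (CStarRing.norm_star_mul_self (x := corner N x)).ge

end Norm

end FinSuppMatrix

/-- The stabilization `A ⊗ 𝒦` of `A`, where `𝒦` is the algebra of compact operators on a separable
infinite-dimensional Hilbert space: the completion of `M_∞(A)` in its C*-norm. -/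
def Stabilization (A : Type u) [NonUnitalCStarAlgebra A] [PartialOrder A] [StarOrderedRing A] :
    Type u :=
  UniformSpace.Completion (FinSuppMatrix A)

namespace Stabilization

open UniformSpace

variable {A : Type u} [NonUnitalCStarAlgebra A] [PartialOrder A] [StarOrderedRing A]

instance : NormedAddCommGroup (Stabilization A) :=
  inferInstanceAs (NormedAddCommGroup (Completion (FinSuppMatrix A)))

instance : NormedSpace ℂ (Stabilization A) :=
  inferInstanceAs (NormedSpace ℂ (Completion (FinSuppMatrix A)))

instance : CompleteSpace (Stabilization A) :=
  inferInstanceAs (CompleteSpace (Completion (FinSuppMatrix A)))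

/-- The canonical isometric embedding of `M_∞(A)` in `A ⊗ 𝒦`. -/
def of : FinSuppMatrix A →ₗᵢ[ℂ] Stabilization A := Completion.toComplₗᵢ

theorem isDenseInducing_of : IsDenseInducing (of : FinSuppMatrix A → Stabilization A) :=
  Completion.isDenseInducing_coe

theorem denseRange_of : DenseRange (of : FinSuppMatrix A → Stabilization A) :=
  isDenseInducing_of.dense

/-- The continuous extension of the multiplication of `M_∞(A)`. -/
instance : Mul (Stabilization A) where
  mul x y := (isDenseInducing_of.prodMap isDenseInducing_of).extend
    (fun p : FinSuppMatrix A × FinSuppMatrix A => of (p.1 * p.2)) (x, y)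

/-- The continuous extension of the involution of `M_∞(A)`. -/
instance : Star (Stabilization A) where
  star := isDenseInducing_of.extend fun x : FinSuppMatrix A => of (star x)

theorem of_mul (x y : FinSuppMatrix A) : of (x * y) = of x * of y :=
  ((isDenseInducing_of.prodMap isDenseInducing_of).extend_eq
    (of.continuous.comp continuous_mul) (x, y)).symm

theorem continuous_mul_aux : Continuous fun p : Stabilization A × Stabilization A => p.1 * p.2 := by
  let m := (AddMonoidHom.mul : FinSuppMatrix A →+ FinSuppMatrix A →+ FinSuppMatrix A).compr₂
    (of (A := A)).toLinearMap.toAddMonoidHom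
  have hm : Continuous fun p : FinSuppMatrix A × FinSuppMatrix A => m p.1 p.2 :=
    of.continuous.comp continuous_mul
  let e : FinSuppMatrix A →+ Stabilization A := (of (A := A)).toLinearMap.toAddMonoidHom
  have di : IsDenseInducing e := isDenseInducing_of
  exact (di.extend_Z_bilin di hm :)

theorem of_star (x : FinSuppMatrix A) : of (star x) = star (of x) :=
  (isDenseInducing_of.extend_eq (f := fun x : FinSuppMatrix A => of (star x))
    (of.continuous.comp (starₗᵢ (E := FinSuppMatrix A) ℂ).continuous) x).symm

theorem continuous_star_aux : Continuous (star : Stabilization A → Stabilization A) := by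
  have h : UniformContinuous fun x : FinSuppMatrix A => of (star x) :=
    of.isometry.uniformContinuous.comp (starₗᵢ (E := FinSuppMatrix A) ℂ).isometry.uniformContinuous
  exact (uniformContinuous_uniformly_extend
    (of (A := A)).isometry.isUniformInducing denseRange_of h).continuous

instance : ContinuousMul (Stabilization A) := ⟨continuous_mul_aux⟩

instance : ContinuousStar (Stabilization A) := ⟨continuous_star_aux⟩

instance : NonUnitalRing (Stabilization A) where
  left_distrib x y z := by
    refine denseRange_of.induction_on₃ (isClosed_eq (by fun_prop) (by fun_prop))
      (fun a b c => ?_) x y z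
    simp only [← map_add, ← of_mul, mul_add]
  right_distrib x y z := by
    refine denseRange_of.induction_on₃ (isClosed_eq (by fun_prop) (by fun_prop))
      (fun a b c => ?_) x y z
    simp only [← map_add, ← of_mul, add_mul]
  zero_mul x := by
    refine denseRange_of.induction_on x (isClosed_eq (by fun_prop) (by fun_prop)) fun a => ?_
    rw [← map_zero of, ← of_mul, zero_mul]
  mul_zero x := by
    refine denseRange_of.induction_on x (isClosed_eq (by fun_prop) (by fun_prop)) fun a => ?_
    rw [← map_zero of, ← of_mul, mul_zero]
  mul_assoc x y z := by
    refine denseRange_of.induction_on₃ (isClosed_eq (by fun_prop) (by fun_prop))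
      (fun a b c => ?_) x y z
    simp only [← of_mul, mul_assoc]

instance : NonUnitalNormedRing (Stabilization A) where
  __ : NonUnitalRing (Stabilization A) := inferInstance
  __ : NormedAddCommGroup (Stabilization A) := inferInstance
  norm_mul_le x y := by
    refine denseRange_of.induction_on₂ (isClosed_le (by fun_prop) (by fun_prop))
      (fun a b => ?_) x y
    simpa only [← of_mul, of.norm_map] using norm_mul_le a b

instance : StarRing (Stabilization A) where
  star_involutive x := by
    refine denseRange_of.induction_on x (isClosed_eq (by fun_prop) (by fun_prop)) fun a => ?_
    simp only [← of_star, star_star]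
  star_add x y := by
    refine denseRange_of.induction_on₂ (isClosed_eq (by fun_prop) (by fun_prop))
      (fun a b => ?_) x y
    simp only [← map_add, ← of_star, star_add]
  star_mul x y := by
    refine denseRange_of.induction_on₂ (isClosed_eq (by fun_prop) (by fun_prop))
      (fun a b => ?_) x y
    simp only [← of_mul, ← of_star, star_mul]

instance : CStarRing (Stabilization A) where
  norm_mul_self_le x := by
    refine denseRange_of.induction_on x (isClosed_le (by fun_prop) (by fun_prop)) fun a => ?_
    simpa only [← of_star, ← of_mul, of.norm_map] using CStarRing.norm_mul_self_le a

theorem continuous_smul_aux (c : ℂ) : Continuous fun x : Stabilization A => c • x :=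
  continuous_const_smul c

instance : IsScalarTower ℂ (Stabilization A) (Stabilization A) where
  smul_assoc c x y := by
    have h1 : Continuous fun p : Stabilization A × Stabilization A => (c • p.1) * p.2 :=
      ((continuous_smul_aux c).comp continuous_fst).mul continuous_snd
    have h2 : Continuous fun p : Stabilization A × Stabilization A => c • (p.1 * p.2) :=
      (continuous_smul_aux c).comp continuous_mul
    refine denseRange_of.induction_on₂ (p := fun x y => (c • x) * y = c • (x * y))
      (isClosed_eq h1 h2) (fun a b => ?_) x y
    simp only [← map_smul, ← of_mul, smul_mul_assoc]

instance : SMulCommClass ℂ (Stabilization A) (Stabilization A) where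
  smul_comm c x y := by
    have h1 : Continuous fun p : Stabilization A × Stabilization A => c • (p.1 * p.2) :=
      (continuous_smul_aux c).comp continuous_mul
    have h2 : Continuous fun p : Stabilization A × Stabilization A => p.1 * (c • p.2) :=
      continuous_fst.mul ((continuous_smul_aux c).comp continuous_snd)
    refine denseRange_of.induction_on₂ (p := fun x y => c • (x * y) = x * (c • y))
      (isClosed_eq h1 h2) (fun a b => ?_) x y
    simp only [← map_smul, ← of_mul, mul_smul_comm]

instance : StarModule ℂ (Stabilization A) where
  star_smul c x := by
    have h1 : Continuous fun x : Stabilization A => star (c • x) :=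
      continuous_star.comp (continuous_smul_aux c)
    have h2 : Continuous fun x : Stabilization A => star c • star x :=
      (continuous_smul_aux _).comp continuous_star
    refine denseRange_of.induction_on (p := fun x => star (c • x) = star c • star x) x
      (isClosed_eq h1 h2) fun a => ?_
    simp only [← map_smul, ← of_star, star_smul]

instance : NonUnitalCStarAlgebra (Stabilization A) where

/-- The order for which the positive elements are those of the form `x* x`. -/
instance : PartialOrder (Stabilization A) := CStarAlgebra.spectralOrder _

instance : StarOrderedRing (Stabilization A) := CStarAlgebra.spectralOrderedRing _

end Stabilization

/-! ### The Cuntz semigroup -/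

section Cuntz

variable {B : Type u} [NonUnitalCStarAlgebra B]

/-- The block diagonal sum of two matrices. -/
def blockSum {m n m' n' : Type} (a : CStarMatrix m n B) (b : CStarMatrix m' n' B) :
    CStarMatrix (m ⊕ m') (n ⊕ n') B :=
  CStarMatrix.ofMatrix (Matrix.fromBlocks a 0 0 b)

section blockSum

variable {m n m' n' : Type} (a : CStarMatrix m n B) (b : CStarMatrix m' n' B)

theorem blockSum_inl_inl (i : m) (j : n) : blockSum a b (Sum.inl i) (Sum.inl j) = a i j := rfl

theorem blockSum_inl_inr (i : m) (j : n') : blockSum a b (Sum.inl i) (Sum.inr j) = 0 := rfl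

theorem blockSum_inr_inl (i : m') (j : n) : blockSum a b (Sum.inr i) (Sum.inl j) = 0 := rfl

theorem blockSum_inr_inr (i : m') (j : n') : blockSum a b (Sum.inr i) (Sum.inr j) = b i j := rfl

end blockSum

namespace CuntzLE

theorem conj_apply {m n : Type} [Fintype n] (x : CStarMatrix n m B) (b : CStarMatrix n n B) (i j : m) :
    (x.conjTranspose * b * x) i j = ∑ k, (∑ l, star (x l i) * b l k) * x k j := rfl

theorem tendsto_iff {m n : Type} {ι : Type*} {f : Filter ι} {y : ι → CStarMatrix m n B}
    {a : CStarMatrix m n B} :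
    Tendsto y f (𝓝 a) ↔ ∀ i j, Tendsto (fun k => y k i j) f (𝓝 (a i j)) := by
  have h : ∀ (y' : ι → m → n → B) (a' : m → n → B),
      Tendsto y' f (𝓝 a') ↔ ∀ i j, Tendsto (fun k => y' k i j) f (𝓝 (a' i j)) := fun y' a' => by
    rw [tendsto_pi_nhds]
    exact forall_congr' fun i => tendsto_pi_nhds
  exact h y a

theorem conj_conj {l m n : Type} [Fintype l] [Fintype n] (b : CStarMatrix l l B) (y : CStarMatrix l n B) (x : CStarMatrix n m B) :
    x.conjTranspose * (y.conjTranspose * b * y) * x = (y * x).conjTranspose * b * (y * x) := by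
  have h : (y * x).conjTranspose = x.conjTranspose * y.conjTranspose :=
    Matrix.conjTranspose_mul (M := y) (N := x)
  rw [h]
  let X : Matrix n m B := x
  let Y : Matrix l n B := y
  let b' : Matrix l l B := b
  change X.conjTranspose * (Y.conjTranspose * b' * Y) * X
    = (X.conjTranspose * Y.conjTranspose) * b' * (Y * X)
  simp only [Matrix.mul_assoc]

end CuntzLE

variable [PartialOrder B] [StarOrderedRing B]

/-- Cuntz subequivalence `a ≾ b` of square matrices over `B`, of possibly different sizes: there is
a sequence of rectangular matrices `x k` such that `(x k)* b (x k)` converges to `a`. -/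
def CuntzLE {m n : Type} [Fintype m] [Fintype n] (a : CStarMatrix m m B) (b : CStarMatrix n n B) :
    Prop :=
  ∃ x : ℕ → CStarMatrix n m B, Tendsto (fun k => (x k).conjTranspose * b * x k) atTop (𝓝 a)

namespace CuntzLE

variable {l m n m' n' : Type} [Fintype l] [Fintype m] [Fintype n] [Fintype m'] [Fintype n']

theorem iff_mem_closure {a : CStarMatrix m m B} {b : CStarMatrix n n B} :
    CuntzLE a b ↔
      a ∈ closure (Set.range fun x : CStarMatrix n m B => x.conjTranspose * b * x) := by
  rw [mem_closure_iff_seq_limit]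
  constructor
  · rintro ⟨x, hx⟩
    exact ⟨_, fun k => ⟨x k, rfl⟩, hx⟩
  · rintro ⟨y, hy, hlim⟩
    choose x hx using hy
    exact ⟨x, by simpa only [hx] using hlim⟩

theorem refl (a : CStarMatrix m m B) : CuntzLE a a := by
  rw [iff_mem_closure]
  let l := CStarAlgebra.approximateUnit (CStarMatrix m m B)
  have hl : l.IsIncreasingApproximateUnit :=
    CStarAlgebra.increasingApproximateUnit (CStarMatrix m m B)
  have : l.NeBot := hl.neBot
  have h1 : Tendsto (fun e => e * a * e) l (𝓝 a) := by
    rw [tendsto_iff_norm_sub_tendsto_zero]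
    have hR := tendsto_iff_norm_sub_tendsto_zero.1 (hl.tendsto_mul_right a)
    have hL := tendsto_iff_norm_sub_tendsto_zero.1 (hl.tendsto_mul_left a)
    refine squeeze_zero' (Eventually.of_forall fun _ => norm_nonneg _) ?_
      (by simpa using hR.add hL)
    filter_upwards [hl.eventually_norm] with e he
    have : e * a * e - a = (e * a - a) * e + (a * e - a) := by rw [sub_mul]; abel
    rw [this]
    refine (norm_add_le _ _).trans ?_
    have h2 : ‖(e * a - a) * e‖ ≤ ‖e * a - a‖ :=
      (norm_mul_le _ _).trans (mul_le_of_le_one_right (norm_nonneg _) he)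
    linarith
  have h2 : ∀ᶠ e in l, e * a * e ∈
      Set.range fun x : CStarMatrix m m B => x.conjTranspose * a * x := by
    filter_upwards [hl.eventually_star_eq] with e he
    refine ⟨e, ?_⟩
    rw [CStarMatrix.star_eq_conjTranspose] at he
    simp only [he]
  exact mem_closure_of_tendsto h1 h2

theorem trans {a : CStarMatrix m m B} {b : CStarMatrix n n B} {c : CStarMatrix l l B}
    (hab : CuntzLE a b) (hbc : CuntzLE b c) : CuntzLE a c := by
  rw [iff_mem_closure] at *
  refine closure_minimal ?_ isClosed_closure hab
  rintro _ ⟨x, rfl⟩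
  have hc : Continuous fun z : CStarMatrix n n B => x.conjTranspose * z * x := by
    refine continuous_iff_continuousAt.2 fun z => ?_
    rw [ContinuousAt, tendsto_iff]
    intro i j
    simp only [conj_apply]
    refine tendsto_finsetSum _ fun k _ => Tendsto.mul_const _ (tendsto_finsetSum _ fun p _ =>
      Tendsto.const_mul _ ?_)
    exact tendsto_iff.1 tendsto_id p k
  refine map_mem_closure (f := fun z : CStarMatrix n n B => x.conjTranspose * z * x) hc hbc ?_
  rintro _ ⟨y, rfl⟩
  exact ⟨y * x, (conj_conj c y x).symm⟩

theorem of_equiv {s : Type} {a : CStarMatrix m m B} {b : CStarMatrix n n B} (e : s ≃ m)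
    (e' : s ≃ n) (h : ∀ i j, a (e i) (e j) = b (e' i) (e' j)) : CuntzLE a b := by
  obtain ⟨x, hx⟩ := refl b
  let f : m ≃ n := e.symm.trans e'
  refine ⟨fun k => CStarMatrix.ofMatrix fun p q => x k p (f q), tendsto_iff.2 fun i j => ?_⟩
  have h1 := tendsto_iff.1 hx (f i) (f j)
  have h2 : b (f i) (f j) = a i j := by
    simpa [f] using (h (e.symm i) (e.symm j)).symm
  rw [← h2]
  exact h1

theorem blockSum_mono {a : CStarMatrix m m B} {b : CStarMatrix n n B} {a' : CStarMatrix m' m' B}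
    {b' : CStarMatrix n' n' B} (ha : CuntzLE a a') (hb : CuntzLE b b') :
    CuntzLE (blockSum a b) (blockSum a' b') := by
  obtain ⟨x, hx⟩ := ha
  obtain ⟨y, hy⟩ := hb
  refine ⟨fun k => blockSum (x k) (y k),
    tendsto_iff.2 fun i j => ?_⟩
  have hx' := fun i j => tendsto_iff.1 hx i j
  have hy' := fun i j => tendsto_iff.1 hy i j
  simp only [conj_apply] at hx' hy' ⊢
  rcases i with i | i <;> rcases j with j | j <;>
    simp only [Fintype.sum_sum_type, blockSum_inl_inl, blockSum_inl_inr, blockSum_inr_inl,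
      blockSum_inr_inr, star_zero, mul_zero, zero_mul, add_zero, zero_add, Finset.sum_const_zero]
  · exact hx' i j
  · exact tendsto_const_nhds
  · exact tendsto_const_nhds
  · exact hy' i j

end CuntzLE

theorem exists_eq_star_mul_self {C : Type u} [NonUnitalCStarAlgebra C] [PartialOrder C]
    [StarOrderedRing C] {c : C} (hc : 0 ≤ c) : ∃ x : C, c = star x * x :=
  CStarAlgebra.nonneg_iff_eq_star_mul_self.1 hc

theorem blockSum_nonneg {m n : Type} [Fintype m] [Fintype n] {a : CStarMatrix m m B}
    {b : CStarMatrix n n B} (ha : 0 ≤ a) (hb : 0 ≤ b) : 0 ≤ blockSum a b := by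
  obtain ⟨x, rfl⟩ := exists_eq_star_mul_self ha
  obtain ⟨y, rfl⟩ := exists_eq_star_mul_self hb
  have h : blockSum (star x * x) (star y * y) = star (blockSum x y) * blockSum x y := by
    ext i j
    rcases i with i | i <;> rcases j with j | j <;>
      simp only [CStarMatrix.mul_apply, CStarMatrix.star_apply, Fintype.sum_sum_type,
        blockSum_inl_inl, blockSum_inl_inr, blockSum_inr_inl, blockSum_inr_inr, star_zero,
        mul_zero, zero_mul, add_zero, zero_add, Finset.sum_const_zero]
  rw [h]
  exact star_mul_self_nonneg _

/-- The positive elements of the matrix algebras `Mₙ(B)`, for all `n`. -/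
structure PosMatrix (B : Type u) [NonUnitalCStarAlgebra B] [PartialOrder B] [StarOrderedRing B] :
    Type u where
  /-- The size of the matrix. -/
  size : ℕ
  /-- The matrix. -/
  mat : CStarMatrix (Fin size) (Fin size) B
  nonneg : 0 ≤ mat

namespace PosMatrix

/-- The preorder is Cuntz subequivalence. -/
instance : Preorder (PosMatrix B) where
  le a b := CuntzLE a.mat b.mat
  le_refl a := CuntzLE.refl a.mat
  le_trans _ _ _ hab hbc := CuntzLE.trans hab hbc

theorem le_def {a b : PosMatrix B} : a ≤ b ↔ CuntzLE a.mat b.mat := Iff.rfl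

/-- The sum `a ⊕ b` is block diagonal. -/
instance : Add (PosMatrix B) where
  add a b :=
    { size := a.size + b.size
      mat := CStarMatrix.reindexₐ ℂ B finSumFinEquiv (blockSum a.mat b.mat)
      nonneg := map_nonneg _ (blockSum_nonneg a.nonneg b.nonneg) }

/-- The matrix of size zero. -/
instance : Zero (PosMatrix B) where
  zero := { size := 0, mat := 0, nonneg := le_rfl }

theorem le_of_equiv {a b : PosMatrix B} {s : Type} (e : s ≃ Fin a.size) (e' : s ≃ Fin b.size)
    (h : ∀ i j, a.mat (e i) (e j) = b.mat (e' i) (e' j)) : a ≤ b :=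
  CuntzLE.of_equiv e e' h

theorem add_mat_apply (a b : PosMatrix B) (i j : Fin a.size ⊕ Fin b.size) :
    (a + b).mat (finSumFinEquiv i) (finSumFinEquiv j) = blockSum a.mat b.mat i j := by
  change blockSum a.mat b.mat (finSumFinEquiv.symm (finSumFinEquiv i))
    (finSumFinEquiv.symm (finSumFinEquiv j)) = _
  rw [Equiv.symm_apply_apply, Equiv.symm_apply_apply]

theorem add_mono {a b a' b' : PosMatrix B} (ha : a ≤ a') (hb : b ≤ b') : a + b ≤ a' + b' := by
  have h1 : CuntzLE (a + b).mat (blockSum a.mat b.mat) :=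
    CuntzLE.of_equiv finSumFinEquiv (Equiv.refl _) (add_mat_apply a b)
  have h2 : CuntzLE (blockSum a'.mat b'.mat) (a' + b').mat :=
    CuntzLE.of_equiv (Equiv.refl _) finSumFinEquiv fun i j => (add_mat_apply a' b' i j).symm
  exact (h1.trans (CuntzLE.blockSum_mono ha hb)).trans h2

theorem add_comm_le (a b : PosMatrix B) : a + b ≤ b + a := by
  refine le_of_equiv (a := a + b) (b := b + a) finSumFinEquiv
    ((Equiv.sumComm _ _).trans finSumFinEquiv) fun i j => ?_
  rw [add_mat_apply, Equiv.trans_apply, Equiv.trans_apply, add_mat_apply]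
  rcases i with i | i <;> rcases j with j | j <;> rfl

theorem add_assoc_equiv (a b c : PosMatrix B) (i j : (Fin a.size ⊕ Fin b.size) ⊕ Fin c.size) :
    (a + b + c).mat (finSumFinEquiv ((finSumFinEquiv.sumCongr (Equiv.refl _)) i))
        (finSumFinEquiv ((finSumFinEquiv.sumCongr (Equiv.refl _)) j)) =
      (a + (b + c)).mat
        (finSumFinEquiv (((Equiv.refl _).sumCongr finSumFinEquiv) (Equiv.sumAssoc _ _ _ i)))
        (finSumFinEquiv (((Equiv.refl _).sumCongr finSumFinEquiv) (Equiv.sumAssoc _ _ _ j))) := by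
  have h1 := add_mat_apply (a + b) c
  have h2 := add_mat_apply a (b + c)
  rw [h1, h2]
  have h3 := fun i j => add_mat_apply a b i j
  have h4 := fun i j => add_mat_apply b c i j
  rcases i with (i | i) | i <;> rcases j with (j | j) | j
  · exact h3 (Sum.inl i) (Sum.inl j)
  · exact h3 (Sum.inl i) (Sum.inr j)
  · rfl
  · exact h3 (Sum.inr i) (Sum.inl j)
  · exact (h3 (Sum.inr i) (Sum.inr j)).trans (h4 (Sum.inl i) (Sum.inl j)).symm
  · exact (h4 (Sum.inl i) (Sum.inr j)).symm
  · rfl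
  · exact (h4 (Sum.inr i) (Sum.inl j)).symm
  · exact (h4 (Sum.inr i) (Sum.inr j)).symm

theorem add_assoc_le (a b c : PosMatrix B) : a + b + c ≤ a + (b + c) :=
  le_of_equiv (a := a + b + c) (b := a + (b + c))
    ((finSumFinEquiv.sumCongr (Equiv.refl _)).trans finSumFinEquiv)
    ((Equiv.sumAssoc _ _ _).trans (((Equiv.refl _).sumCongr finSumFinEquiv).trans finSumFinEquiv))
    (add_assoc_equiv a b c)

theorem le_add_assoc (a b c : PosMatrix B) : a + (b + c) ≤ a + b + c :=
  le_of_equiv (a := a + (b + c)) (b := a + b + c)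
    ((Equiv.sumAssoc _ _ _).trans (((Equiv.refl _).sumCongr finSumFinEquiv).trans finSumFinEquiv))
    ((finSumFinEquiv.sumCongr (Equiv.refl _)).trans finSumFinEquiv)
    fun i j => (add_assoc_equiv a b c i j).symm

theorem add_zero_equiv (a : PosMatrix B) (i j : Fin a.size ⊕ Fin 0) :
    (a + 0).mat (finSumFinEquiv (n := 0) i) (finSumFinEquiv (n := 0) j) =
      a.mat (Equiv.sumEmpty (Fin a.size) (Fin 0) i) (Equiv.sumEmpty (Fin a.size) (Fin 0) j) := by
  refine (add_mat_apply a 0 i j).trans ?_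
  rcases i with i | i
  · rcases j with j | j
    · rfl
    · exact j.elim0
  · exact i.elim0

theorem add_zero_le (a : PosMatrix B) : a + 0 ≤ a :=
  le_of_equiv (a := a + 0) (b := a) (finSumFinEquiv (n := 0)) (Equiv.sumEmpty _ _)
    (add_zero_equiv a)

theorem le_add_zero (a : PosMatrix B) : a ≤ a + 0 :=
  le_of_equiv (a := a) (b := a + 0) (Equiv.sumEmpty _ _) (finSumFinEquiv (n := 0))
    fun i j => (add_zero_equiv a i j).symm

end PosMatrix

/-- The Cuntz semigroup `W(B)`: the positive elements of the matrix algebras `Mₙ(B)`, up to Cuntz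
equivalence (`a ≾ b` and `b ≾ a`), ordered by Cuntz subequivalence. -/
def CuntzSemigroup (B : Type u) [NonUnitalCStarAlgebra B] [PartialOrder B] [StarOrderedRing B] :
    Type u :=
  Antisymmetrization (PosMatrix B) (· ≤ ·)

namespace CuntzSemigroup

instance : PartialOrder (CuntzSemigroup B) :=
  inferInstanceAs (PartialOrder (Antisymmetrization (PosMatrix B) (· ≤ ·)))

/-- The class `[a]` of a positive matrix. -/
def mk (a : PosMatrix B) : CuntzSemigroup B := toAntisymmetrization (· ≤ ·) a

theorem mk_le_mk {a b : PosMatrix B} : mk a ≤ mk b ↔ a ≤ b := Iff.rfl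

theorem mk_eq_mk {a b : PosMatrix B} (hab : a ≤ b) (hba : b ≤ a) : mk a = mk b :=
  le_antisymm (mk_le_mk.2 hab) (mk_le_mk.2 hba)

theorem ind {p : CuntzSemigroup B → Prop} (h : ∀ a, p (mk a)) (x : CuntzSemigroup B) : p x :=
  Quotient.inductionOn x h

/-- `[a] + [b] = [a ⊕ b]`. -/
instance : Add (CuntzSemigroup B) where
  add := Quotient.map₂ (· + ·) fun _ _ h₁ _ _ h₂ =>
    ⟨PosMatrix.add_mono h₁.1 h₂.1, PosMatrix.add_mono h₁.2 h₂.2⟩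

instance : Zero (CuntzSemigroup B) where
  zero := mk 0

theorem mk_add (a b : PosMatrix B) : mk (a + b) = mk a + mk b := rfl

theorem mk_zero : mk (0 : PosMatrix B) = 0 := rfl

theorem add_comm_aux (x y : CuntzSemigroup B) : x + y = y + x := by
  induction x using ind with | _ a
  induction y using ind with | _ b
  exact mk_eq_mk (PosMatrix.add_comm_le a b) (PosMatrix.add_comm_le b a)

theorem add_zero_aux (x : CuntzSemigroup B) : x + 0 = x := by
  induction x using ind with | _ a
  exact mk_eq_mk (PosMatrix.add_zero_le a) (PosMatrix.le_add_zero a)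

instance : AddCommMonoid (CuntzSemigroup B) where
  add_assoc x y z := by
    induction x using ind with | _ a
    induction y using ind with | _ b
    induction z using ind with | _ c
    exact mk_eq_mk (PosMatrix.add_assoc_le a b c) (PosMatrix.le_add_assoc a b c)
  zero_add x := by rw [add_comm_aux, add_zero_aux]
  add_zero := add_zero_aux
  add_comm := add_comm_aux
  nsmul := nsmulRec

instance : IsOrderedAddMonoid (CuntzSemigroup B) where
  add_le_add_left x y hxy z := by
    induction x using ind with | _ a
    induction y using ind with | _ b
    induction z using ind with | _ c
    exact PosMatrix.add_mono hxy (le_refl c)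

end CuntzSemigroup

end Cuntz

/-- The stabilized Cuntz semigroup `Cu(A) = W(A ⊗ 𝒦)`. -/
abbrev Cu (A : Type u) [NonUnitalCStarAlgebra A] [PartialOrder A] [StarOrderedRing A] : Type u :=
  CuntzSemigroup (Stabilization A)

/-! ### The `n`-comparison property -/

/-- The relation `x ≤ₛ y` in an ordered semigroup: `(k + 1) x ≤ k y` for some `k ≥ 1`. -/
def StablyLE {S : Type u} [AddCommMonoid S] [PartialOrder S] (x y : S) : Prop :=
  ∃ k : ℕ, 0 < k ∧ (k + 1) • x ≤ k • y

/-- The `n`-comparison property of an ordered semigroup. -/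
def HasNComparison (S : Type u) [AddCommMonoid S] [PartialOrder S] (n : ℕ) : Prop :=
  ∀ (x : S) (y : Fin (n + 1) → S), (∀ i, StablyLE x (y i)) → x ≤ ∑ i, y i

/-! ### Nuclear dimension -/

/-- A finite-dimensional C*-algebra. -/
structure FinDimCStarAlgebra : Type (u + 1) where
  /-- The underlying type. -/
  carrier : Type u
  [cstarAlgebra : NonUnitalCStarAlgebra carrier]
  [partialOrder : PartialOrder carrier]
  [starOrderedRing : StarOrderedRing carrier]
  [finiteDimensional : FiniteDimensional ℂ carrier]

namespace FinDimCStarAlgebra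

instance : CoeSort FinDimCStarAlgebra.{u} (Type u) := ⟨carrier⟩

attribute [instance] cstarAlgebra partialOrder starOrderedRing finiteDimensional

end FinDimCStarAlgebra

section NuclearDimension

variable {A₁ A₂ : Type u} [NonUnitalCStarAlgebra A₁] [PartialOrder A₁] [StarOrderedRing A₁]
  [NonUnitalCStarAlgebra A₂] [PartialOrder A₂] [StarOrderedRing A₂]

/-- A completely positive map is a contraction. -/
def IsContraction (φ : CompletelyPositiveMap A₁ A₂) : Prop := ∀ a, ‖φ a‖ ≤ ‖a‖

/-- A completely positive map has order zero: it preserves orthogonality of positive elements. -/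
def IsOrderZero (φ : CompletelyPositiveMap A₁ A₂) : Prop :=
  ∀ a b, 0 ≤ a → 0 ≤ b → a * b = 0 → φ a * φ b = 0

/-- There are nets of c.p.c. maps `ψ i l : A → F i l` and c.p.c. order zero maps `φ i l : F i l → A`,
for `i = 0, …, n`, with `F i l` finite-dimensional, such that `∑ i, φ i l (ψ i l a)` converges
to `a` for every `a`. -/
def HasDecomposableApproximations (A : Type u) [NonUnitalCStarAlgebra A] [PartialOrder A]
    [StarOrderedRing A] (n : ℕ) : Prop :=
  ∃ (Λ : Type u) (_ : Preorder Λ) (_ : IsDirectedOrder Λ) (_ : Nonempty Λ)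
    (F : Fin (n + 1) → Λ → FinDimCStarAlgebra.{u})
    (ψ : ∀ i l, CompletelyPositiveMap A (F i l))
    (φ : ∀ i l, CompletelyPositiveMap (F i l) A),
    (∀ i l, IsContraction (ψ i l)) ∧ (∀ i l, IsContraction (φ i l)) ∧
    (∀ i l, IsOrderZero (φ i l)) ∧
    ∀ a, Tendsto (fun l => ∑ i, φ i l (ψ i l a)) atTop (𝓝 a)

/-- `A` has nuclear dimension `n`: `n` is the smallest natural number for which such approximations
exist. -/
def HasNuclearDimension (A : Type u) [NonUnitalCStarAlgebra A] [PartialOrder A]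
    [StarOrderedRing A] (n : ℕ) : Prop :=
  IsLeast {m : ℕ | HasDecomposableApproximations A m} n

end NuclearDimension

end

noncomputable section

open Filter Topology

universe u

/-! ### Finite-dimensional C*-algebras -/

section FiniteDim

variable {F : Type*} [CStarAlgebra F] [FiniteDimensional ℂ F]

/-! Write θᵢ = φᵢ ∘ ψᵢ for the summands ("colours") of the approximation. The colours are treated
separately: if k[a] ≤ k[b], then far out in the net θᵢ(a) is close to some x* b x. Since a is close
to ∑ θᵢ(a), it is then close to ∑ xᵢ* bᵢ xᵢ, which gives [a] ≤ ∑ [bᵢ]. The multiplicity k is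
cancelled inside the finite-dimensional algebras, where projections are compared by their ranks in
the simple summands.

The relation 1 ⊗ a ≈ v*(1 ⊗ b)v has to survive ψᵢ, which need not be asymptotically multiplicative.
What holds is that each θᵢ is asymptotically an A-bimodule map, because it is dominated by maps
converging to the identity (`tendsto_map_mul_sub_map_mul`). Hence θ(x)θ(yw) ≈ θ(x)yθ(w) ≈ θ(xy)θ(w).
By the rule φ(x)φ(y) = φ(1)φ(xy) for order zero maps (`orderZero_mul`), this says that φ(1)φ(c) → 0
for c = ψ(x)ψ(yw) − ψ(xy)ψ(w). To conclude that c itself is small, `exists_central_cut` discards a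
direct summand on which φ is small; on the other one φ(1)φ(·) controls the norm. The cut-down ψ is
therefore asymptotically associative: ψ(x)ψ(yw) ≈ ψ(xy)ψ(w). This yields ψ(a)ψ(v*bv)ψ(a) ≈
ψ(av*)ψ(b)ψ(va) in the amplifications.

Let p and q be spectral projections of ψ(a) and ψ(b), cutting off small eigenvalues. The last
relation makes k copies of p factor through k copies of q, so that p is equivalent to a
subprojection of q (`exists_partialIsometry_of_diagCopies`). Then (ψ(a)p)⁴ = r*ψ(b)²r exactly, for
some r. The order zero rule carries this identity through φ, the bimodule property replaces θ(b)² by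
θ(s)bθ(s) with s = √b, and functional calculus undoes the fourth power. This is
`exists_conj_approx_of_diagCopies`.

The resulting estimate `exists_sum_conj_approx` has an error independent of the size of the
matrices, so it extends to matrices over A ⊗ 𝒦 by compression to blocks in M_N(A)
(`exists_sum_conj_approx_stabilization`). -/

theorem finite_spectrum_real (x : F) : (spectrum ℝ x).Finite := by
  have : FiniteDimensional ℝ F := Module.Finite.trans ℂ F
  have hint : IsIntegral ℝ x := IsIntegral.of_finite ℝ x
  have hne : minpoly ℝ x ≠ 0 := minpoly.ne_zero hint
  refine (minpoly ℝ x).roots.toFinset.finite_toSet.subset fun t ht => ?_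
  rcases subsingleton_or_nontrivial F with h | h
  · simp at ht
  have h1 := spectrum.subset_polynomial_aeval x (minpoly ℝ x) ⟨t, ht, rfl⟩
  rw [minpoly.aeval, spectrum.zero_eq] at h1
  simpa [hne] using h1

/-- A finite set is discrete, so characteristic functions, and with them spectral projections, are
available in the continuous functional calculus. -/
theorem continuousOn_spectrum_of_finiteDimensional (x : F) (f : ℝ → ℝ) :
    ContinuousOn f (spectrum ℝ x) :=
  (finite_spectrum_real x).continuousOn f

theorem cfc_mul_of_finiteDimensional (x : F) (f g : ℝ → ℝ) :
    cfc (fun t => f t * g t) x = cfc f x * cfc g x :=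
  cfc_mul f g x (continuousOn_spectrum_of_finiteDimensional x f)
    (continuousOn_spectrum_of_finiteDimensional x g)

theorem cfc_mul_self_of_finiteDimensional {x : F} (hx : IsSelfAdjoint x) (f : ℝ → ℝ) :
    cfc f x * x = cfc (fun t => f t * t) x := by
  rw [cfc_mul_of_finiteDimensional, cfc_id' ℝ x]

theorem self_mul_cfc_of_finiteDimensional {x : F} (hx : IsSelfAdjoint x) (f : ℝ → ℝ) :
    x * cfc f x = cfc (fun t => t * f t) x := by
  rw [cfc_mul_of_finiteDimensional, cfc_id' ℝ x]

/-- Spectral truncation: the spectral projection `p` of `X` for `(δ, ∞)`, and the inverse `y` of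
`X` on its range. -/
theorem exists_spectral_truncation [PartialOrder F] [StarOrderedRing F] {X : F} (hX : 0 ≤ X)
    {δ : ℝ} (hδ : 0 < δ) :
    ∃ p y : F, IsStarProjection p ∧ IsSelfAdjoint y ∧ y * X = p ∧ X * y = p ∧ ‖y‖ ≤ δ⁻¹ ∧
      X * p = p * X ∧ 0 ≤ X - X * p ∧ ‖X - X * p‖ ≤ δ := by
  have hXs : IsSelfAdjoint X := .of_nonneg hX
  let f : ℝ → ℝ := fun t => if δ < t then t⁻¹ else 0
  let χ : ℝ → ℝ := fun t => if δ < t then 1 else 0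
  have hid : cfc (fun t : ℝ => t) X = X := cfc_id' ℝ X
  have hfX : ∀ t, f t * t = χ t := fun t => by
    simp only [f, χ]; split_ifs with h
    · exact inv_mul_cancel₀ (hδ.trans h).ne'
    · exact zero_mul t
  have h1 : cfc f X * X = cfc χ X := by
    simp only [cfc_mul_self_of_finiteDimensional hXs, hfX]
  have h2 : X * cfc f X = cfc χ X := by
    simp only [self_mul_cfc_of_finiteDimensional hXs, mul_comm _ (f _), hfX]
  have h3 : X - X * cfc χ X = cfc (fun t => t - t * χ t) X := by
    rw [cfc_sub (fun t : ℝ => t) (fun t => t * χ t) X (by fun_prop)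
      (continuousOn_spectrum_of_finiteDimensional X _), cfc_mul_of_finiteDimensional, hid]
  have h4 : X * cfc χ X = cfc χ X * X := by
    simp only [self_mul_cfc_of_finiteDimensional hXs, cfc_mul_self_of_finiteDimensional hXs,
      mul_comm]
  refine ⟨cfc χ X, cfc f X, ⟨?_, cfc_predicate χ X⟩, cfc_predicate f X, h1, h2, ?_, h4, ?_, ?_⟩
  · rw [IsIdempotentElem, ← cfc_mul_of_finiteDimensional]
    congr 1
    funext t
    simp only [χ]; split_ifs <;> simp
  · refine norm_cfc_le (by positivity) fun t ht => ?_
    simp only [f]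
    split_ifs with h
    · rw [Real.norm_of_nonneg (by have := hδ.trans h; positivity)]
      exact inv_anti₀ hδ h.le
    · simpa using hδ.le
  · rw [h3]
    refine cfc_nonneg fun t ht => ?_
    have := spectrum_nonneg_of_nonneg hX ht
    simp only [χ]; split_ifs <;> simp [this]
  · rw [h3]
    refine norm_cfc_le hδ.le fun t ht => ?_
    have := spectrum_nonneg_of_nonneg hX ht
    simp only [χ]
    split_ifs with h
    · simpa using hδ.le
    · rw [mul_zero, sub_zero, Real.norm_of_nonneg this]
      exact not_lt.1 h

/-- A nonzero positive element has a nonzero spectral projection for the eigenvalue `‖w‖`. -/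
theorem exists_top_projection [PartialOrder F] [StarOrderedRing F] {w : F} (hw : 0 ≤ w)
    (hw0 : w ≠ 0) : ∃ p : F, IsStarProjection p ∧ p ≠ 0 ∧ w * p = (‖w‖ : ℂ) • p := by
  have hws : IsSelfAdjoint w := .of_nonneg hw
  have : Nontrivial F := ⟨w, 0, hw0⟩
  let χ : ℝ → ℝ := fun t => if t = ‖w‖ then 1 else 0
  refine ⟨cfc χ w, ⟨?_, cfc_predicate χ w⟩, fun h => ?_, ?_⟩
  · rw [IsIdempotentElem, ← cfc_mul_of_finiteDimensional]
    congr 1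
    funext t
    simp only [χ]; split_ifs <;> simp
  · have h0 : cfc χ w = cfc (fun _ : ℝ => (0 : ℝ)) w := by rw [h, cfc_const_zero]
    -- The point ‖w‖ lies in the spectrum, so the indicator of {‖w‖} does not vanish there.
    have h1 := (cfc_eq_cfc_iff_eqOn (ha := hws)
      (hf := continuousOn_spectrum_of_finiteDimensional w _)
      (hg := continuousOn_spectrum_of_finiteDimensional w _)).1 h0
      (CStarAlgebra.norm_mem_spectrum_of_nonneg hw)
    simp [χ] at h1
  · rw [self_mul_cfc_of_finiteDimensional hws, Complex.coe_smul,
      ← cfc_smul _ _ _ (continuousOn_spectrum_of_finiteDimensional w _)]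
    congr 1
    funext t
    simp only [χ]; split_ifs with h <;> simp [h]

/-- Spectral decomposition of a self-adjoint element. -/
theorem exists_spectral_decomposition {x : F} (hx : IsSelfAdjoint x) :
    ∃ (s : Finset ℝ) (p : ℝ → F), (∀ t, IsStarProjection (p t)) ∧
      (∀ t t', t ≠ t' → p t * p t' = 0) ∧ x = ∑ t ∈ s, (t : ℂ) • p t ∧
      1 = ∑ t ∈ s, p t := by
  let χ : ℝ → ℝ → ℝ := fun a t => if t = a then 1 else 0
  let s := (finite_spectrum_real x).toFinset
  have hc := continuousOn_spectrum_of_finiteDimensional x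
  refine ⟨s, fun a => cfc (χ a) x, fun a => ⟨?_, cfc_predicate _ x⟩, fun a b hab => ?_, ?_, ?_⟩
  · rw [IsIdempotentElem, ← cfc_mul_of_finiteDimensional]
    congr 1
    funext t
    simp only [χ]; split_ifs <;> simp
  · rw [← cfc_mul_of_finiteDimensional]
    have : (fun t => χ a t * χ b t) = fun _ => 0 := by
      funext t
      simp only [χ]
      split_ifs with h1 h2
      · exact absurd (h1.symm.trans h2) hab
      all_goals simp
    rw [this, cfc_const_zero]
  · simp only [Complex.coe_smul]
    have : ∀ a : ℝ, a • cfc (χ a) x = cfc (fun t => a • χ a t) x := fun a =>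
      (cfc_smul _ _ _ (hc _)).symm
    simp only [this]
    rw [← cfc_sum _ _ _ (fun i _ => hc _)]
    conv_lhs => rw [← cfc_id' ℝ x]
    refine cfc_congr fun t ht => ?_
    have hts : t ∈ s := by simpa [s] using ht
    simp [χ, Finset.sum_apply, hts]
  · rw [← cfc_sum _ _ _ (fun i _ => hc _), ← cfc_one ℝ x]
    refine cfc_congr fun t ht => ?_
    have hts : t ∈ s := by simpa [s] using ht
    simp [χ, Finset.sum_apply, hts]

end FiniteDim

/-- A finite-dimensional C*-algebra has a unit. -/
theorem exists_unit_of_finiteDimensional (F : Type*) [NonUnitalCStarAlgebra F]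
    [FiniteDimensional ℂ F] : ∃ e : F, ∀ x, e * x = x ∧ x * e = x := by
  let : PartialOrder F := CStarAlgebra.spectralOrder F
  have : StarOrderedRing F := CStarAlgebra.spectralOrderedRing F
  have hl := CStarAlgebra.increasingApproximateUnit F
  have := hl.neBot
  have : ProperSpace F := FiniteDimensional.proper ℂ F
  have hK : IsCompact (Metric.closedBall (0 : F) 1) := isCompact_closedBall 0 1
  have hle : CStarAlgebra.approximateUnit F ≤ 𝓟 (Metric.closedBall (0 : F) 1) := by
    rw [le_principal_iff]
    filter_upwards [hl.eventually_norm] with e he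
    simpa using he
  -- The unit is a cluster point of the approximate unit in the compact unit ball.
  obtain ⟨e, -, he⟩ := hK hle
  have key : ∀ f : F → F, Continuous f → ∀ x, Tendsto f (CStarAlgebra.approximateUnit F) (𝓝 x) →
      f e = x := fun f hf x hx => by
    have h1 : ClusterPt (f e) (Filter.map f (CStarAlgebra.approximateUnit F)) :=
      he.map hf.continuousAt tendsto_map
    exact eq_of_nhds_neBot (h1.mono hx)
  exact ⟨e, fun x => ⟨key (· * x) (by fun_prop) x (hl.tendsto_mul_right x),
    key (x * ·) (by fun_prop) x (hl.tendsto_mul_left x)⟩⟩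

/-- A finite-dimensional C*-algebra is a unital C*-algebra. -/
theorem exists_cstarAlgebra_of_finiteDimensional (F : Type*) [inst : NonUnitalCStarAlgebra F]
    [FiniteDimensional ℂ F] :
    ∃ c : CStarAlgebra F, @CStarAlgebra.toNonUnitalCStarAlgebra F c = inst := by
  obtain ⟨e, he⟩ := exists_unit_of_finiteDimensional F
  let r : NormedRing F :=
    { (inferInstance : NonUnitalNormedRing F) with
      one := e
      one_mul := fun x => (he x).1
      mul_one := fun x => (he x).2 }
  let a : NormedAlgebra ℂ F :=
    { (Algebra.ofModule (R := ℂ) (A := F) smul_mul_assoc mul_smul_comm) with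
      norm_smul_le := norm_smul_le }
  -- Only a unit is added to the existing structure, so the equality is definitional and a given F
  -- can be made unital by substitution.
  refine ⟨{ toNormedRing := r
            toStarRing := inferInstance
            toCompleteSpace := inferInstance
            toCStarRing := inferInstance
            toNormedAlgebra := a
            toStarModule := inferInstance }, rfl⟩

/-! ### Completely positive maps -/

/-- A linear map is completely positive: its amplifications to matrix algebras are positive. -/
def IsCompletelyPositive {A B : Type*} [NonUnitalCStarAlgebra A] [PartialOrder A]
    [StarOrderedRing A] [NonUnitalCStarAlgebra B] [PartialOrder B] [StarOrderedRing B]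
    (f : A →ₗ[ℂ] B) : Prop :=
  ∀ (ι : Type) [Fintype ι] (M : CStarMatrix ι ι A), 0 ≤ M → 0 ≤ M.map f

namespace IsCompletelyPositive

variable {A B C : Type*} [NonUnitalCStarAlgebra A] [PartialOrder A] [StarOrderedRing A]
  [NonUnitalCStarAlgebra B] [PartialOrder B] [StarOrderedRing B]
  [NonUnitalCStarAlgebra C] [PartialOrder C] [StarOrderedRing C]

theorem of_completelyPositiveMap (f : CompletelyPositiveMap A B) :
    IsCompletelyPositive f.toLinearMap :=
  fun _ _ M hM => f.map_cstarMatrix_nonneg M hM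

theorem comp {g : B →ₗ[ℂ] C} {f : A →ₗ[ℂ] B} (hg : IsCompletelyPositive g)
    (hf : IsCompletelyPositive f) : IsCompletelyPositive (g ∘ₗ f) :=
  fun ι _ M hM => hg ι _ (hf ι M hM)

theorem add {f g : A →ₗ[ℂ] B} (hf : IsCompletelyPositive f) (hg : IsCompletelyPositive g) :
    IsCompletelyPositive (f + g) :=
  fun ι _ M hM => add_nonneg (hf ι M hM) (hg ι M hM)

theorem zero : IsCompletelyPositive (0 : A →ₗ[ℂ] B) :=
  fun _ _ _ _ => le_of_eq rfl

theorem sum {κ : Type*} (s : Finset κ) {f : κ → A →ₗ[ℂ] B}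
    (hf : ∀ k ∈ s, IsCompletelyPositive (f k)) : IsCompletelyPositive (∑ k ∈ s, f k) :=
  Finset.sum_induction f IsCompletelyPositive (fun _ _ => add) zero hf

theorem of_nonUnitalStarAlgHom (f : A →⋆ₙₐ[ℂ] B) :
    IsCompletelyPositive (f : A →ₗ[ℂ] B) :=
  fun _ _ _ hM => map_nonneg (CStarMatrix.mapₙₐ f) hM

theorem map_nonneg {f : A →ₗ[ℂ] B} (hf : IsCompletelyPositive f) {a : A} (ha : 0 ≤ a) :
    0 ≤ f a := by
  let g : CompletelyPositiveMap A B := ⟨f, fun k M hM => hf (Fin k) M hM⟩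
  exact _root_.map_nonneg g ha

theorem map_star {f : A →ₗ[ℂ] B} (hf : IsCompletelyPositive f) (a : A) :
    f (star a) = star (f a) := by
  let g : CompletelyPositiveMap A B := ⟨f, fun k M hM => hf (Fin k) M hM⟩
  exact StarHomClass.map_star g a

/-- The matrix `(f (cᵢ* cⱼ))` is of the form `N* N`. -/
theorem exists_gram {f : A →ₗ[ℂ] B} (hf : IsCompletelyPositive f) {n : ℕ} (c : Fin (n + 1) → A) :
    ∃ N : Fin (n + 1) → Fin (n + 1) → B,
      ∀ i j, f (star (c i) * c j) = ∑ k, star (N k i) * N k j := by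
  -- With c as first row and zeros below, R*R = (cᵢ* cⱼ) is positive, and so is its image under the
  -- amplification of f.
  let R : CStarMatrix (Fin (n + 1)) (Fin (n + 1)) A :=
    CStarMatrix.ofMatrix fun k j => if k = 0 then c j else 0
  obtain ⟨N, hN⟩ := exists_eq_star_mul_self (hf _ _ (star_mul_self_nonneg R))
  refine ⟨fun k j => N k j, fun i j => ?_⟩
  have h := congrFun (congrFun hN i) j
  have hR : (star R * R) i j = star (c i) * c j := by
    change ∑ k : Fin (n + 1), star (if k = 0 then c i else 0) * (if k = 0 then c j else 0) = _
    simp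
  rw [CStarMatrix.mul_apply] at h
  rw [← hR]
  exact h

end IsCompletelyPositive

/-! ### Order zero maps on finite-dimensional C*-algebras -/

section OrderZero

variable {F A : Type*} [CStarAlgebra F] [PartialOrder F] [StarOrderedRing F]
  [FiniteDimensional ℂ F] [NonUnitalCStarAlgebra A] [PartialOrder A] [StarOrderedRing A]
  {φ : F →ₗ[ℂ] A}

/-- Distinct spectral projections of x are orthogonal, hence so are their images. Both sides are
therefore ∑ t² φ(pₜ)², summed over the spectrum. -/
theorem orderZero_sq_of_isSelfAdjoint
    (h0 : ∀ a b, 0 ≤ a → 0 ≤ b → a * b = 0 → φ a * φ b = 0) {x : F} (hx : IsSelfAdjoint x) :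
    φ x * φ x = φ 1 * φ (x * x) := by
  obtain ⟨s, p, hp, hpp, hxs, h1⟩ := exists_spectral_decomposition hx
  have hpos : ∀ t, 0 ≤ p t := fun t => (hp t).nonneg
  have hor : ∀ t t', t ≠ t' → φ (p t) * φ (p t') = 0 := fun t t' h =>
    h0 _ _ (hpos t) (hpos t') (hpp t t' h)
  have key : ∀ g h : ℝ → ℂ, (∑ t ∈ s, g t • φ (p t)) * (∑ t ∈ s, h t • φ (p t)) =
      ∑ t ∈ s, (g t * h t) • (φ (p t) * φ (p t)) := fun g h => by
    rw [Finset.sum_mul_sum]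
    refine Finset.sum_congr rfl fun t ht => ?_
    rw [Finset.sum_eq_single t]
    · rw [smul_mul_smul_comm]
    · intro t' _ ht'
      rw [smul_mul_smul_comm, hor t t' (Ne.symm ht'), smul_zero]
    · exact fun h => absurd ht h
  have hxx : x * x = ∑ t ∈ s, ((t : ℂ) * t) • p t := by
    rw [hxs, Finset.sum_mul_sum]
    refine Finset.sum_congr rfl fun t ht => ?_
    rw [Finset.sum_eq_single t]
    · rw [smul_mul_smul_comm, (hp t).isIdempotentElem.eq]
    · intro t' _ ht'
      rw [smul_mul_smul_comm, hpp t t' (Ne.symm ht'), smul_zero]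
    · exact fun h => absurd ht h
  have e1 : φ x = ∑ t ∈ s, (t : ℂ) • φ (p t) := by
    conv_lhs => rw [hxs]
    simp
  have e2 : φ (x * x) = ∑ t ∈ s, ((t : ℂ) * t) • φ (p t) := by
    rw [hxx]
    simp
  have e3 : φ 1 = ∑ t ∈ s, (1 : ℂ) • φ (p t) := by
    rw [h1]
    simp
  rw [e1, e2, e3, key, key]
  simp

/-- The structure of order zero maps: `φ x φ y = φ 1 φ (x y)`. -/
theorem orderZero_mul (hφ : IsCompletelyPositive φ)
    (h0 : ∀ a b, 0 ≤ a → 0 ≤ b → a * b = 0 → φ a * φ b = 0) (x y : F) :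
    φ x * φ y = φ 1 * φ (x * y) := by
  -- Polarizing the identity for squares gives the symmetrized (Jordan) form of the claim. Taking y
  -- = 1 in it shows that φ(1) commutes with the range of φ.
  have hs : ∀ {x y : F}, IsSelfAdjoint x → IsSelfAdjoint y →
      φ x * φ y + φ y * φ x = φ 1 * φ (x * y + y * x) := fun {x y} hx hy => by
    have h1 := orderZero_sq_of_isSelfAdjoint h0 hx
    have h2 := orderZero_sq_of_isSelfAdjoint h0 hy
    have h3 := orderZero_sq_of_isSelfAdjoint h0 (hx.add hy)
    simp only [map_add, add_mul, mul_add, h1, h2] at h3 ⊢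
    have := sub_eq_zero.2 h3
    rw [← sub_eq_zero, ← this]
    abel
  have hdec : ∀ x : F, ∃ a b : F, IsSelfAdjoint a ∧ IsSelfAdjoint b ∧ x = a + Complex.I • b :=
    fun x => ⟨_, _, (realPart x).2, (imaginaryPart x).2, (realPart_add_I_smul_imaginaryPart x).symm⟩
  have hj : ∀ x y : F, φ x * φ y + φ y * φ x = φ 1 * φ (x * y + y * x) := fun x y => by
    obtain ⟨a, b, ha, hb, rfl⟩ := hdec x
    obtain ⟨c, d, hc, hd, rfl⟩ := hdec y
    have e1 := hs ha hc
    have e2 := hs ha hd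
    have e3 := hs hb hc
    have e4 := hs hb hd
    simp only [map_add, map_smul, add_mul, mul_add, smul_mul_assoc, mul_smul_comm]
      at e1 e2 e3 e4 ⊢
    have := congr($e1 + Complex.I • $e2 + Complex.I • $e3 + (Complex.I * Complex.I) • $e4)
    simp only [smul_add] at this
    rw [← sub_eq_zero] at this ⊢
    rw [← this]
    module
  have hcomm : ∀ x, φ x * φ 1 = φ 1 * φ x := fun x => by
    have := hj x 1
    simp only [mul_one, one_mul, map_add, mul_add] at this
    exact add_right_cancel this
  have hH : 0 ≤ φ 1 := hφ.map_nonneg zero_le_one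
  have hHs : star (φ 1) = φ 1 := (IsSelfAdjoint.of_nonneg hH).star_eq
  -- The goal is D = 0. The Gram matrix of (1, x) shows φ(1)D(x) ≥ 0, while the Jordan identity
  -- gives D(x) + D(x*) = 0; so φ(1)D(x) = 0. Since φ(v)² = φ(1)φ(v²) for self-adjoint v, D(x)
  -- annihilates the whole range of φ, hence D(x)² = 0.
  let D : F → A := fun x => φ 1 * φ (star x * x) - star (φ x) * φ x
  have hstarφ : ∀ x, star (φ x) = φ (star x) := fun x => (hφ.map_star x).symm
  have hDpos : ∀ x, 0 ≤ φ 1 * D x := fun x => by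
    obtain ⟨N, hN⟩ := hφ.exists_gram (n := 1) ![1, x]
    have h00 := hN 0 0
    have h01 := hN 0 1
    have h10 := hN 1 0
    have h11 := hN 1 1
    simp only [Matrix.cons_val_zero, Matrix.cons_val_one, star_one, mul_one, one_mul] at h00 h01 h10 h11
    have : φ 1 * D x = ∑ k, star (N k 1 * φ 1 - N k 0 * φ x) * (N k 1 * φ 1 - N k 0 * φ x) := by
      have expand : ∀ k, star (N k 1 * φ 1 - N k 0 * φ x) * (N k 1 * φ 1 - N k 0 * φ x) =
          φ 1 * (star (N k 1) * N k 1) * φ 1 - φ 1 * (star (N k 1) * N k 0) * φ x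
          - star (φ x) * (star (N k 0) * N k 1) * φ 1
          + star (φ x) * (star (N k 0) * N k 0) * φ x := fun k => by
        simp only [star_sub, star_mul, hHs]
        noncomm_ring
      simp only [expand, Finset.sum_add_distrib, Finset.sum_sub_distrib, ← Finset.sum_mul,
        ← Finset.mul_sum, ← h00, ← h01, ← h10, ← h11]
      have c1 := hcomm x
      have c2 := hcomm (star x)
      have c3 := hcomm (star x * x)
      simp only [D, hstarφ]
      have r1 : φ 1 * φ (star x * x) * φ 1 = φ 1 * (φ 1 * φ (star x * x)) := by
        rw [mul_assoc, c3]
      have r2 : φ (star x) * φ x * φ 1 = φ 1 * (φ (star x) * φ x) := by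
        rw [mul_assoc, c1, ← mul_assoc, c2, mul_assoc]
      have r3 : φ (star x) * φ 1 * φ x = φ 1 * (φ (star x) * φ x) := by
        rw [c2, mul_assoc]
      have r4 : φ 1 * φ (star x) * φ x = φ 1 * (φ (star x) * φ x) := mul_assoc _ _ _
      rw [r1, r2, r3, r4, mul_sub]
      abel
    rw [this]
    exact Finset.sum_nonneg fun k _ => star_mul_self_nonneg _
  have hDD : ∀ x, D x + D (star x) = 0 := fun x => by
    have := hj (star x) x
    simp only [D, hstarφ, star_star]
    rw [map_add, mul_add] at this
    rw [← sub_eq_zero] at this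
    rw [← neg_eq_zero, ← this]
    abel
  have hHD : ∀ x, φ 1 * D x = 0 := fun x => by
    have h1 : φ 1 * D x = -(φ 1 * D (star x)) := by
      rw [← mul_neg, eq_neg_of_add_eq_zero_left (hDD x)]
    exact le_antisymm (h1 ▸ neg_nonpos.2 (hDpos (star x))) (hDpos x)
  have hDstar : ∀ x, star (D x) = D x := fun x => by
    simp only [D, star_sub, star_mul, star_star, hHs, hstarφ, hcomm]
  have hDφ : ∀ x v, D x * φ v = 0 := fun x v => by
    have hsa : ∀ v : F, IsSelfAdjoint v → D x * φ v = 0 := fun v hv => by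
      have hv' : star (φ v) = φ v := by rw [hstarφ, hv.star_eq]
      have hDH : D x * φ 1 = 0 := by
        have := congrArg star (hHD x)
        rwa [star_mul, hDstar, hHs, star_zero] at this
      rw [← CStarRing.mul_star_self_eq_zero_iff, star_mul, hDstar, hv', mul_assoc,
        ← mul_assoc (φ v), orderZero_sq_of_isSelfAdjoint h0 hv, ← mul_assoc, ← mul_assoc, hDH,
        zero_mul, zero_mul]
    obtain ⟨a, b, ha, hb, rfl⟩ := hdec v
    rw [map_add, map_smul, mul_add, mul_smul_comm, hsa a ha, hsa b hb, smul_zero, add_zero]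
  have hD : ∀ x, φ (star x) * φ x = φ 1 * φ (star x * x) := fun x => by
    have : D x * D x = 0 := by
      conv_lhs => rw [show D x = φ 1 * φ (star x * x) - star (φ x) * φ x from rfl]
      rw [sub_mul]
      have e1 : φ 1 * φ (star x * x) * D x = 0 := by
        rw [← hcomm, mul_assoc, hHD, mul_zero]
      have e2 : φ x * D x = 0 := by
        have := congrArg star (hDφ x (star x))
        rwa [star_mul, hDstar, hstarφ, star_star, star_zero] at this
      rw [e1, mul_assoc, e2, mul_zero, sub_zero]
    have h := (CStarRing.star_mul_self_eq_zero_iff (D x)).1 (by rw [hDstar, this])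
    rw [← hstarφ]
    exact (sub_eq_zero.1 h).symm
  -- Sesquilinear polarization, from the values at x + y and x + iy.
  have hpol : ∀ x y, φ (star x) * φ y = φ 1 * φ (star x * y) := fun x y => by
    have e0 := hD x
    have e1 := hD y
    have e2 := hD (x + y)
    have e3 := hD (x + Complex.I • y)
    simp only [star_add, star_smul, map_add, map_smul, add_mul, mul_add, smul_mul_assoc,
      mul_smul_comm, e0, e1, Complex.star_def, Complex.conj_I] at e2 e3
    have hI : Complex.I * Complex.I = -1 := Complex.I_mul_I
    have f2 : φ (star y) * φ x + φ (star x) * φ y =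
        φ 1 * φ (star y * x) + φ 1 * φ (star x * y) := by
      rw [← sub_eq_zero] at e2 ⊢
      rw [← e2]
      abel
    have f3 : -Complex.I • (φ (star y) * φ x) + Complex.I • (φ (star x) * φ y) =
        -Complex.I • (φ 1 * φ (star y * x)) + Complex.I • (φ 1 * φ (star x * y)) := by
      rw [← sub_eq_zero] at e3 ⊢
      rw [← e3]
      module
    have f4 := congr(Complex.I • $f2 + $f3)
    simp only [smul_add, neg_smul] at f4
    have f5 : (2 * Complex.I) • (φ (star x) * φ y) = (2 * Complex.I) • (φ 1 * φ (star x * y)) := by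
      rw [← sub_eq_zero] at f4 ⊢
      rw [← f4]
      module
    exact smul_right_injective A (by simp : (2 * Complex.I) ≠ 0) f5
  have := hpol (star x) y
  rwa [star_star] at this

end OrderZero

/-! ### Cutting an order zero map down to a direct summand -/

section Cut

variable {F A : Type*} [CStarAlgebra F] [PartialOrder F] [StarOrderedRing F]
  [FiniteDimensional ℂ F] [NonUnitalCStarAlgebra A] [PartialOrder A] [StarOrderedRing A]
  {φ : F →ₗ[ℂ] A}

-- A factor φ(1) can be traded for φ(y): φ(1)^(m+1) φ(xy) = φ(1)^m φ(x)φ(y). The shift of the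
-- exponent costs a factor 1/s, and m = 0 is covered by the maximum. The unitization serves only to
-- give a meaning to φ(1)⁰.
open Unitization in
theorem exists_growth_bound_mul (hmul : ∀ x y, φ x * φ y = φ 1 * φ (x * y)) {s : ℝ} (hs : 0 < s)
    {x : F} (y : F)
    (hx : ∃ C : ℝ, ∀ m : ℕ, ‖(φ 1 : Unitization ℂ A) ^ m * (φ x : Unitization ℂ A)‖ ≤ C * s ^ m) :
    ∃ C : ℝ, ∀ m : ℕ,
      ‖(φ 1 : Unitization ℂ A) ^ m * (φ (x * y) : Unitization ℂ A)‖ ≤ C * s ^ m := by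
  obtain ⟨C, hC⟩ := hx
  refine ⟨max (‖φ (x * y)‖) (C * ‖φ y‖ / s), fun m => ?_⟩
  cases m with
  | zero => simp [norm_inr]
  | succ m =>
    rw [pow_succ, mul_assoc, ← inr_mul, ← hmul, inr_mul, ← mul_assoc]
    calc _ ≤ C * s ^ m * ‖φ y‖ := by
          refine (norm_mul_le _ _).trans ?_
          rw [norm_inr]
          exact mul_le_mul_of_nonneg_right (hC m) (norm_nonneg _)
      _ = (C * ‖φ y‖ / s) * s ^ (m + 1) := by field_simp; ring
      _ ≤ _ := by gcongr; exact le_max_right _ _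

open Unitization in
/-- The two-sided ideal of the elements `x` for which `φ x` lives where `φ 1 ≤ s`. -/
def growthIdeal (hφ : IsCompletelyPositive φ) (hmul : ∀ x y, φ x * φ y = φ 1 * φ (x * y))
    {s : ℝ} (hs : 0 < s) : NonUnitalStarSubalgebra ℂ F where
  carrier := {x | ∃ C : ℝ, ∀ m : ℕ,
    ‖(φ 1 : Unitization ℂ A) ^ m * (φ x : Unitization ℂ A)‖ ≤ C * s ^ m}
  zero_mem' := ⟨0, fun m => by simp⟩
  add_mem' := by
    rintro x y ⟨C, hC⟩ ⟨D, hD⟩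
    refine ⟨C + D, fun m => ?_⟩
    rw [map_add, inr_add, mul_add, add_mul]
    exact (norm_add_le _ _).trans (add_le_add (hC m) (hD m))
  smul_mem' := by
    rintro c x ⟨C, hC⟩
    refine ⟨‖c‖ * C, fun m => ?_⟩
    rw [map_smul, inr_smul, mul_smul_comm, norm_smul, mul_assoc]
    exact mul_le_mul_of_nonneg_left (hC m) (norm_nonneg c)
  mul_mem' := by
    rintro x y hx -
    exact exists_growth_bound_mul hmul hs y hx
  star_mem' := by
    rintro x ⟨C, hC⟩
    refine ⟨C, fun m => ?_⟩
    have hH : star (φ 1) = φ 1 := (IsSelfAdjoint.of_nonneg (hφ.map_nonneg zero_le_one)).star_eq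
    have hc : Commute (φ 1 : Unitization ℂ A) (φ x : Unitization ℂ A) := by
      have := hmul x 1
      rw [mul_one] at this
      rw [Commute, SemiconjBy, ← inr_mul, ← inr_mul, this]
    have : (φ 1 : Unitization ℂ A) ^ m * (φ (star x) : Unitization ℂ A) =
        star ((φ 1 : Unitization ℂ A) ^ m * (φ x : Unitization ℂ A)) := by
      rw [(hc.pow_left m).eq, star_mul, star_pow, ← inr_star, ← inr_star, hH, hφ.map_star]
    rw [this, norm_star]
    exact hC m

open Unitization in
/-- An order zero map on a finite-dimensional C*-algebra is small on a direct summand, and bounded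
below on the complementary one. -/
theorem exists_central_cut (hφ : IsCompletelyPositive φ) (hc : ∀ x, ‖φ x‖ ≤ ‖x‖)
    (hmul : ∀ x y, φ x * φ y = φ 1 * φ (x * y)) {s : ℝ} (hs : 0 < s) :
    ∃ z : F, IsStarProjection z ∧ (∀ x, z * x = x * z) ∧
      (∀ u, ‖φ ((1 - z) * u)‖ ^ 2 ≤ s * ‖u‖ ^ 2) ∧
      ∀ u, ‖z * u‖ ^ 2 * s ^ 3 ≤ ‖u‖ * ‖φ 1 * φ u‖ := by
  let K := growthIdeal hφ hmul hs
  have hcomm : ∀ x, φ x * φ 1 = φ 1 * φ x := fun x => by rw [hmul, mul_one]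
  have hstarφ : ∀ x, star (φ x) = φ (star x) := fun x => (hφ.map_star x).symm
  have hKr : ∀ x ∈ K, ∀ y, x * y ∈ K :=
    fun x hx y => exists_growth_bound_mul hmul hs y hx
  have hKl : ∀ x ∈ K, ∀ y, y * x ∈ K := fun x hx y => by
    have := star_mem (hKr _ (star_mem hx) (star y))
    rwa [star_mul, star_star, star_star] at this
  -- A closed, finite-dimensional *-subalgebra is a C*-algebra with a unit e. As K is a two-sided
  -- ideal, ex = exe = xe for all x, so e is a central projection.
  have hclosed : IsClosed (K : Set F) := K.toSubmodule.closed_of_finiteDimensional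
  have : FiniteDimensional ℂ K := inferInstanceAs (FiniteDimensional ℂ K.toSubmodule)
  obtain ⟨⟨e, heK⟩, he⟩ := exists_unit_of_finiteDimensional K
  have he1 : ∀ x ∈ K, e * x = x := fun x hx => congrArg Subtype.val (he ⟨x, hx⟩).1
  have he2 : ∀ x ∈ K, x * e = x := fun x hx => congrArg Subtype.val (he ⟨x, hx⟩).2
  have hes : star e = e := by
    have h1 := he1 _ (star_mem heK)
    have h2 := congrArg star h1
    rw [star_mul, star_star] at h2
    exact h1.symm.trans h2
  have hee : e * e = e := he1 e heK
  have hec : ∀ x, e * x = x * e := fun x => by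
    rw [← he2 _ (hKr e heK x), mul_assoc, he1 _ (hKl e heK x)]
  have hproj : ∀ p : F, IsStarProjection p → ∀ m : ℕ, (φ 1 : Unitization ℂ A) ^ m *
      (φ p : Unitization ℂ A) = (φ p : Unitization ℂ A) ^ (m + 1) := fun p hp m => by
    induction m with
    | zero => simp
    | succ m ih =>
      have h1 : (φ 1 : Unitization ℂ A) * (φ p : Unitization ℂ A) =
          (φ p : Unitization ℂ A) * (φ p : Unitization ℂ A) := by
        rw [← inr_mul, ← inr_mul, hmul p, hp.isIdempotentElem.eq]
      rw [pow_succ, mul_assoc, h1, ← mul_assoc, ih, ← pow_succ]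
  have hmem : ∀ p : F, IsStarProjection p → ‖φ p‖ ≤ s → p ∈ K := fun p hp hps => by
    refine ⟨s, fun m => ?_⟩
    rw [hproj p hp, mul_comm, ← pow_succ]
    refine (norm_pow_le' _ m.succ_pos).trans ?_
    rw [norm_inr]
    gcongr
  -- Membership of e in the ideal bounds ‖φ(e)^(m+1)‖ by C s^m. For m + 1 = 2^j the norm of the
  -- power of a self-adjoint element is the power of the norm, so ‖φ(e)‖ > s would make
  -- (‖φ(e)‖/s)^(2^j) unbounded.
  have hle : ‖φ e‖ ≤ s := by
    obtain ⟨C, hC⟩ := heK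
    by_contra! hlt
    have hsa : IsSelfAdjoint (φ e : Unitization ℂ A) := by
      rw [IsSelfAdjoint, ← inr_star, hstarφ, hes]
    have hpow : ∀ j : ℕ, (‖φ e‖ / s) ^ 2 ^ j ≤ C / s := fun j => by
      have h1 := hC (2 ^ j - 1)
      have h2 : 2 ^ j - 1 + 1 = 2 ^ j := Nat.sub_add_cancel Nat.one_le_two_pow
      rw [hproj e ⟨hee, hes⟩, h2, hsa.norm_pow_two_pow, norm_inr] at h1
      rw [div_pow, div_le_div_iff₀ (by positivity) hs, ← h2, pow_succ s, ← mul_assoc, h2]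
      exact mul_le_mul_of_nonneg_right h1 hs.le
    have h3 : Tendsto (fun j : ℕ => (‖φ e‖ / s) ^ 2 ^ j) atTop atTop :=
      (tendsto_pow_atTop_atTop_of_one_lt ((one_lt_div hs).2 hlt)).comp
        (tendsto_pow_atTop_atTop_of_one_lt one_lt_two)
    obtain ⟨j, hj⟩ := (h3.eventually_gt_atTop (C / s)).exists
    exact absurd (hpow j) (not_le.2 hj)
  have hz : IsStarProjection (1 - e) := IsStarProjection.one_sub ⟨hee, hes⟩
  have hzc : ∀ x, (1 - e) * x = x * (1 - e) := fun x => by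
    rw [sub_mul, mul_sub, one_mul, mul_one, hec]
  refine ⟨1 - e, hz, hzc, fun u => ?_, fun u => ?_⟩
  · rw [sub_sub_cancel, sq, ← CStarRing.norm_star_mul_self, hstarφ, hmul, star_mul, hes]
    have : star u * e * (e * u) = e * (star u * u) := by
      rw [mul_assoc, ← mul_assoc e e, hee, ← mul_assoc, ← hec, mul_assoc]
    rw [this, ← hmul]
    calc _ ≤ ‖φ e‖ * ‖φ (star u * u)‖ := norm_mul_le _ _
      _ ≤ s * ‖star u * u‖ := by gcongr; exact hc _
      _ = _ := by rw [CStarRing.norm_star_mul_self, sq]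
  · set z := 1 - e
    rcases eq_or_ne (z * u) 0 with h0 | h0
    · rw [h0, norm_zero, zero_pow two_ne_zero, zero_mul]
      positivity
    have hzs : star z = z := hz.isSelfAdjoint
    have hzz : z * z = z := hz.isIdempotentElem
    obtain ⟨w, hw⟩ : ∃ w, w = star (z * u) * (z * u) := ⟨_, rfl⟩
    have hw0 : w ≠ 0 := by
      rw [hw, Ne, CStarRing.star_mul_self_eq_zero_iff]
      exact h0
    have hwn : ‖w‖ = ‖z * u‖ ^ 2 := by rw [hw, CStarRing.norm_star_mul_self, sq]
    have hw' : w = (z * star u) * u := by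
      rw [hw, star_mul, hzs, ← mul_assoc, mul_assoc (star u), hzz, ← hzc]
    have hzw : z * w = w := by rw [hw', ← mul_assoc, ← mul_assoc, hzz]
    -- The projection p lies under z = 1 − e, hence outside the ideal, and this forces ‖φ(p)‖ > s.
    obtain ⟨p, hp, hp0, hwp⟩ := exists_top_projection (hw ▸ star_mul_self_nonneg (z * u)) hw0
    have hzp : z * p = p := by
      have h1 : z * (w * p) = w * p := by rw [← mul_assoc, hzw]
      rw [hwp, mul_smul_comm] at h1
      exact smul_right_injective F (by simpa using hw0 : (‖w‖ : ℂ) ≠ 0) h1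
    have hps : s < ‖φ p‖ := by
      by_contra! h
      have h1 := he1 p (hmem p hp h)
      have h2 : (1 - e) * p = p := hzp
      rw [sub_mul, one_mul, h1, sub_self] at h2
      exact hp0 h2.symm
    have hpp : φ 1 * φ p = φ p * φ p := by rw [hmul p, hp.isIdempotentElem.eq]
    have hpsa : star (φ p) = φ p := by rw [hstarφ, hp.isSelfAdjoint.star_eq]
    -- The product is φ(1)³ φ(wp) = ‖w‖ φ(p)⁴. Comparing norms and cancelling one factor ‖φ(p)‖
    -- leaves the cube in the lower bound.
    have hkey : φ (z * star u) * (φ 1 * φ u) * φ p =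
        (‖w‖ : ℂ) • (star (star (φ p) * φ p) * (star (φ p) * φ p)) := by
      calc _ = φ 1 * (φ 1 * φ w) * φ p := by
            rw [← mul_assoc (φ (z * star u)), hcomm, mul_assoc (φ 1), hmul (z * star u), ← hw']
        _ = φ 1 * (φ 1 * (φ w * φ p)) := by simp only [mul_assoc]
        _ = (‖w‖ : ℂ) • (φ 1 * (φ 1 * (φ 1 * φ p))) := by
            rw [hmul w, hwp, map_smul]
            simp only [mul_smul_comm]
        _ = _ := by
            simp only [star_mul, hpsa]
            rw [hpp, ← mul_assoc (φ 1) (φ p), hpp, ← mul_assoc (φ 1), ← mul_assoc (φ 1), hpp,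
              mul_assoc]
    have hn := congrArg norm hkey
    rw [norm_smul, CStarRing.norm_star_mul_self, CStarRing.norm_star_mul_self,
      Complex.norm_real, norm_norm, hwn] at hn
    have hn2 : ‖φ (z * star u) * (φ 1 * φ u) * φ p‖ ≤ ‖u‖ * ‖φ 1 * φ u‖ * ‖φ p‖ := by
      refine (norm_mul_le _ _).trans ?_
      gcongr
      refine (norm_mul_le _ _).trans ?_
      gcongr
      calc _ ≤ ‖z * star u‖ := hc _
        _ ≤ ‖z‖ * ‖star u‖ := norm_mul_le _ _
        _ ≤ 1 * ‖star u‖ := by gcongr; exact hz.norm_le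
        _ = ‖u‖ := by rw [one_mul, norm_star]
    have hp0' : 0 < ‖φ p‖ := hs.trans hps
    have h3 : ‖z * u‖ ^ 2 * ‖φ p‖ ^ 3 ≤ ‖u‖ * ‖φ 1 * φ u‖ := by
      refine le_of_mul_le_mul_right ?_ hp0'
      calc _ = ‖z * u‖ ^ 2 * (‖φ p‖ * ‖φ p‖ * (‖φ p‖ * ‖φ p‖)) := by ring
        _ ≤ _ := by rw [← hn]; exact hn2
    refine le_trans ?_ h3
    gcongr

end Cut

/-! ### Asymptotic bimodule maps -/

section Bimodule

variable {A : Type*} [NonUnitalCStarAlgebra A] [PartialOrder A] [StarOrderedRing A]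

/-- The defect of a completely positive map `f` from being right `A`-linear. -/
def moduleDefect (f : A →ₗ[ℂ] A) (x y : A) : A :=
  f (star (x * y) * (x * y)) - f (star (x * y) * x) * y - star y * f (star x * (x * y)) +
    star y * f (star x * x) * y

namespace IsCompletelyPositive

variable {f : A →ₗ[ℂ] A}

/-- For a Gram matrix N*N of (xy, x, c), take u to be the column of xy minus the column of x times
y, and v the column of c. All three expressions are then A-valued inner products of u and v, ready
for Cauchy–Schwarz. -/
theorem exists_moduleDefect_eq (hf : IsCompletelyPositive f) (x y c : A) :
    ∃ u v : Fin 3 → A, moduleDefect f x y = ∑ k, star (u k) * u k ∧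
      f (star c * c) = ∑ k, star (v k) * v k ∧
      f (star c * (x * y)) - f (star c * x) * y = ∑ k, star (v k) * u k := by
  obtain ⟨N, hN⟩ := hf.exists_gram (n := 2) ![x * y, x, c]
  have h00 := hN 0 0
  have h01 := hN 0 1
  have h10 := hN 1 0
  have h11 := hN 1 1
  have h20 := hN 2 0
  have h21 := hN 2 1
  have h22 := hN 2 2
  simp only [Matrix.cons_val_zero, Matrix.cons_val_one, Matrix.cons_val] at h00 h01 h10 h11 h20 h21 h22
  refine ⟨fun k => N k 0 - N k 1 * y, fun k => N k 2, ?_, h22, ?_⟩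
  · have expand : ∀ k, star (N k 0 - N k 1 * y) * (N k 0 - N k 1 * y) =
        star (N k 0) * N k 0 - star (N k 0) * N k 1 * y - star y * (star (N k 1) * N k 0)
          + star y * (star (N k 1) * N k 1) * y := fun k => by
      simp only [star_sub, star_mul]
      noncomm_ring
    simp only [expand, Finset.sum_add_distrib, Finset.sum_sub_distrib, ← Finset.sum_mul,
      ← Finset.mul_sum, ← h00, ← h01, ← h10, ← h11]
    rfl
  · simp only [mul_sub, ← mul_assoc, Finset.sum_sub_distrib, ← Finset.sum_mul, ← h20, ← h21]

theorem moduleDefect_nonneg (hf : IsCompletelyPositive f) (x y : A) :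
    0 ≤ moduleDefect f x y := by
  obtain ⟨u, v, h, -⟩ := hf.exists_moduleDefect_eq x y 0
  rw [h]
  exact Finset.sum_nonneg fun k _ => star_mul_self_nonneg _

/-- A crude Cauchy–Schwarz inequality, entry by entry; the 3 counts the rows of the Gram matrix. -/
theorem norm_map_mul_sub_le (hf : IsCompletelyPositive f) (x y c : A) :
    ‖f (star c * (x * y)) - f (star c * x) * y‖ ≤
      3 * (√‖f (star c * c)‖ * √‖moduleDefect f x y‖) := by
  obtain ⟨u, v, h1, h2, h3⟩ := hf.exists_moduleDefect_eq x y c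
  have aux : ∀ (w : Fin 3 → A) (k : Fin 3), ‖w k‖ ≤ √‖∑ k, star (w k) * w k‖ := fun w k => by
    refine Real.le_sqrt_of_sq_le ?_
    rw [sq, ← CStarRing.norm_star_mul_self]
    exact CStarAlgebra.norm_le_norm_of_nonneg_of_le (star_mul_self_nonneg _)
      (Finset.single_le_sum (f := fun k => star (w k) * w k)
        (fun k _ => star_mul_self_nonneg (w k)) (Finset.mem_univ k))
  rw [h3, h1, h2]
  calc _ ≤ ∑ k : Fin 3, ‖star (v k) * u k‖ := norm_sum_le _ _
    _ ≤ ∑ _k : Fin 3, (√‖∑ k, star (v k) * v k‖ * √‖∑ k, star (u k) * u k‖) := by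
        refine Finset.sum_le_sum fun k _ => (norm_mul_le _ _).trans ?_
        rw [norm_star]
        exact mul_le_mul (aux v k) (aux u k) (norm_nonneg _) (Real.sqrt_nonneg _)
    _ = _ := by simp

end IsCompletelyPositive

theorem moduleDefect_add (f g : A →ₗ[ℂ] A) (x y : A) :
    moduleDefect (f + g) x y = moduleDefect f x y + moduleDefect g x y := by
  simp only [moduleDefect, LinearMap.add_apply, add_mul, mul_add]
  abel

variable {Λ : Type*} {l : Filter Λ} {θ R : Λ → A →ₗ[ℂ] A}

/-- A net of completely positive contractions dominated by maps converging to the identity is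
asymptotically right `A`-linear. -/
theorem tendsto_map_mul_sub_map_mul (hθ : ∀ i, IsCompletelyPositive (θ i))
    (hR : ∀ i, IsCompletelyPositive (R i)) (hb : ∀ i x, ‖θ i x‖ ≤ ‖x‖)
    (hid : ∀ x, Tendsto (fun i => θ i x + R i x) l (𝓝 x)) (w y : A) :
    Tendsto (fun i => θ i (w * y) - θ i w * y) l (𝓝 0) := by
  have hdef : ∀ x y : A, Tendsto (fun i => ‖moduleDefect (θ i) x y‖) l (𝓝 0) := fun x y => by
    -- The defect of the identity map is zero. The defect is additive in the map and positive, so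
    -- the defect of θ is dominated by that of θ + R.
    have h1 : Tendsto (fun i => moduleDefect (θ i + R i) x y) l (𝓝 0) := by
      have h0 : (0 : A) = star (x * y) * (x * y) - star (x * y) * x * y -
          star y * (star x * (x * y)) + star y * (star x * x) * y := by
        simp only [star_mul]
        noncomm_ring
      rw [h0]
      exact (((hid _).sub ((hid _).mul_const y)).sub ((hid _).const_mul (star y))).add
        (((hid _).const_mul (star y)).mul_const y)
    refine squeeze_zero (fun i => norm_nonneg _) (fun i => ?_) (by simpa using h1.norm)
    refine CStarAlgebra.norm_le_norm_of_nonneg_of_le ((hθ i).moduleDefect_nonneg x y) ?_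
    rw [moduleDefect_add]
    exact le_add_of_nonneg_right ((hR i).moduleDefect_nonneg x y)
  have hprod : ∀ c x : A, Tendsto (fun i => θ i (star c * x * y) - θ i (star c * x) * y) l
      (𝓝 0) := fun c x => by
    rw [tendsto_zero_iff_norm_tendsto_zero]
    have h2 : Tendsto (fun i => 3 * (√‖star c * c‖ * √‖moduleDefect (θ i) x y‖)) l (𝓝 0) := by
      have := (((hdef x y).sqrt).const_mul (√‖star c * c‖)).const_mul 3
      simpa using this
    refine squeeze_zero (fun i => norm_nonneg _) (fun i => ?_) h2
    rw [mul_assoc (star c)]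
    refine ((hθ i).norm_map_mul_sub_le x y c).trans ?_
    gcongr
    exact hb i _
  -- The estimate needs w to be a product; positive elements c*c are products and span A.
  have hw : w ∈ Submodule.span ℂ {a : A | 0 ≤ a} := by
    rw [CStarAlgebra.span_nonneg]
    trivial
  induction hw using Submodule.span_induction with
  | mem x hx =>
    obtain ⟨c, rfl⟩ := exists_eq_star_mul_self hx
    exact hprod c c
  | zero => simpa using tendsto_const_nhds
  | add x x' _ _ hx hx' =>
    have := hx.add hx'
    rw [add_zero] at this
    refine this.congr fun i => ?_
    simp only [add_mul, map_add]
    abel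
  | smul c x _ hx =>
    have := hx.const_smul c
    rw [smul_zero] at this
    refine this.congr fun i => ?_
    simp only [smul_mul_assoc, map_smul, smul_sub]

/-- The version of `tendsto_map_mul_sub_map_mul` for left multiplication. -/
theorem tendsto_map_mul_sub_mul_map (hθ : ∀ i, IsCompletelyPositive (θ i))
    (hR : ∀ i, IsCompletelyPositive (R i)) (hb : ∀ i x, ‖θ i x‖ ≤ ‖x‖)
    (hid : ∀ x, Tendsto (fun i => θ i x + R i x) l (𝓝 x)) (w y : A) :
    Tendsto (fun i => θ i (w * y) - w * θ i y) l (𝓝 0) := by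
  have h := (tendsto_map_mul_sub_map_mul hθ hR hb hid (star y) (star w)).star
  rw [star_zero] at h
  refine h.congr fun i => ?_
  rw [star_sub, star_mul, ← (hθ i).map_star, ← (hθ i).map_star, star_mul, star_star, star_star]

end Bimodule

/-! ### Comparison of projections over finite-dimensional C*-algebras -/

/-- The block diagonal matrix with `κ` copies of a matrix on the diagonal. -/
def diagCopies (κ : Type) {ι : Type} {B : Type*} [Fintype κ] [DecidableEq κ] [Fintype ι]
    [NonUnitalCStarAlgebra B] :
    CStarMatrix ι ι B →⋆ₙₐ[ℂ] CStarMatrix (κ × ι) (κ × ι) B where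
  toFun X := CStarMatrix.ofMatrix fun a b => if a.1 = b.1 then X a.2 b.2 else 0
  map_smul' c X := by
    ext a b
    change (if a.1 = b.1 then c • X a.2 b.2 else 0) = c • (if a.1 = b.1 then X a.2 b.2 else 0)
    split_ifs <;> simp
  map_zero' := by
    ext a b
    change (if a.1 = b.1 then (0 : B) else 0) = 0
    simp
  map_add' X Y := by
    ext a b
    change (if a.1 = b.1 then X a.2 b.2 + Y a.2 b.2 else 0) =
      (if a.1 = b.1 then X a.2 b.2 else 0) + (if a.1 = b.1 then Y a.2 b.2 else 0)
    split_ifs <;> simp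
  map_mul' X Y := by
    ext a b
    change (if a.1 = b.1 then (X * Y) a.2 b.2 else 0) = ∑ c : κ × ι,
      (if a.1 = c.1 then X a.2 c.2 else 0) * (if c.1 = b.1 then Y c.2 b.2 else 0)
    rw [Fintype.sum_prod_type, Finset.sum_eq_single a.1]
    · simp only [if_true]
      split_ifs
      · rfl
      · simp
    · intro k _ hk
      simp [Ne.symm hk]
    · simp
  map_star' X := by
    ext a b
    change (if a.1 = b.1 then star (X b.2 a.2) else 0) =
      star (if b.1 = a.1 then X b.2 a.2 else 0)
    simp only [eq_comm (a := a.1)]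
    split_ifs <;> simp

theorem diagCopies_apply (κ : Type) {ι : Type} {B : Type*} [Fintype κ] [DecidableEq κ] [Fintype ι]
    [NonUnitalCStarAlgebra B] (X : CStarMatrix ι ι B) (a b : κ × ι) :
    diagCopies κ X a b = if a.1 = b.1 then X a.2 b.2 else 0 := rfl

theorem diagCopies_map (κ : Type) {ι : Type} {B C : Type*} [Fintype κ] [DecidableEq κ] [Fintype ι]
    [NonUnitalCStarAlgebra B] [NonUnitalCStarAlgebra C] (f : B →ₗ[ℂ] C) (X : CStarMatrix ι ι B) :
    diagCopies κ (X.map f) = (diagCopies κ X).map f := by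
  ext a b
  rw [CStarMatrix.map_apply, diagCopies_apply, diagCopies_apply, apply_ite f, map_zero]
  rfl

/-- If `p` factors through `q`, then `p` is equivalent to a subprojection of `q`. -/
theorem exists_partialIsometry_of_eq_mul {G : Type*} [CStarAlgebra G] [FiniteDimensional ℂ G]
    {p q x y : G} (hp : IsStarProjection p) (hq : IsStarProjection q) (h : p = x * q * y) :
    ∃ t : G, star t * t = p ∧ q * t = t := by
  let _ : PartialOrder G := CStarAlgebra.spectralOrder G
  have _ : StarOrderedRing G := CStarAlgebra.spectralOrderedRing G
  have hpp := hp.isIdempotentElem.eq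
  have hqq := hq.isIdempotentElem.eq
  -- The partial isometry is the polar part u(u*u)^(-1/2). Since p = (px)u, the element u is
  -- injective on the range of p, so the support χ(W) of W = u*u is all of p.
  obtain ⟨u, hu⟩ : ∃ u, u = q * y * p := ⟨_, rfl⟩
  have hqu : q * u = u := by rw [hu, mul_assoc, ← mul_assoc q q, hqq]
  have hup : u * p = u := by rw [hu, mul_assoc, hpp]
  have hpu : p = p * x * u := by
    calc p = p * (x * q * y) * p := by rw [← h, hpp, hpp]
      _ = p * x * u := by rw [hu]; simp only [mul_assoc]
  have hW : 0 ≤ star u * u := star_mul_self_nonneg u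
  have hWs : IsSelfAdjoint (star u * u) := .of_nonneg hW
  set W := star u * u with hWdef
  have hpW : p * W = W := by
    have : p * star u = star u := by
      rw [← hp.isSelfAdjoint.star_eq, ← star_mul, hup]
    rw [hWdef, ← mul_assoc, this]
  let f : ℝ → ℝ := fun t => if 0 < t then (√t)⁻¹ else 0
  let g : ℝ → ℝ := fun t => if 0 < t then t⁻¹ else 0
  let χ : ℝ → ℝ := fun t => if 0 < t then 1 else 0
  have e1 : W * cfc g W = cfc χ W := by
    rw [self_mul_cfc_of_finiteDimensional hWs]
    congr 1
    funext t
    simp only [g, χ]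
    split_ifs with ht
    · exact mul_inv_cancel₀ ht.ne'
    · exact mul_zero t
  have e2 : cfc f W * W * cfc f W = cfc χ W := by
    rw [cfc_mul_self_of_finiteDimensional hWs, ← cfc_mul_of_finiteDimensional]
    congr 1
    funext t
    simp only [f, χ]
    split_ifs with ht
    · have : √t ≠ 0 := (Real.sqrt_pos.2 ht).ne'
      field_simp
      exact (Real.sq_sqrt ht.le).symm
    · simp
  have e3 : W * cfc χ W = W := by
    rw [self_mul_cfc_of_finiteDimensional hWs]
    conv_rhs => rw [← cfc_id' ℝ W]
    refine cfc_congr fun t ht => ?_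
    have := spectrum_nonneg_of_nonneg hW ht
    simp only [χ]
    split_ifs with h0
    · exact mul_one t
    · rw [mul_zero]
      exact le_antisymm this (not_lt.1 h0)
  have e4 : p * cfc χ W = cfc χ W := by rw [← e1, ← mul_assoc, hpW]
  have e5 : u * cfc χ W = u := by
    rw [← sub_eq_zero, ← CStarRing.star_mul_self_eq_zero_iff, star_sub, star_mul,
      (cfc_predicate χ W : IsSelfAdjoint (cfc χ W)).star_eq]
    calc _ = cfc χ W * (W * cfc χ W) - cfc χ W * W - W * cfc χ W + W := by
          rw [hWdef]; noncomm_ring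
      _ = 0 := by rw [e3]; abel
  have e6 : p = cfc χ W := by
    rw [← e4]
    conv_rhs => rw [hpu, mul_assoc, e5]
    exact hpu
  refine ⟨u * cfc f W, ?_, by rw [← mul_assoc, hqu]⟩
  rw [star_mul, (cfc_predicate f W : IsSelfAdjoint (cfc f W)).star_eq, ← mul_assoc,
    mul_assoc (cfc f W), ← hWdef, e2, e6]

/-- The Jacobson radical is nilpotent, but x*x is self-adjoint, and a nilpotent self-adjoint element
is zero by the C*-identity. -/
theorem isSemisimpleRing_of_finiteDimensional (F : Type*) [CStarAlgebra F]
    [FiniteDimensional ℂ F] : IsSemisimpleRing F := by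
  have : IsArtinianRing F := IsArtinianRing.of_finite ℂ F
  rw [IsArtinianRing.isSemisimpleRing_iff_jacobson, eq_bot_iff]
  intro x hx
  obtain ⟨n, hn⟩ := IsSemiprimaryRing.isNilpotent (R := F)
  have h1 : star x * x ∈ Ring.jacobson F := Ideal.mul_mem_left _ _ hx
  have h2 : (star x * x) ^ n = 0 := by
    have := Ideal.pow_mem_pow h1 n
    rw [hn] at this
    simpa using this
  have h3 : (star x * x) ^ 2 ^ n = 0 := pow_eq_zero_of_le Nat.lt_two_pow_self.le h2
  have h4 : ‖star x * x‖ ^ 2 ^ n = 0 := by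
    rw [← (IsSelfAdjoint.star_mul_self x).norm_pow_two_pow, h3, norm_zero]
  have h5 : star x * x = 0 := norm_eq_zero.1 (pow_eq_zero_iff (by positivity) |>.1 h4)
  simpa using (CStarRing.star_mul_self_eq_zero_iff x).1 h5

/-- Used to count ranks with multiplicity: the trace is visibly additive over diagonal blocks. -/
theorem Matrix.rank_eq_trace_of_isIdempotentElem {n : Type*} [Fintype n] [DecidableEq n]
    {P : Matrix n n ℂ} (hP : IsIdempotentElem P) : (P.rank : ℂ) = P.trace := by
  have h : IsIdempotentElem (Matrix.toLin' P) := by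
    rw [IsIdempotentElem, Module.End.mul_eq_comp, ← Matrix.toLin'_mul, hP.eq]
  rw [← Matrix.trace_toLin'_eq P, (LinearMap.IsIdempotentElem.isProj_range _ h).trace]
  rfl

/-- Embed the range of P in that of Q by a linear map f. Then Y lifts f ∘ P through Q, and X inverts
f on its image. -/
theorem Matrix.exists_eq_mul_mul_of_rank_le {n : Type*} [Fintype n] [DecidableEq n]
    {P Q : Matrix n n ℂ} (h : P.rank ≤ Q.rank) : ∃ X Y : Matrix n n ℂ, P = X * Q * Y := by
  let p := Matrix.toLin' P
  let q := Matrix.toLin' Q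
  have hr : Module.finrank ℂ (LinearMap.range p) ≤ Module.finrank ℂ (LinearMap.range q) := h
  obtain ⟨f, hf⟩ := finrank_le_iff_exists_linearMap.1 hr
  obtain ⟨g, hg⟩ := q.rangeRestrict.exists_rightInverse_of_surjective q.range_rangeRestrict
  obtain ⟨k, hk⟩ := ((LinearMap.range q).subtype ∘ₗ f).exists_leftInverse_of_injective
    (LinearMap.ker_eq_bot.2 (Subtype.val_injective.comp hf))
  refine ⟨LinearMap.toMatrix' ((LinearMap.range p).subtype ∘ₗ k),
    LinearMap.toMatrix' (g ∘ₗ f ∘ₗ p.rangeRestrict), ?_⟩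
  apply Matrix.toLin'.injective
  rw [Matrix.toLin'_mul, Matrix.toLin'_mul, Matrix.toLin'_toMatrix', Matrix.toLin'_toMatrix']
  refine LinearMap.ext fun v => ?_
  have h1 : q (g (f (p.rangeRestrict v))) = f (p.rangeRestrict v) :=
    congrArg Subtype.val (LinearMap.congr_fun hg (f (p.rangeRestrict v)))
  have h2 : k (f (p.rangeRestrict v)) = p.rangeRestrict v :=
    LinearMap.congr_fun hk (p.rangeRestrict v)
  change p v = k (q (g (f (p.rangeRestrict v))))
  rw [h1, h2]
  rfl

/-- Cancellation of multiplicities for projections over a finite-dimensional C*-algebra. -/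
theorem exists_partialIsometry_of_diagCopies {F : Type*} [CStarAlgebra F] [PartialOrder F]
    [StarOrderedRing F] [FiniteDimensional ℂ F]
    {ι κ : Type} [Fintype ι] [DecidableEq ι] [Fintype κ] [DecidableEq κ] [Nonempty κ]
    {p q : CStarMatrix ι ι F} (hp : IsStarProjection p) (hq : IsStarProjection q)
    {S R : CStarMatrix (κ × ι) (κ × ι) F} (h : diagCopies κ p = S * diagCopies κ q * R) :
    ∃ t : CStarMatrix ι ι F, star t * t = p ∧ q * t = t := by
  have := isSemisimpleRing_of_finiteDimensional F
  -- The Wedderburn isomorphism need not preserve the involution. Idempotents, ranks and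
  -- factorizations p = XqY are purely algebraic, and a partial isometry is recovered from such a
  -- factorization at the end.
  obtain ⟨n, d, -, ⟨ρ⟩⟩ := IsSemisimpleRing.exists_algEquiv_pi_matrix_of_isAlgClosed ℂ F
  let ρ' : ∀ (J : Type) [Fintype J] [DecidableEq J] (i : Fin n),
      CStarMatrix J J F →+* Matrix (J × Fin (d i)) (J × Fin (d i)) ℂ := fun J _ _ i =>
    ((Matrix.compRingEquiv J (Fin (d i)) ℂ).toRingHom.comp
      ((Pi.evalRingHom _ i).comp ρ.toRingEquiv.toRingHom).mapMatrix).comp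
        CStarMatrix.ofMatrixRingEquiv.symm.toRingHom
  have hρ' : ∀ (J : Type) [Fintype J] [DecidableEq J] (i : Fin n) (X : CStarMatrix J J F) a b,
      ρ' J i X a b = ρ (X a.1 b.1) i a.2 b.2 := fun J _ _ i X a b => rfl
  have htr : ∀ (i : Fin n) (X : CStarMatrix ι ι F),
      (ρ' (κ × ι) i (diagCopies κ X)).trace = Fintype.card κ * (ρ' ι i X).trace := fun i X => by
    simp only [Matrix.trace, Matrix.diag, hρ', Fintype.sum_prod_type]
    simp only [diagCopies_apply, if_true, Finset.sum_const, Finset.card_univ, nsmul_eq_mul]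
  have hidem : ∀ X : CStarMatrix ι ι F, IsStarProjection X → ∀ i,
      (ρ' (κ × ι) i (diagCopies κ X)).rank = Fintype.card κ * (ρ' ι i X).rank := fun X hX i => by
    have h1 : IsIdempotentElem (ρ' ι i X) :=
      hX.isIdempotentElem.map (ρ' ι i)
    have h2 : IsIdempotentElem (ρ' (κ × ι) i (diagCopies κ X)) :=
      (hX.isIdempotentElem.map (diagCopies κ)).map (ρ' (κ × ι) i)
    have := htr i X
    rw [← Matrix.rank_eq_trace_of_isIdempotentElem h1,
      ← Matrix.rank_eq_trace_of_isIdempotentElem h2] at this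
    exact_mod_cast this
  have hrank : ∀ i, (ρ' ι i p).rank ≤ (ρ' ι i q).rank := fun i => by
    have h1 : ρ' (κ × ι) i (diagCopies κ p) =
        ρ' (κ × ι) i S * ρ' (κ × ι) i (diagCopies κ q) * ρ' (κ × ι) i R := by
      rw [h, map_mul, map_mul]
    have h2 : (ρ' (κ × ι) i (diagCopies κ p)).rank ≤ (ρ' (κ × ι) i (diagCopies κ q)).rank := by
      rw [h1]
      exact (Matrix.rank_mul_le_left _ _).trans (Matrix.rank_mul_le_right _ _)
    rw [hidem p hp, hidem q hq] at h2
    exact Nat.le_of_mul_le_mul_left h2 Fintype.card_pos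
  choose X Y hXY using fun i => Matrix.exists_eq_mul_mul_of_rank_le (hrank i)
  let lift : (∀ i, Matrix (ι × Fin (d i)) (ι × Fin (d i)) ℂ) → CStarMatrix ι ι F := fun Z =>
    CStarMatrix.ofMatrix fun a b => ρ.symm fun i => Matrix.of fun c e => Z i (a, c) (b, e)
  have hlift : ∀ Z i, ρ' ι i (lift Z) = Z i := fun Z i => by
    ext a b
    rw [hρ']
    change ρ (ρ.symm fun i => Matrix.of fun c e => Z i (a.1, c) (b.1, e)) i a.2 b.2 = Z i a b
    rw [AlgEquiv.apply_symm_apply]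
    rfl
  have hpq : p = lift X * q * lift Y := by
    ext a b
    apply ρ.injective
    ext i c e
    have h1 : ρ' ι i p = ρ' ι i (lift X * q * lift Y) := by
      rw [map_mul, map_mul, hlift, hlift, hXY i]
    exact congrFun (congrFun h1 (a, c)) (b, e)
  have : FiniteDimensional ℂ (CStarMatrix ι ι F) :=
    inferInstanceAs (FiniteDimensional ℂ (Matrix ι ι F))
  exact exists_partialIsometry_of_eq_mul hp hq hpq

/-! ### Amplifications of completely positive contractions -/

-- For a fixed matrix size this turns entrywise convergence into norm convergence, uniformly in the
-- algebra of entries, which may vary along a net.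
open CStarMatrix WithCStarModule in
theorem CStarMatrix.norm_le_sum_norm_entry {m n A : Type*} [Fintype m] [Fintype n]
    [NonUnitalCStarAlgebra A] [PartialOrder A] [StarOrderedRing A] (M : CStarMatrix m n A) :
    ‖M‖ ≤ ∑ j, ∑ i, ‖M i j‖ := by
  rw [norm_def]
  refine (toCLM M).opNorm_le_bound (by positivity) fun v => ?_
  simp only [toCLM_apply_eq_sum, Finset.sum_mul]
  apply pi_norm_le_sum_norm _ |>.trans
  gcongr with i _
  apply norm_sum_le _ _ |>.trans
  gcongr with j _
  apply norm_mul_le _ _ |>.trans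
  rw [mul_comm]
  gcongr
  exact norm_apply_le_norm v j

/-- The diagonal matrices with constant diagonal. -/
def diagConst (ι : Type) {B : Type*} [Fintype ι] [DecidableEq ι] [NonUnitalCStarAlgebra B] :
    B →⋆ₙₐ[ℂ] CStarMatrix ι ι B where
  toFun x := CStarMatrix.ofMatrix fun a b => if a = b then x else 0
  map_smul' c x := by
    ext a b
    change (if a = b then c • x else 0) = c • (if a = b then x else 0)
    split_ifs <;> simp
  map_zero' := by
    ext a b
    change (if a = b then (0 : B) else 0) = 0
    simp
  map_add' x y := by
    ext a b
    change (if a = b then x + y else 0) = (if a = b then x else 0) + (if a = b then y else 0)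
    split_ifs <;> simp
  map_mul' x y := by
    ext a b
    change (if a = b then x * y else 0) =
      ∑ c, (if a = c then x else 0) * (if c = b then y else 0)
    simp
  map_star' x := by
    ext a b
    change (if a = b then star x else 0) = star (if b = a then x else 0)
    simp only [eq_comm (a := a)]
    split_ifs <;> simp

theorem diagConst_apply (ι : Type) {B : Type*} [Fintype ι] [DecidableEq ι]
    [NonUnitalCStarAlgebra B] (x : B) (a b : ι) :
    diagConst ι x a b = if a = b then x else 0 := rfl

theorem diagConst_mul_mul_apply {ι : Type} {B : Type*} [Fintype ι] [DecidableEq ι]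
    [NonUnitalCStarAlgebra B] (x y : B) (M : CStarMatrix ι ι B) (a b : ι) :
    (diagConst ι x * M * diagConst ι y) a b = x * M a b * y := by
  simp only [CStarMatrix.mul_apply, diagConst_apply]
  simp

namespace IsCompletelyPositive

variable {C D : Type*} [NonUnitalCStarAlgebra C] [PartialOrder C] [StarOrderedRing C]
  [NonUnitalCStarAlgebra D] [PartialOrder D] [StarOrderedRing D] {f : C →ₗ[ℂ] D}

/-- As C may lack a unit, M is compressed by an approximate unit e on the diagonal. From eMe ≤ ‖M‖e²
the image under f has norm at most ‖M‖‖f(e²)‖ ≤ ‖M‖, and e tends to the limit. -/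
theorem norm_map_le_of_nonneg (hf : IsCompletelyPositive f) (hc : ∀ x, ‖f x‖ ≤ ‖x‖) {ι : Type}
    [Fintype ι] {M : CStarMatrix ι ι C} (hM : 0 ≤ M) : ‖M.map f‖ ≤ ‖M‖ := by
  classical
  have hl := CStarAlgebra.increasingApproximateUnit C
  have := hl.neBot
  have hcont : Continuous f := by
    have : ∃ K : ℝ, ∀ x, ‖f x‖ ≤ K * ‖x‖ := ⟨1, fun x => by simpa using hc x⟩
    exact (f.mkContinuousOfExistsBound this).continuous
  have h1 : Tendsto (fun e => (diagConst ι e * M * diagConst ι e).map f)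
      (CStarAlgebra.approximateUnit C) (𝓝 (M.map f)) := by
    rw [CuntzLE.tendsto_iff]
    intro a b
    simp only [CStarMatrix.map_apply, diagConst_mul_mul_apply]
    refine (hcont.tendsto _).comp ?_
    have hR := tendsto_iff_norm_sub_tendsto_zero.1 (hl.tendsto_mul_right (M a b))
    have hL := tendsto_iff_norm_sub_tendsto_zero.1 (hl.tendsto_mul_left (M a b))
    rw [tendsto_iff_norm_sub_tendsto_zero]
    refine squeeze_zero' (Eventually.of_forall fun _ => norm_nonneg _) ?_
      (by simpa using hR.add hL)
    filter_upwards [hl.eventually_norm] with e he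
    have : e * M a b * e - M a b = (e * M a b - M a b) * e + (M a b * e - M a b) := by
      rw [sub_mul]; abel
    rw [this]
    refine (norm_add_le _ _).trans ?_
    have h2 : ‖(e * M a b - M a b) * e‖ ≤ ‖e * M a b - M a b‖ :=
      (norm_mul_le _ _).trans (mul_le_of_le_one_right (norm_nonneg _) he)
    linarith
  refine le_of_tendsto h1.norm ?_
  filter_upwards [hl.eventually_norm, hl.eventually_star_eq] with e he hes
  have hds : star (diagConst ι e) = diagConst ι e := by rw [← StarHomClass.map_star, hes]
  have hle : diagConst ι e * M * diagConst ι e ≤ ‖M‖ • (diagConst ι e * diagConst ι e) := by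
    have := CStarAlgebra.star_left_conjugate_le_norm_smul (a := diagConst ι e) (b := M)
      (.of_nonneg hM)
    rwa [hds] at this
  have hpos : 0 ≤ diagConst ι e * M * diagConst ι e := by
    have := star_left_conjugate_nonneg hM (diagConst ι e)
    rwa [hds] at this
  have hmono : (diagConst ι e * M * diagConst ι e).map f ≤ ‖M‖ • diagConst ι (f (e * e)) := by
    have h3 := hf ι _ (sub_nonneg.2 hle)
    rw [← sub_nonneg]
    convert h3 using 1
    ext a b
    rw [← map_mul]
    change ‖M‖ • (if a = b then f (e * e) else 0) - f _ =
      f (‖M‖ • (if a = b then e * e else 0) - _)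
    rw [map_sub, ← Complex.coe_smul, ← Complex.coe_smul, map_smul, apply_ite f, map_zero]
  calc _ ≤ ‖‖M‖ • diagConst ι (f (e * e))‖ :=
        CStarAlgebra.norm_le_norm_of_nonneg_of_le (hf ι _ hpos) hmono
    _ ≤ ‖M‖ * ‖f (e * e)‖ := by
        have : ‖M‖ • diagConst ι (f (e * e)) = ((‖M‖ : ℝ) : ℂ) • diagConst ι (f (e * e)) := by
          ext a b
          exact (Complex.coe_smul _ _).symm
        rw [this, norm_smul, Complex.norm_real, norm_norm]
        gcongr
        exact NonUnitalStarAlgHom.norm_apply_le _ _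
    _ ≤ ‖M‖ * 1 := by
        gcongr
        refine (hc _).trans ((norm_mul_le _ _).trans ?_)
        exact mul_le_one₀ he (norm_nonneg _) he
    _ = ‖M‖ := mul_one _

/-- The constant 4 comes from writing M as a combination of four positive elements; any constant
independent of f would do. -/
theorem norm_map_le (hf : IsCompletelyPositive f) (hc : ∀ x, ‖f x‖ ≤ ‖x‖) {ι : Type}
    [Fintype ι] (M : CStarMatrix ι ι C) : ‖M.map f‖ ≤ 4 * ‖M‖ := by
  obtain ⟨x, hx, hn, h⟩ := CStarAlgebra.exists_sum_four_nonneg M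
  have : M.map f = ∑ i : Fin 4, Complex.I ^ (i : ℕ) • (x i).map f := by
    conv_lhs => rw [h]
    change CStarMatrix.mapₗ f _ = ∑ i : Fin 4, Complex.I ^ (i : ℕ) • CStarMatrix.mapₗ f (x i)
    rw [map_sum]
    simp only [map_smul]
  rw [this]
  calc _ ≤ ∑ i : Fin 4, ‖Complex.I ^ (i : ℕ) • (x i).map f‖ := norm_sum_le _ _
    _ ≤ ∑ _i : Fin 4, ‖M‖ := by
        refine Finset.sum_le_sum fun i _ => ?_
        rw [norm_smul, norm_pow, Complex.norm_I, one_pow, one_mul]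
        exact (hf.norm_map_le_of_nonneg hc (hx i)).trans (hn i)
    _ = 4 * ‖M‖ := by simp

theorem map_conjTranspose (hf : IsCompletelyPositive f) {ι : Type} [Fintype ι]
    (M : CStarMatrix ι ι C) : (star M).map f = star (M.map f) := by
  ext a b
  exact hf.map_star _

end IsCompletelyPositive

/-- A positive element `E` is approximated by `d E⁴ d`, with a bound for `d`. -/
theorem exists_approx_conj_pow_four {B : Type*} [NonUnitalCStarAlgebra B] [PartialOrder B]
    [StarOrderedRing B] {δ : ℝ} (hδ : 0 < δ) : ∃ D : ℝ, 0 ≤ D ∧ ∀ E : B, 0 ≤ E →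
    ∃ d : B, IsSelfAdjoint d ∧ ‖d‖ ≤ D ∧ ‖E - d * (E * E * (E * E)) * d‖ ≤ δ := by
  let η := δ / 4
  have hη : 0 < η := by positivity
  refine ⟨1 / (η * √η), by positivity, fun E hE => ?_⟩
  have hEs : IsSelfAdjoint E := .of_nonneg hE
  have hnn : ∀ t ∈ quasispectrum ℝ E, 0 ≤ t := fun t ht => quasispectrum_nonneg_of_nonneg E hE t ht
  -- A smoothed version of t^(-3/2), for which g t⁴ g = t w⁴ with w = t/(t + η). The error t(1 −
  -- w)(1 + w)(1 + w²) is at most 4η = δ, and g ≤ 1/(η√η) uniformly in E.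
  let g : ℝ → ℝ := fun t => √t / (t + η) ^ 2
  have hg : ContinuousOn g (quasispectrum ℝ E) := by
    refine ContinuousOn.div (by fun_prop) (by fun_prop) fun t ht => ?_
    have := hnn t ht
    positivity
  have hid : cfcₙ (fun t : ℝ => t) E = E := cfcₙ_id' ℝ E
  have h1 : cfcₙ (fun t : ℝ => t * t * (t * t)) E = E * E * (E * E) := by
    rw [cfcₙ_mul (fun t : ℝ => t * t) (fun t : ℝ => t * t) E, cfcₙ_mul (fun t : ℝ => t)
      (fun t : ℝ => t) E, hid]
  have h2 : cfcₙ (fun t : ℝ => g t * (t * t * (t * t)) * g t) E =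
      cfcₙ g E * (E * E * (E * E)) * cfcₙ g E := by
    have hg0 : g 0 = 0 := by simp [g]
    rw [cfcₙ_mul (fun t => g t * (t * t * (t * t))) g E
      (hg.mul (by fun_prop)) (by simp) hg hg0,
      cfcₙ_mul g (fun t : ℝ => t * t * (t * t)) E hg hg0 (by fun_prop) (by simp), h1]
  have h3 : cfcₙ (fun t : ℝ => t - g t * (t * t * (t * t)) * g t) E =
      E - cfcₙ g E * (E * E * (E * E)) * cfcₙ g E := by
    rw [cfcₙ_sub (fun t : ℝ => t) (fun t => g t * (t * t * (t * t)) * g t) E (by fun_prop)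
      (by simp) ((hg.mul (by fun_prop)).mul hg) (by simp), h2, hid]
  refine ⟨cfcₙ g E, cfcₙ_predicate g E, ?_, ?_⟩
  · refine norm_cfcₙ_le fun t ht => ?_
    have ht0 := hnn t ht
    rw [Real.norm_of_nonneg (by positivity)]
    have hsq : √η * √t ≤ t + η := by
      nlinarith [sq_nonneg (√t - √η), Real.sq_sqrt ht0, Real.sq_sqrt hη.le]
    have hs : 0 < √η := Real.sqrt_pos.2 hη
    rw [div_le_div_iff₀ (by positivity) (by positivity)]
    calc √t * (η * √η) = η * (√η * √t) := by ring
      _ ≤ (t + η) * (t + η) := by gcongr; linarith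
      _ = 1 * (t + η) ^ 2 := by ring
  · rw [← h3]
    refine norm_cfcₙ_le fun t ht => ?_
    have ht0 := hnn t ht
    have hpos : 0 < t + η := by positivity
    have hst := Real.sq_sqrt ht0
    obtain ⟨w, hw⟩ : ∃ w, w = t / (t + η) := ⟨_, rfl⟩
    have hw0 : 0 ≤ w := by rw [hw]; positivity
    have hw1 : w ≤ 1 := by rw [hw, div_le_one hpos]; linarith
    have htw : t * (1 - w) ≤ η := by
      have : t * (1 - w) = w * η := by rw [hw]; field_simp; ring
      rw [this]
      nlinarith
    have e : t - g t * (t * t * (t * t)) * g t = t * (1 - w) * (1 + w) * (1 + w ^ 2) := by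
      have : g t * (t * t * (t * t)) * g t = t * w ^ 4 := by
        simp only [g, hw]
        field_simp
        rw [hst]
        ring
      rw [this]
      ring
    have h0 : 0 ≤ t * (1 - w) := mul_nonneg ht0 (by linarith)
    rw [e, Real.norm_of_nonneg (by positivity)]
    calc t * (1 - w) * (1 + w) * (1 + w ^ 2) ≤ η * 2 * 2 := by
          gcongr
          · linarith
          · nlinarith
      _ = δ := by simp only [η]; ring

/-! ### Comparison in a single finite-dimensional approximation -/

/-- The element 1 − (p − T) is invertible, and multiplying it by p on the left gives pT. -/
theorem eq_mul_inverse_of_norm_sub_lt_one {H : Type*} [CStarAlgebra H] {p T : H}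
    (hp : IsStarProjection p) (h : ‖p - T‖ < 1) : ∃ R, p = p * T * R := by
  have hu : IsUnit (1 - (p - T)) := isUnit_one_sub_of_norm_lt_one h
  obtain ⟨R, hR⟩ := hu.exists_right_inv
  refine ⟨R, ?_⟩
  have h1 : p * T = p * (1 - (p - T)) := by
    rw [mul_sub, mul_sub, hp.isIdempotentElem.eq, mul_one]
    abel
  rw [h1, mul_assoc, hR, mul_one]

theorem inverse_mul_cube_mul {R : Type*} [Semigroup R] {p X y : R} (hp : IsIdempotentElem p)
    (h1 : y * X = p) (h2 : X * y = p) (h3 : X * p = p * X) : y * (X * X * X) * (y * y) = p := by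
  calc y * (X * X * X) * (y * y) = (y * X) * X * (X * y) * y := by simp only [mul_assoc]
    _ = p * (X * p) * y := by rw [h1, h2]; simp only [mul_assoc]
    _ = p * p * (X * y) := by rw [h3]; simp only [mul_assoc]
    _ = p := by rw [h2, hp.eq, hp.eq]

/-- The estimate that compares the support of `X` with a compression of `Q`. -/
theorem norm_sub_conj_lt_one {H : Type*} [NonUnitalCStarAlgebra H] {p X y V W B Q L : H} {δ e : ℝ}
    (hδ : 0 < δ) (hp : IsStarProjection p) (h1 : y * X = p) (h2 : X * y = p)
    (h3 : X * p = p * X) (hy : ‖y‖ ≤ δ⁻¹) (hXL : ‖X - L‖ ≤ δ / 4)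
    (hL : ‖X * L * X - V * B * W‖ ≤ δ ^ 3 / 4) (hBQ : ‖B - Q‖ ≤ e)
    (he : ‖V‖ * e * ‖W‖ ≤ δ ^ 3 / 4) : ‖p - y * V * Q * (W * (y * y))‖ < 1 := by
  -- With p = yX = Xy one has p = yX³y² and pLpy = yXLXy². The three terms replace X by L, then XLX
  -- by VBW, then B by Q; each has norm at most 1/4.
  have key : p - y * V * Q * (W * (y * y)) = p * (X - L) * p * y +
      y * (X * L * X - V * B * W) * (y * y) + y * (V * (B - Q) * W) * (y * y) := by
    have e1 : p * (X - L) * p * y = p - y * (X * L * X) * (y * y) := by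
      rw [← inverse_mul_cube_mul hp.isIdempotentElem h1 h2 h3]
      nth_rewrite 1 [inverse_mul_cube_mul hp.isIdempotentElem h1 h2 h3]
      nth_rewrite 1 [inverse_mul_cube_mul hp.isIdempotentElem h1 h2 h3]
      rw [← h1]
      nth_rewrite 2 [h1]
      rw [← h2]
      noncomm_ring
    rw [e1]
    noncomm_ring
  have hpn : ‖p‖ ≤ 1 := hp.norm_le
  have hyy : ‖y * y‖ ≤ δ⁻¹ * δ⁻¹ := (norm_mul_le _ _).trans (by gcongr)
  have n1 : ‖p * (X - L) * p * y‖ ≤ 1 * (δ / 4) * 1 * δ⁻¹ := by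
    refine (norm_mul_le _ _).trans ?_
    gcongr
    refine (norm_mul_le _ _).trans ?_
    gcongr
    refine (norm_mul_le _ _).trans ?_
    gcongr
  have n2 : ‖y * (X * L * X - V * B * W) * (y * y)‖ ≤ δ⁻¹ * (δ ^ 3 / 4) * (δ⁻¹ * δ⁻¹) := by
    refine (norm_mul_le _ _).trans ?_
    gcongr
    refine (norm_mul_le _ _).trans ?_
    gcongr
  have n3 : ‖y * (V * (B - Q) * W) * (y * y)‖ ≤ δ⁻¹ * (δ ^ 3 / 4) * (δ⁻¹ * δ⁻¹) := by
    refine (norm_mul_le _ _).trans ?_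
    gcongr
    refine (norm_mul_le _ _).trans ?_
    gcongr
    refine le_trans ?_ he
    refine (norm_mul_le _ _).trans ?_
    gcongr
    refine (norm_mul_le _ _).trans ?_
    gcongr
  have c1 : 1 * (δ / 4) * 1 * δ⁻¹ = 1 / 4 := by field_simp
  have c2 : δ⁻¹ * (δ ^ 3 / 4) * (δ⁻¹ * δ⁻¹) = 1 / 4 := by field_simp
  rw [c1] at n1
  rw [c2] at n2 n3
  rw [key]
  refine (norm_add₃_le).trans_lt ?_
  linarith

theorem map_mul_map_of_mul_eq {F B : Type*} [CStarAlgebra F] [NonUnitalCStarAlgebra B]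
    {φ : F →ₗ[ℂ] B} (hmul : ∀ x y, φ x * φ y = φ 1 * φ (x * y)) {ι : Type} [Fintype ι]
    [DecidableEq ι] (X Y : CStarMatrix ι ι F) :
    X.map φ * Y.map φ = (1 : CStarMatrix ι ι F).map φ * (X * Y).map φ := by
  ext a b
  have h1 : (X.map φ * Y.map φ) a b = φ 1 * φ ((X * Y) a b) := by
    simp only [CStarMatrix.mul_apply, CStarMatrix.map_apply]
    rw [Finset.sum_congr rfl fun c _ => hmul (X a c) (Y c b), ← Finset.mul_sum, ← map_sum]
  have h2 : ((1 : CStarMatrix ι ι F).map φ * (X * Y).map φ) a b =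
      ∑ c, φ ((1 : CStarMatrix ι ι F) a c) * φ ((X * Y) c b) := CStarMatrix.mul_apply
  rw [h1, h2, Finset.sum_eq_single a]
  · rw [show (1 : CStarMatrix ι ι F) a a = 1 from Matrix.one_apply_eq a]
  · intro c _ hc
    rw [show (1 : CStarMatrix ι ι F) a c = 0 from Matrix.one_apply_ne' hc, map_zero, zero_mul]
  · simp

/-- A product of four images depends only on the product of the four arguments, so an identity
between fourfold products passes through φ even though φ is not multiplicative. -/
theorem mul_four_eq_of_mul_eq {F B : Type*} [CStarAlgebra F] [NonUnitalCStarAlgebra B]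
    {φ : F →ₗ[ℂ] B} (hmul : ∀ x y, φ x * φ y = φ 1 * φ (x * y)) {ι : Type} [Fintype ι]
    [DecidableEq ι] (X Y Z W : CStarMatrix ι ι F) :
    X.map φ * (Y.map φ * Z.map φ) * W.map φ =
      (1 : CStarMatrix ι ι F).map φ * ((1 : CStarMatrix ι ι F).map φ *
        ((1 : CStarMatrix ι ι F).map φ * (X * (Y * Z) * W).map φ)) := by
  have h := fun X Y => map_mul_map_of_mul_eq (ι := ι) hmul X Y
  rw [← mul_assoc (X.map φ), h X Y, mul_assoc ((1 : CStarMatrix ι ι F).map φ), h (X * Y) Z,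
    mul_assoc ((1 : CStarMatrix ι ι F).map φ),
    mul_assoc ((1 : CStarMatrix ι ι F).map φ), h (X * Y * Z) W, mul_assoc X Y Z]

/-- In a finite-dimensional approximation, `k [a] ≤ k [b]` gives a comparison of the supports. -/
theorem exists_partialIsometry_of_norm_sub_le {A G : Type*} [NonUnitalCStarAlgebra A]
    [PartialOrder A] [StarOrderedRing A] [CStarAlgebra G] [PartialOrder G] [StarOrderedRing G]
    [FiniteDimensional ℂ G] {ι κ : Type} [Fintype ι] [DecidableEq ι] [Fintype κ] [DecidableEq κ]
    [Nonempty κ] {ψ : A →ₗ[ℂ] G} (hψ : IsCompletelyPositive ψ) (hψc : ∀ x, ‖ψ x‖ ≤ ‖x‖)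
    {a b : CStarMatrix ι ι A} {v : CStarMatrix (κ × ι) (κ × ι) A} {δ δ' η : ℝ} (hδ : 0 < δ)
    (hδ' : 0 ≤ δ') (hv : ‖diagCopies κ a - star v * diagCopies κ b * v‖ ≤ δ / 16)
    (h1 : ‖(diagCopies κ a).map ψ * (star v * (diagCopies κ b * v)).map ψ -
      (diagCopies κ a * star v).map ψ * (diagCopies κ b * v).map ψ‖ ≤ η)
    (h2 : ‖(diagCopies κ b * v).map ψ * (diagCopies κ a).map ψ -
      (diagCopies κ b).map ψ * (v * diagCopies κ a).map ψ‖ ≤ η)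
    (hη : η * (4 * ‖diagCopies κ a‖) + 4 * ‖diagCopies κ a * star v‖ * η ≤ δ ^ 3 / 4)
    (hδ'' : 4 * ‖diagCopies κ a * star v‖ * δ' * (4 * ‖v * diagCopies κ a‖) ≤ δ ^ 3 / 4)
    {p y q : CStarMatrix ι ι G} (hp : IsStarProjection p) (hpy : y * a.map ψ = p)
    (hpy' : a.map ψ * y = p) (hcomm : a.map ψ * p = p * a.map ψ) (hy : ‖y‖ ≤ δ⁻¹)
    (hq : IsStarProjection q) (hbq : ‖b.map ψ - b.map ψ * q‖ ≤ δ') :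
    ∃ t : CStarMatrix ι ι G, star t * t = p ∧ q * t = t := by
  have hn := fun M => hψ.norm_map_le hψc (ι := κ × ι) M
  have hD := fun M : CStarMatrix ι ι G => NonUnitalStarAlgHom.norm_apply_le (diagCopies κ) M
  have hp' : IsStarProjection (diagCopies κ p) := hp.map (diagCopies κ)
  have hlt := norm_sub_conj_lt_one (H := CStarMatrix (κ × ι) (κ × ι) G) (p := diagCopies κ p)
    (X := (diagCopies κ a).map ψ) (y := diagCopies κ y) (V := (diagCopies κ a * star v).map ψ)
    (W := (v * diagCopies κ a).map ψ) (B := (diagCopies κ b).map ψ)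
    (Q := diagCopies κ (b.map ψ * q)) (L := (star v * diagCopies κ b * v).map ψ) (e := δ')
    hδ hp' (by rw [← diagCopies_map, ← map_mul, hpy]) (by rw [← diagCopies_map, ← map_mul, hpy'])
    (by rw [← diagCopies_map, ← map_mul, ← map_mul, hcomm]) ((hD y).trans hy) ?_ ?_ ?_ ?_
  · obtain ⟨R, hR⟩ := eq_mul_inverse_of_norm_sub_lt_one hp' hlt
    refine exists_partialIsometry_of_diagCopies hp hq (κ := κ)
      (S := diagCopies κ p * (diagCopies κ y * (diagCopies κ a * star v).map ψ *
        diagCopies κ (b.map ψ)))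
      (R := (v * diagCopies κ a).map ψ * (diagCopies κ y * diagCopies κ y) * R) ?_
    refine hR.trans ?_
    rw [map_mul (diagCopies κ) (b.map ψ) q]
    simp only [mul_assoc]
  -- The bound 4 for the amplification of ψ turns δ/16 into the required δ/4.
  · have := hn (diagCopies κ a - star v * diagCopies κ b * v)
    have e : (diagCopies κ a - star v * diagCopies κ b * v).map ψ =
      (diagCopies κ a).map ψ - (star v * diagCopies κ b * v).map ψ :=
      map_sub (CStarMatrix.mapₗ ψ) _ _
    rw [← e]
    linarith
  · rw [mul_assoc (star v)]
    -- Two uses of approximate associativity: first v* moves left to a, then v moves right to a.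
    have e : (diagCopies κ a).map ψ * (star v * (diagCopies κ b * v)).map ψ *
        (diagCopies κ a).map ψ -
        (diagCopies κ a * star v).map ψ * (diagCopies κ b).map ψ * (v * diagCopies κ a).map ψ =
        ((diagCopies κ a).map ψ * (star v * (diagCopies κ b * v)).map ψ -
          (diagCopies κ a * star v).map ψ * (diagCopies κ b * v).map ψ) * (diagCopies κ a).map ψ +
        (diagCopies κ a * star v).map ψ * ((diagCopies κ b * v).map ψ * (diagCopies κ a).map ψ -
          (diagCopies κ b).map ψ * (v * diagCopies κ a).map ψ) := by
      rw [sub_mul, mul_sub]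
      simp only [mul_assoc]
      abel
    rw [e]
    refine (norm_add_le _ _).trans (le_trans ?_ hη)
    gcongr
    · refine (norm_mul_le _ _).trans ?_
      gcongr
      · exact (norm_nonneg _).trans h1
      · exact hn _
    · refine (norm_mul_le _ _).trans ?_
      gcongr
      exact hn _
  · rw [← diagCopies_map, ← map_sub]
    exact (hD _).trans hbq
  · refine le_trans ?_ hδ''
    gcongr
    · exact hn _
    · exact hn _

/-- Here p = t*t = t* q² t with q = yY = Yy, so (Xp)⁴ = X²t*(yY)(Yy)tX² is a product of the four
factors r*, Y, Y, r with r = ytX². Both sides are fourfold products, as needed to apply φ; hence the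
fourth power. -/
theorem exists_conj_eq_pow_four {F B : Type*} [CStarAlgebra F] [PartialOrder F]
    [StarOrderedRing F] [NonUnitalCStarAlgebra B] [PartialOrder B] [StarOrderedRing B]
    {φ : F →ₗ[ℂ] B} (hφ : IsCompletelyPositive φ) (hφc : ∀ x, ‖φ x‖ ≤ ‖x‖)
    (hmul : ∀ x y, φ x * φ y = φ 1 * φ (x * y)) {ι : Type} [Fintype ι] [DecidableEq ι]
    {X Y p q y t : CStarMatrix ι ι F} {δ : ℝ} (hX : 0 ≤ X) (hp : IsStarProjection p)
    (hXp : X * p = p * X) (hys : IsSelfAdjoint y) (hyY : y * Y = q) (hYy : Y * y = q)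
    (hy : ‖y‖ ≤ δ) (htp : star t * t = p) (hqt : q * t = t) :
    ∃ r : CStarMatrix ι ι B, ‖r‖ ≤ 4 * (δ * ‖X‖ * ‖X‖) ∧
      (X * p).map φ * (X * p).map φ * ((X * p).map φ * (X * p).map φ) =
        star r * (Y.map φ * Y.map φ) * r := by
  have hXs : IsSelfAdjoint X := .of_nonneg hX
  have hpp := hp.isIdempotentElem.eq
  have ht : ‖t‖ ≤ 1 := by
    have h1 : ‖t‖ * ‖t‖ ≤ 1 := by
      rw [← CStarRing.norm_star_mul_self, htp]
      exact hp.norm_le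
    nlinarith [norm_nonneg t]
  have h0 : 0 ≤ δ := (norm_nonneg _).trans hy
  refine ⟨(y * t * X * X).map φ, ?_, ?_⟩
  · refine (hφ.norm_map_le hφc _).trans ?_
    gcongr
    refine (norm_mul_le _ _).trans ?_
    gcongr
    refine (norm_mul_le _ _).trans ?_
    gcongr
    refine (norm_mul_le _ _).trans ?_
    nlinarith [norm_nonneg t, norm_nonneg y]
  · rw [← hφ.map_conjTranspose, mul_four_eq_of_mul_eq hmul, ← mul_assoc,
      mul_assoc ((X * p).map φ), mul_four_eq_of_mul_eq hmul]
    have e : star (y * t * X * X) * (Y * Y) * (y * t * X * X) =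
        X * p * (X * p * (X * p)) * (X * p) := by
      calc star (y * t * X * X) * (Y * Y) * (y * t * X * X)
          = X * X * star t * (y * Y) * (Y * y) * t * X * X := by
            simp only [star_mul, hXs.star_eq, hys.star_eq, mul_assoc]
        _ = X * X * (star t * t) * X * X := by
            rw [hyY, hYy]
            simp only [mul_assoc]
            rw [← mul_assoc q t, hqt, ← mul_assoc q t, hqt]
        _ = X * p * (X * p * (X * p)) * (X * p) := by
            rw [htp]
            have e1 : X * p * (X * p) = X * X * p := by
              rw [mul_assoc, ← mul_assoc p, ← hXp, mul_assoc X p p, hpp, mul_assoc]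
            have e2 : X * p * (X * p * (X * p)) * (X * p) =
              (X * p * (X * p)) * (X * p * (X * p)) := by simp only [mul_assoc]
            have e3 : p * (X * X) = X * X * p := by
              rw [← mul_assoc, ← hXp, mul_assoc, ← hXp, mul_assoc]
            rw [e2, e1, mul_assoc _ X X, mul_assoc (X * X) p, e3, mul_assoc (X * X) p, ← mul_assoc p,
              e3, mul_assoc (X * X) p, hpp]
    rw [e]

theorem exists_pos_mul_le (K : ℝ) {c : ℝ} (hc : 0 < c) : ∃ η : ℝ, 0 < η ∧ K * η ≤ c := by
  refine ⟨c / (|K| + 1), by positivity, ?_⟩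
  rw [mul_div_assoc', div_le_iff₀ (by positivity)]
  nlinarith [le_abs_self K, abs_nonneg K]

/-- If `k [a] ≤ k [b]`, then `φ (ψ a)` is approximately of the form `x* b x`, for approximations
`φ ∘ ψ` through finite-dimensional algebras that are approximately multiplicative enough. -/
theorem exists_conj_approx_of_diagCopies {A : Type*} [NonUnitalCStarAlgebra A]
    [PartialOrder A] [StarOrderedRing A] {ι κ : Type} [Fintype ι] [DecidableEq ι] [Fintype κ]
    [DecidableEq κ] [Nonempty κ] {a b s : CStarMatrix ι ι A}
    {v : CStarMatrix (κ × ι) (κ × ι) A} {δ : ℝ} (hδ : 0 < δ) (ha : 0 ≤ a) (hb : 0 ≤ b)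
    (hs : 0 ≤ s) (hv : ‖diagCopies κ a - star v * diagCopies κ b * v‖ ≤ δ / 16) :
    ∃ η : ℝ, 0 < η ∧ ∀ (G : Type u) [CStarAlgebra G] [PartialOrder G] [StarOrderedRing G]
      [FiniteDimensional ℂ G] (ψ : A →ₗ[ℂ] G) (φ : G →ₗ[ℂ] A), IsCompletelyPositive ψ →
      IsCompletelyPositive φ → (∀ x, ‖ψ x‖ ≤ ‖x‖) → (∀ x, ‖φ x‖ ≤ ‖x‖) →
      (∀ x y, φ x * φ y = φ 1 * φ (x * y)) →
      ‖(diagCopies κ a).map ψ * (star v * (diagCopies κ b * v)).map ψ -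
        (diagCopies κ a * star v).map ψ * (diagCopies κ b * v).map ψ‖ ≤ η →
      ‖(diagCopies κ b * v).map ψ * (diagCopies κ a).map ψ -
        (diagCopies κ b).map ψ * (v * diagCopies κ a).map ψ‖ ≤ η →
      ‖b.map (φ ∘ₗ ψ) * b.map (φ ∘ₗ ψ) - s.map (φ ∘ₗ ψ) * b * s.map (φ ∘ₗ ψ)‖ ≤ η →
      ∃ x : CStarMatrix ι ι A, ‖a.map (φ ∘ₗ ψ) - star x * b * x‖ ≤ 3 * δ := by
  -- D depends on δ alone, δ' also on a and v, and K on a and δ'. None involves G, ψ or φ, so a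
  -- single η serves all factorizations.
  obtain ⟨D, hD0, hD⟩ := exists_approx_conj_pow_four (B := CStarMatrix ι ι A) hδ
  have hc : 0 < δ ^ 3 / 4 := by positivity
  obtain ⟨δ', hδ', h1⟩ := exists_pos_mul_le
    (4 * ‖diagCopies κ a * star v‖ * (4 * ‖v * diagCopies κ a‖)) hc
  obtain ⟨η₁, hη₁, h2⟩ := exists_pos_mul_le
    (4 * ‖diagCopies κ a‖ + 4 * ‖diagCopies κ a * star v‖) hc
  let K := 4 * (δ'⁻¹ * ‖a‖ * ‖a‖)
  obtain ⟨η₂, hη₂, h3⟩ := exists_pos_mul_le (D * K * (K * D)) hδ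
  refine ⟨min η₁ η₂, lt_min hη₁ hη₂, fun G _ _ _ _ ψ φ hψ hφ hψc hφc hmul e1 e2 e3 => ?_⟩
  have : FiniteDimensional ℂ (CStarMatrix ι ι G) :=
    inferInstanceAs (FiniteDimensional ℂ (Matrix ι ι G))
  have hX : 0 ≤ a.map ψ := hψ ι a ha
  have hY : 0 ≤ b.map ψ := hψ ι b hb
  obtain ⟨p, y, hp, -, hyX, hXy, hy, hXp, hXp0, hXpδ⟩ := exists_spectral_truncation hX hδ
  obtain ⟨q, z, hq, hz, hzY, hYz, hzn, -, -, hYq⟩ := exists_spectral_truncation hY hδ'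
  obtain ⟨t, htp, hqt⟩ := exists_partialIsometry_of_norm_sub_le hψ hψc hδ hδ'.le hv
    (e1.trans (min_le_left _ _)) (e2.trans (min_le_left _ _)) (by linarith) (by linarith) hp hyX hXy
    hXp hy hq hYq
  obtain ⟨r, hr, hE⟩ := exists_conj_eq_pow_four hφ hφc hmul hX hp hXp hz hzY hYz hzn htp hqt
  have hrK : ‖r‖ ≤ K := by
    refine hr.trans ?_
    have := hψ.norm_map_le_of_nonneg hψc ha
    simp only [K]
    gcongr
  have hXp' : 0 ≤ a.map ψ * p := by
    have h := star_left_conjugate_nonneg hX p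
    rwa [hp.isSelfAdjoint.star_eq, ← hXp, mul_assoc, hp.isIdempotentElem.eq] at h
  obtain ⟨d, hd, hdn, hdE⟩ := hD _ (hφ ι _ hXp')
  have hsθ : star (s.map (φ ∘ₗ ψ)) = s.map (φ ∘ₗ ψ) := by
    rw [← (hφ.comp hψ).map_conjTranspose, (IsSelfAdjoint.of_nonneg hs).star_eq]
  refine ⟨s.map (φ ∘ₗ ψ) * r * d, ?_⟩
  -- The three errors, each at most δ, come from the spectral truncation, from undoing the fourth
  -- power, and from replacing θ(b)² by θ(s)bθ(s).
  have key : a.map (φ ∘ₗ ψ) - star (s.map (φ ∘ₗ ψ) * r * d) * b * (s.map (φ ∘ₗ ψ) * r * d) =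
      (a.map ψ - a.map ψ * p).map φ +
      ((a.map ψ * p).map φ - d * ((a.map ψ * p).map φ * (a.map ψ * p).map φ *
        ((a.map ψ * p).map φ * (a.map ψ * p).map φ)) * d) +
      d * star r * (b.map (φ ∘ₗ ψ) * b.map (φ ∘ₗ ψ) -
        s.map (φ ∘ₗ ψ) * b * s.map (φ ∘ₗ ψ)) * (r * d) := by
    have e4 : (a.map ψ - a.map ψ * p).map φ = a.map (φ ∘ₗ ψ) - (a.map ψ * p).map φ :=
      map_sub (CStarMatrix.mapₗ φ) _ _
    have e5 : (b.map ψ).map φ = b.map (φ ∘ₗ ψ) := rfl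
    rw [e4, hE, e5]
    simp only [star_mul, hsθ, hd.star_eq, mul_sub, sub_mul, mul_assoc]
    abel
  rw [key]
  have n1 : ‖(a.map ψ - a.map ψ * p).map φ‖ ≤ δ :=
    (hφ.norm_map_le_of_nonneg hφc hXp0).trans hXpδ
  have n3 : ‖d * star r * (b.map (φ ∘ₗ ψ) * b.map (φ ∘ₗ ψ) -
      s.map (φ ∘ₗ ψ) * b * s.map (φ ∘ₗ ψ)) * (r * d)‖ ≤ δ := by
    refine le_trans ?_ h3
    calc _ ≤ D * K * η₂ * (K * D) := by
          refine (norm_mul_le _ _).trans ?_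
          gcongr
          · refine (norm_mul_le _ _).trans ?_
            gcongr
            · refine (norm_mul_le _ _).trans ?_
              rw [norm_star]
              gcongr
            · exact e3.trans (min_le_right _ _)
          · refine (norm_mul_le _ _).trans ?_
            gcongr
      _ = _ := by ring
  refine norm_add₃_le.trans ?_
  linarith

/-! ### Approximations by multiplicative order zero factorizations -/

/-- A pair of completely positive contractions `A → G → A` through a unital finite-dimensional
C*-algebra, the second of which satisfies the multiplicativity rule of order zero maps. -/
structure OrderZeroFactorization (A : Type u) [NonUnitalCStarAlgebra A] [PartialOrder A]
    [StarOrderedRing A] : Type (u + 1) where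
  /-- The finite-dimensional algebra. -/
  carrier : Type u
  [cstarAlgebra : CStarAlgebra carrier]
  [partialOrder : PartialOrder carrier]
  [starOrderedRing : StarOrderedRing carrier]
  [finiteDimensional : FiniteDimensional ℂ carrier]
  /-- The first map. -/
  down : A →ₗ[ℂ] carrier
  /-- The second map. -/
  up : carrier →ₗ[ℂ] A
  down_cp : IsCompletelyPositive down
  up_cp : IsCompletelyPositive up
  norm_down_le : ∀ x, ‖down x‖ ≤ ‖x‖
  norm_up_le : ∀ x, ‖up x‖ ≤ ‖x‖
  up_mul : ∀ x y, up x * up y = up 1 * up (x * y)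

namespace OrderZeroFactorization

attribute [instance] cstarAlgebra partialOrder starOrderedRing finiteDimensional

variable {A : Type u} [NonUnitalCStarAlgebra A] [PartialOrder A] [StarOrderedRing A]

/-- The composition of the two maps. -/
def toMap (f : OrderZeroFactorization A) : A →ₗ[ℂ] A := f.up ∘ₗ f.down

theorem toMap_cp (f : OrderZeroFactorization A) : IsCompletelyPositive f.toMap :=
  f.up_cp.comp f.down_cp

theorem norm_toMap_le (f : OrderZeroFactorization A) (x : A) : ‖f.toMap x‖ ≤ ‖x‖ :=
  (f.norm_up_le _).trans (f.norm_down_le x)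

end OrderZeroFactorization

/-- Multiplication by a central projection. -/
def mulCentralProjection {F : Type*} [NonUnitalCStarAlgebra F] (z : F) (hz : IsStarProjection z)
    (hc : ∀ x, z * x = x * z) : F →⋆ₙₐ[ℂ] F where
  toFun x := z * x
  map_smul' c x := mul_smul_comm c z x
  map_zero' := mul_zero z
  map_add' := mul_add z
  map_mul' x y := by
    rw [mul_assoc z x, ← mul_assoc x z, ← hc, mul_assoc z x, ← mul_assoc z z,
      hz.isIdempotentElem.eq]
  map_star' x := by rw [star_mul, hz.isSelfAdjoint.star_eq, hc]

/-- Only the first map is compressed, by the central projection z, so the second keeps its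
multiplicativity rule. The part removed is φ((1 − z)ψ(·)): it is completely positive, hence harmless
for domination arguments, and small. The last clause is the lower bound on zF, applied to ψ(x)ψ(yw)
− ψ(xy)ψ(w). -/
theorem exists_factorization_of_orderZero_mul {A F : Type u} [NonUnitalCStarAlgebra A]
    [PartialOrder A] [StarOrderedRing A] [CStarAlgebra F] [PartialOrder F] [StarOrderedRing F]
    [FiniteDimensional ℂ F] {ψ : A →ₗ[ℂ] F} {φ : F →ₗ[ℂ] A} (hψ : IsCompletelyPositive ψ)
    (hφ : IsCompletelyPositive φ) (hψc : ∀ x, ‖ψ x‖ ≤ ‖x‖) (hφc : ∀ x, ‖φ x‖ ≤ ‖x‖)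
    (hmul : ∀ x y, φ x * φ y = φ 1 * φ (x * y)) {s : ℝ} (hs : 0 < s) :
    ∃ f : OrderZeroFactorization A, IsCompletelyPositive (φ ∘ₗ ψ - f.toMap) ∧
      (∀ x, ‖φ (ψ x) - f.toMap x‖ ^ 2 ≤ s * ‖x‖ ^ 2) ∧
      ∀ x y w, ‖f.down x * f.down (y * w) - f.down (x * y) * f.down w‖ ^ 2 * s ^ 3 ≤
        2 * (‖x‖ * ‖y‖ * ‖w‖) * ‖φ (ψ x) * φ (ψ (y * w)) - φ (ψ (x * y)) * φ (ψ w)‖ := by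
  obtain ⟨z, hz, hzc, h1, h2⟩ := exists_central_cut hφ hφc hmul hs
  have hz' := hz.one_sub
  have hzc' : ∀ x, (1 - z) * x = x * (1 - z) := fun x => by
    rw [sub_mul, mul_sub, hzc, one_mul, mul_one]
  let m := mulCentralProjection z hz hzc
  let m' := mulCentralProjection (1 - z) hz' hzc'
  let f : OrderZeroFactorization A :=
    { carrier := F
      down := (m : F →ₗ[ℂ] F) ∘ₗ ψ
      up := φ
      down_cp := (IsCompletelyPositive.of_nonUnitalStarAlgHom m).comp hψ
      up_cp := hφ
      norm_down_le := fun x => (NonUnitalStarAlgHom.norm_apply_le m _).trans (hψc x)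
      norm_up_le := hφc
      up_mul := hmul }
  have hdiff : φ ∘ₗ ψ - f.toMap = φ ∘ₗ (m' : F →ₗ[ℂ] F) ∘ₗ ψ := by
    ext x
    change φ (ψ x) - φ (z * ψ x) = φ ((1 - z) * ψ x)
    rw [← map_sub, sub_mul, one_mul]
  refine ⟨f, ?_, fun x => ?_, fun x y w => ?_⟩
  · rw [hdiff]
    exact hφ.comp ((IsCompletelyPositive.of_nonUnitalStarAlgHom m').comp hψ)
  · have e : φ (ψ x) - f.toMap x = φ ((1 - z) * ψ x) := LinearMap.congr_fun hdiff x
    rw [e]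
    refine (h1 _).trans ?_
    gcongr
    exact hψc x
  · have e : f.down x * f.down (y * w) - f.down (x * y) * f.down w =
        z * (ψ x * ψ (y * w) - ψ (x * y) * ψ w) := by
      have hm : ∀ u v, m u * m v = m (u * v) := fun u v => (map_mul m u v).symm
      change m (ψ x) * m (ψ (y * w)) - m (ψ (x * y)) * m (ψ w) = m _
      rw [hm, hm, ← map_sub]
    rw [e]
    refine (h2 _).trans ?_
    rw [map_sub, mul_sub, ← hmul, ← hmul]
    gcongr
    refine (norm_sub_le _ _).trans ?_
    have n1 : ‖ψ x * ψ (y * w)‖ ≤ ‖x‖ * (‖y‖ * ‖w‖) := by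
      refine (norm_mul_le _ _).trans ?_
      gcongr
      · exact hψc x
      · exact (hψc _).trans (norm_mul_le _ _)
    have n2 : ‖ψ (x * y) * ψ w‖ ≤ ‖x‖ * ‖y‖ * ‖w‖ := by
      refine (norm_mul_le _ _).trans ?_
      gcongr
      · exact (hψc _).trans (norm_mul_le _ _)
      · exact hψc w
    linarith

theorem exists_factorization_of_orderZero {A F : Type u} [NonUnitalCStarAlgebra A]
    [PartialOrder A] [StarOrderedRing A] [inst : NonUnitalCStarAlgebra F] [PartialOrder F]
    [StarOrderedRing F] [FiniteDimensional ℂ F] {ψ : A →ₗ[ℂ] F} {φ : F →ₗ[ℂ] A}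
    (hψ : IsCompletelyPositive ψ) (hφ : IsCompletelyPositive φ) (hψc : ∀ x, ‖ψ x‖ ≤ ‖x‖)
    (hφc : ∀ x, ‖φ x‖ ≤ ‖x‖) (h0 : ∀ a b, 0 ≤ a → 0 ≤ b → a * b = 0 → φ a * φ b = 0)
    {s : ℝ} (hs : 0 < s) :
    ∃ f : OrderZeroFactorization A, IsCompletelyPositive (φ ∘ₗ ψ - f.toMap) ∧
      (∀ x, ‖φ (ψ x) - f.toMap x‖ ^ 2 ≤ s * ‖x‖ ^ 2) ∧
      ∀ x y w, ‖f.down x * f.down (y * w) - f.down (x * y) * f.down w‖ ^ 2 * s ^ 3 ≤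
        2 * (‖x‖ * ‖y‖ * ‖w‖) * ‖φ (ψ x) * φ (ψ (y * w)) - φ (ψ (x * y)) * φ (ψ w)‖ := by
  obtain ⟨c, rfl⟩ := exists_cstarAlgebra_of_finiteDimensional F
  exact exists_factorization_of_orderZero_mul hψ hφ hψc hφc (orderZero_mul hφ h0) hs

/-! ### Asymptotic identities for amplifications to matrices -/

section Net

variable {A : Type u} [NonUnitalCStarAlgebra A] [PartialOrder A] [StarOrderedRing A]
  {Λ : Type*} {l : Filter Λ}

theorem CStarMatrix.tendsto_norm_of_entries {ι : Type} [Fintype ι] {G : Λ → Type*}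
    [∀ j, NonUnitalCStarAlgebra (G j)] [∀ j, PartialOrder (G j)] [∀ j, StarOrderedRing (G j)]
    (M : ∀ j, CStarMatrix ι ι (G j)) (h : ∀ a b, Tendsto (fun j => ‖M j a b‖) l (𝓝 0)) :
    Tendsto (fun j => ‖M j‖) l (𝓝 0) := by
  refine squeeze_zero (fun _ => norm_nonneg _)
    (fun j => CStarMatrix.norm_le_sum_norm_entry (M j)) ?_
  simpa using tendsto_finsetSum Finset.univ fun b _ =>
    tendsto_finsetSum Finset.univ fun a _ => h a b

/-- Asymptotic associativity passes to matrices. -/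
theorem tendsto_norm_map_mul_map {G : Λ → Type*}
    [∀ j, NonUnitalCStarAlgebra (G j)] [∀ j, PartialOrder (G j)] [∀ j, StarOrderedRing (G j)]
    {ψ : ∀ j, A →ₗ[ℂ] G j}
    (h : ∀ x y w, Tendsto (fun j => ‖ψ j x * ψ j (y * w) - ψ j (x * y) * ψ j w‖) l (𝓝 0))
    {ι : Type} [Fintype ι] (X Y Z : CStarMatrix ι ι A) :
    Tendsto (fun j => ‖X.map (ψ j) * (Y * Z).map (ψ j) - (X * Y).map (ψ j) * Z.map (ψ j)‖) l
      (𝓝 0) := by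
  refine CStarMatrix.tendsto_norm_of_entries _ fun a b => ?_
  have e : ∀ j, (X.map (ψ j) * (Y * Z).map (ψ j) - (X * Y).map (ψ j) * Z.map (ψ j)) a b =
      ∑ c, ∑ d, (ψ j (X a c) * ψ j (Y c d * Z d b) - ψ j (X a c * Y c d) * ψ j (Z d b)) := by
    intro j
    have e1 : (X.map (ψ j) * (Y * Z).map (ψ j)) a b =
        ∑ c, ∑ d, ψ j (X a c) * ψ j (Y c d * Z d b) := by
      simp only [CStarMatrix.mul_apply, CStarMatrix.map_apply, map_sum, Finset.mul_sum]
    have e2 : ((X * Y).map (ψ j) * Z.map (ψ j)) a b =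
        ∑ c, ∑ d, ψ j (X a c * Y c d) * ψ j (Z d b) := by
      simp only [CStarMatrix.mul_apply, CStarMatrix.map_apply, map_sum, Finset.sum_mul]
      exact Finset.sum_comm
    rw [CStarMatrix.sub_apply, e1, e2]
    simp only [Finset.sum_sub_distrib]
  refine squeeze_zero (fun _ => norm_nonneg _) (fun j => (congrArg norm (e j)).le.trans
    ((norm_sum_le _ _).trans (Finset.sum_le_sum fun c _ => norm_sum_le _ _))) ?_
  simpa using tendsto_finsetSum Finset.univ fun c _ =>
    tendsto_finsetSum Finset.univ fun d _ => h (X a c) (Y c d) (Z d b)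

theorem tendsto_norm_map_mul_sub_map_mul {θ : Λ → A →ₗ[ℂ] A}
    (h : ∀ w y, Tendsto (fun j => θ j (w * y) - θ j w * y) l (𝓝 0)) {ι : Type} [Fintype ι]
    (X Y : CStarMatrix ι ι A) :
    Tendsto (fun j => ‖(X * Y).map (θ j) - X.map (θ j) * Y‖) l (𝓝 0) := by
  refine CStarMatrix.tendsto_norm_of_entries _ fun a b => ?_
  have e : ∀ j, ((X * Y).map (θ j) - X.map (θ j) * Y) a b =
      ∑ c, (θ j (X a c * Y c b) - θ j (X a c) * Y c b) := by
    intro j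
    rw [CStarMatrix.sub_apply]
    simp only [CStarMatrix.mul_apply, CStarMatrix.map_apply, map_sum, Finset.sum_sub_distrib]
  refine squeeze_zero (fun _ => norm_nonneg _) (fun j => (congrArg norm (e j)).le.trans
    (norm_sum_le _ _)) ?_
  simpa using tendsto_finsetSum Finset.univ fun c _ => (h (X a c) (Y c b)).norm

theorem tendsto_norm_map_mul_sub_mul_map {θ : Λ → A →ₗ[ℂ] A}
    (h : ∀ w y, Tendsto (fun j => θ j (w * y) - w * θ j y) l (𝓝 0)) {ι : Type} [Fintype ι]
    (X Y : CStarMatrix ι ι A) :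
    Tendsto (fun j => ‖(X * Y).map (θ j) - X * Y.map (θ j)‖) l (𝓝 0) := by
  refine CStarMatrix.tendsto_norm_of_entries _ fun a b => ?_
  have e : ∀ j, ((X * Y).map (θ j) - X * Y.map (θ j)) a b =
      ∑ c, (θ j (X a c * Y c b) - X a c * θ j (Y c b)) := by
    intro j
    rw [CStarMatrix.sub_apply]
    simp only [CStarMatrix.mul_apply, CStarMatrix.map_apply, map_sum, Finset.sum_sub_distrib]
  refine squeeze_zero (fun _ => norm_nonneg _) (fun j => (congrArg norm (e j)).le.trans
    (norm_sum_le _ _)) ?_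
  simpa using tendsto_finsetSum Finset.univ fun c _ => (h (X a c) (Y c b)).norm

/-- By the two module properties θ(s²)θ(s²) ≈ θ(s)s·sθ(s). This brings s² itself, which will be b,
into the middle. -/
theorem tendsto_norm_map_sq_sub_conj {θ : Λ → A →ₗ[ℂ] A} (hθ : ∀ j, IsCompletelyPositive (θ j))
    (hb : ∀ j x, ‖θ j x‖ ≤ ‖x‖)
    (h1 : ∀ w y, Tendsto (fun j => θ j (w * y) - θ j w * y) l (𝓝 0))
    (h2 : ∀ w y, Tendsto (fun j => θ j (w * y) - w * θ j y) l (𝓝 0)) {ι : Type} [Fintype ι]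
    (s : CStarMatrix ι ι A) :
    Tendsto (fun j => ‖(s * s).map (θ j) * (s * s).map (θ j) -
      s.map (θ j) * (s * s) * s.map (θ j)‖) l (𝓝 0) := by
  have t1 := (tendsto_norm_map_mul_sub_map_mul h1 s s).mul_const (4 * ‖s * s‖)
  have t2 := (tendsto_norm_map_mul_sub_mul_map h2 s s).const_mul (4 * ‖s‖ * ‖s‖)
  refine squeeze_zero (fun _ => norm_nonneg _) (fun j => ?_) (by simpa using t1.add t2)
  have e : (s * s).map (θ j) * (s * s).map (θ j) - s.map (θ j) * (s * s) * s.map (θ j) =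
      ((s * s).map (θ j) - s.map (θ j) * s) * (s * s).map (θ j) +
        s.map (θ j) * s * ((s * s).map (θ j) - s * s.map (θ j)) := by
    simp only [sub_mul, mul_sub, mul_assoc]
    abel
  rw [e]
  refine (norm_add_le _ _).trans ?_
  gcongr
  · refine (norm_mul_le _ _).trans ?_
    gcongr
    exact (hθ j).norm_map_le (hb j) _
  · refine (norm_mul_le _ _).trans ?_
    gcongr
    refine (norm_mul_le _ _).trans ?_
    gcongr
    exact (hθ j).norm_map_le (hb j) _

end Net

/-! ### Comparison in matrix algebras -/

theorem exists_mul_self_eq_of_nonneg {C : Type*} [NonUnitalCStarAlgebra C] [PartialOrder C]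
    [StarOrderedRing C] {b : C} (hb : 0 ≤ b) : ∃ s, 0 ≤ s ∧ s * s = b :=
  ⟨CFC.sqrt b, CFC.sqrt_nonneg b, CFC.sqrt_mul_sqrt_self b hb⟩

section Core

variable {A : Type u} [NonUnitalCStarAlgebra A] [PartialOrder A] [StarOrderedRing A]

/-- The case of one colour, with R standing for the sum of the other colours. -/
theorem eventually_exists_conj_approx {Λ : Type*} {l : Filter Λ}
    {F : Λ → FinDimCStarAlgebra.{u}} {ψ : ∀ j, A →ₗ[ℂ] F j} {φ : ∀ j, F j →ₗ[ℂ] A}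
    {R : Λ → A →ₗ[ℂ] A} (hψ : ∀ j, IsCompletelyPositive (ψ j))
    (hφ : ∀ j, IsCompletelyPositive (φ j)) (hψc : ∀ j x, ‖ψ j x‖ ≤ ‖x‖)
    (hφc : ∀ j x, ‖φ j x‖ ≤ ‖x‖)
    (h0 : ∀ j a b, 0 ≤ a → 0 ≤ b → a * b = 0 → φ j a * φ j b = 0)
    (hR : ∀ j, IsCompletelyPositive (R j))
    (hid : ∀ x, Tendsto (fun j => φ j (ψ j x) + R j x) l (𝓝 x))
    {ι κ : Type} [Fintype ι] [DecidableEq ι] [Fintype κ] [DecidableEq κ] [Nonempty κ]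
    {a b : CStarMatrix ι ι A} {v : CStarMatrix (κ × ι) (κ × ι) A} {δ : ℝ} (hδ : 0 < δ)
    (ha : 0 ≤ a) (hb : 0 ≤ b)
    (hv : ‖diagCopies κ a - star v * diagCopies κ b * v‖ ≤ δ / 16) :
    ∀ᶠ j in l, ∃ x : CStarMatrix ι ι A, ‖a.map (φ j ∘ₗ ψ j) - star x * b * x‖ ≤ 4 * δ := by
  -- Cutting at level σ² changes each entry by at most σ times its norm, hence the matrix of a by at
  -- most δ; this is the fourth δ. The level stays fixed along the net, so dividing by (σ²)³
  -- preserves convergence to 0.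
  obtain ⟨σ, hσ, hσa⟩ := exists_pos_mul_le (∑ c, ∑ d, ‖a d c‖) hδ
  have hs : 0 < σ ^ 2 := by positivity
  choose f hf1 hf2 hf3 using fun j =>
    exists_factorization_of_orderZero (hψ j) (hφ j) (hψc j) (hφc j) (h0 j) hs
  obtain ⟨s, hs0, rfl⟩ := exists_mul_self_eq_of_nonneg hb
  obtain ⟨η, hη, H⟩ := exists_conj_approx_of_diagCopies.{u} hδ ha hb hs0 hv
  have hθ : ∀ j, IsCompletelyPositive (φ j ∘ₗ ψ j) := fun j => (hφ j).comp (hψ j)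
  have hθb : ∀ j x, ‖(φ j ∘ₗ ψ j) x‖ ≤ ‖x‖ := fun j x => (hφc j _).trans (hψc j x)
  -- Asymptotic associativity of the cut-down maps: it holds for θ after applying φ, by the bimodule
  -- property, and is pulled back through the lower bound for φ.
  have hassoc : ∀ x y w, Tendsto
      (fun j => ‖(f j).down x * (f j).down (y * w) - (f j).down (x * y) * (f j).down w‖) l
      (𝓝 0) := by
    intro x y w
    have t1 := tendsto_map_mul_sub_map_mul hθ hR hθb hid x y
    have t2 := tendsto_map_mul_sub_mul_map hθ hR hθb hid y w
    have t3 : Tendsto (fun j => ‖φ j (ψ j x) * φ j (ψ j (y * w)) -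
        φ j (ψ j (x * y)) * φ j (ψ j w)‖) l (𝓝 0) := by
      have t4 := (t2.norm.const_mul ‖x‖).add (t1.norm.mul_const ‖w‖)
      rw [norm_zero, mul_zero, zero_mul, add_zero] at t4
      refine squeeze_zero (fun _ => norm_nonneg _) (fun j => ?_) t4
      have e : φ j (ψ j x) * φ j (ψ j (y * w)) - φ j (ψ j (x * y)) * φ j (ψ j w) =
          φ j (ψ j x) * (φ j (ψ j (y * w)) - y * φ j (ψ j w)) -
          (φ j (ψ j (x * y)) - φ j (ψ j x) * y) * φ j (ψ j w) := by
        simp only [mul_sub, sub_mul, mul_assoc]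
        abel
      rw [e]
      refine (norm_sub_le _ _).trans ?_
      gcongr
      · refine (norm_mul_le _ _).trans ?_
        gcongr
        · exact hθb j x
        · exact le_rfl
      · refine (norm_mul_le _ _).trans ?_
        gcongr
        · exact le_rfl
        · exact hθb j w
    have t5 : Tendsto (fun j => ‖(f j).down x * (f j).down (y * w) -
        (f j).down (x * y) * (f j).down w‖ ^ 2) l (𝓝 0) := by
      have t6 := (t3.const_mul (2 * (‖x‖ * ‖y‖ * ‖w‖))).div_const ((σ ^ 2) ^ 3)
      rw [mul_zero, zero_div] at t6
      refine squeeze_zero (fun _ => by positivity) (fun j => ?_) t6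
      rw [le_div_iff₀ (by positivity)]
      exact hf3 j x y w
    have t7 := (Real.continuous_sqrt.tendsto 0).comp t5
    rw [Real.sqrt_zero] at t7
    exact t7.congr fun j => Real.sqrt_sq (norm_nonneg _)
  -- The remainder absorbs the discarded part, so the cut-down compositions are again dominated by
  -- maps tending to the identity and are asymptotic bimodule maps too.
  have hR' : ∀ j, IsCompletelyPositive (R j + (φ j ∘ₗ ψ j - (f j).toMap)) :=
    fun j => (hR j).add (hf1 j)
  have hid' : ∀ x, Tendsto (fun j => (f j).toMap x +
      (R j + (φ j ∘ₗ ψ j - (f j).toMap)) x) l (𝓝 x) := fun x => (hid x).congr fun j => by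
    simp only [LinearMap.add_apply, LinearMap.sub_apply, LinearMap.comp_apply]
    abel
  have hcp := fun j => (f j).toMap_cp
  have hcb := fun j => (f j).norm_toMap_le
  have e3 := tendsto_norm_map_sq_sub_conj hcp hcb
    (tendsto_map_mul_sub_map_mul hcp hR' hcb hid')
    (tendsto_map_mul_sub_mul_map hcp hR' hcb hid') s
  have e1 := tendsto_norm_map_mul_map hassoc (diagCopies κ a) (star v) (diagCopies κ (s * s) * v)
  have e2 := tendsto_norm_map_mul_map hassoc (diagCopies κ (s * s)) v (diagCopies κ a)
  filter_upwards [e1.eventually_le_const hη, e2.eventually_le_const hη,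
    e3.eventually_le_const hη] with j h1 h2 h3
  obtain ⟨x, hx⟩ := H (f j).carrier (f j).down (f j).up (f j).down_cp (f j).up_cp
    (f j).norm_down_le (f j).norm_up_le (f j).up_mul h1 (by rwa [norm_sub_rev]) h3
  refine ⟨x, ?_⟩
  have hcut : ‖a.map (φ j ∘ₗ ψ j) - a.map (f j).toMap‖ ≤ δ := by
    refine (CStarMatrix.norm_le_sum_norm_entry _).trans (le_trans ?_ hσa)
    simp only [Finset.sum_mul]
    refine Finset.sum_le_sum fun c _ => Finset.sum_le_sum fun d _ => ?_
    have := hf2 j (a d c)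
    rw [← mul_pow, mul_comm σ] at this
    exact le_of_sq_le_sq this (by positivity)
  have e : a.map (φ j ∘ₗ ψ j) - star x * (s * s) * x =
      (a.map (φ j ∘ₗ ψ j) - a.map (f j).toMap) +
        (a.map (f j).toMap - star x * (s * s) * x) := by abel
  rw [e]
  refine (norm_add_le _ _).trans ?_
  have : ‖a.map (f j).toMap - star x * (s * s) * x‖ ≤ 3 * δ := hx
  linarith

/-- Comparison in a matrix algebra over a C*-algebra of nuclear dimension at most `n`, with
constants that do not depend on the size of the matrices. -/
theorem exists_sum_conj_approx {n : ℕ} (hA : HasDecomposableApproximations A n) {δ : ℝ}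
    (hδ : 0 < δ) {ι : Type} [Fintype ι] [DecidableEq ι] {a : CStarMatrix ι ι A}
    {b : Fin (n + 1) → CStarMatrix ι ι A} (ha : 0 ≤ a) (hb : ∀ i, 0 ≤ b i)
    {k : Fin (n + 1) → ℕ} (hk : ∀ i, 0 < k i)
    (v : ∀ i, CStarMatrix (Fin (k i) × ι) (Fin (k i) × ι) A)
    (hv : ∀ i, ‖diagCopies (Fin (k i)) a - star (v i) * diagCopies (Fin (k i)) (b i) * v i‖ ≤
      δ / 16) :
    ∃ x : Fin (n + 1) → CStarMatrix ι ι A,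
      ‖a - ∑ i, star (x i) * b i * x i‖ ≤ (4 * (n + 1) + 1) * δ := by
  obtain ⟨Λ, _, _, _, F, ψ, φ, hψc, hφc, h0, hid⟩ := hA
  let ψ' := fun i l => (ψ i l).toLinearMap
  let φ' := fun i l => (φ i l).toLinearMap
  have hψ : ∀ i l, IsCompletelyPositive (ψ' i l) :=
    fun i l => IsCompletelyPositive.of_completelyPositiveMap _
  have hφ : ∀ i l, IsCompletelyPositive (φ' i l) :=
    fun i l => IsCompletelyPositive.of_completelyPositiveMap _
  have hcolor : ∀ i, ∀ᶠ l in atTop, ∃ x : CStarMatrix ι ι A,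
      ‖a.map (φ' i l ∘ₗ ψ' i l) - star x * b i * x‖ ≤ 4 * δ := by
    intro i
    have : Nonempty (Fin (k i)) := ⟨⟨0, hk i⟩⟩
    refine eventually_exists_conj_approx (hψ i) (hφ i) (hψc i) (hφc i) (h0 i)
      -- The other colours together complete colour i to the identity in the limit.
      (R := fun l => ∑ i' ∈ Finset.univ.erase i, φ' i' l ∘ₗ ψ' i' l)
      (fun l => IsCompletelyPositive.sum _ fun i' _ => (hφ i' l).comp (hψ i' l))
      (fun x => (hid x).congr fun l => ?_) hδ ha (hb i) (hv i)
    rw [LinearMap.sum_apply]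
    exact (Finset.add_sum_erase Finset.univ (fun i' => φ i' l (ψ i' l x))
      (Finset.mem_univ i)).symm
  have hsum : Tendsto (fun l => ∑ i, a.map (φ' i l ∘ₗ ψ' i l)) atTop (𝓝 a) := by
    rw [CuntzLE.tendsto_iff]
    intro c d
    refine (hid (a c d)).congr fun l => ?_
    have : ∀ (t : Finset (Fin (n + 1))), (∑ i ∈ t, a.map (φ' i l ∘ₗ ψ' i l)) c d =
        ∑ i ∈ t, φ i l (ψ i l (a c d)) := by
      intro t
      induction t using Finset.cons_induction with
      | empty => rfl
      | cons i t hi ih =>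
        rw [Finset.sum_cons, Finset.sum_cons, CStarMatrix.add_apply, ih]
        rfl
    exact (this _).symm
  have hclose : ∀ᶠ l in atTop, ‖a - ∑ i, a.map (φ' i l ∘ₗ ψ' i l)‖ ≤ δ := by
    have := (tendsto_iff_norm_sub_tendsto_zero.1 hsum).eventually_le_const hδ
    filter_upwards [this] with l hl
    rwa [norm_sub_rev]
  obtain ⟨l, hl, hl'⟩ := (hclose.and (eventually_all.2 hcolor)).exists
  choose x hx using hl'
  refine ⟨x, ?_⟩
  have e : a - ∑ i, star (x i) * b i * x i = (a - ∑ i, a.map (φ' i l ∘ₗ ψ' i l)) +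
      ∑ i, (a.map (φ' i l ∘ₗ ψ' i l) - star (x i) * b i * x i) := by
    rw [Finset.sum_sub_distrib]
    abel
  rw [e]
  refine (norm_add_le _ _).trans ?_
  have : ‖∑ i, (a.map (φ' i l ∘ₗ ψ' i l) - star (x i) * b i * x i)‖ ≤
      ∑ _i : Fin (n + 1), 4 * δ := (norm_sum_le _ _).trans (Finset.sum_le_sum fun i _ => hx i)
  have hcard : ∑ _i : Fin (n + 1), 4 * δ = (n + 1) * (4 * δ) := by simp
  rw [hcard] at this
  linarith

end Core

/-! ### Matrix algebras in the stabilization -/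

section Stable

variable {A : Type u} [NonUnitalCStarAlgebra A] [PartialOrder A] [StarOrderedRing A]

open FinSuppMatrix

/-- The inclusion of `M_N(A)` in `A ⊗ 𝒦` as a corner. -/
def cornerHom (A : Type u) [NonUnitalCStarAlgebra A] [PartialOrder A] [StarOrderedRing A]
    (N : ℕ) : CStarMatrix (Fin N) (Fin N) A →⋆ₙₐ[ℂ] Stabilization A where
  toFun X := Stabilization.of (ofCorner X)
  map_smul' c X := by
    rw [← map_smul]
    congr 1
    refine ext_corner (ofCorner_suppLE _) ((ofCorner_suppLE _).smul c) ?_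
    rw [corner_ofCorner, corner_smul, corner_ofCorner]
    rfl
  map_zero' := by
    rw [← map_zero Stabilization.of]
    congr 1
    exact ext_corner (ofCorner_suppLE _) (fun _ _ _ => rfl)
      (by rw [corner_ofCorner, corner_zero])
  map_add' X Y := by
    rw [← map_add]
    congr 1
    refine ext_corner (ofCorner_suppLE _) ((ofCorner_suppLE _).add (ofCorner_suppLE _)) ?_
    rw [corner_ofCorner, corner_add, corner_ofCorner, corner_ofCorner]
  map_mul' X Y := by
    rw [← Stabilization.of_mul]
    congr 1
    refine ext_corner (ofCorner_suppLE _) ((ofCorner_suppLE _).mul (ofCorner_suppLE _)) ?_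
    rw [corner_ofCorner, corner_mul (ofCorner_suppLE _), corner_ofCorner, corner_ofCorner]
  map_star' X := by
    rw [← Stabilization.of_star]
    congr 1
    refine ext_corner (ofCorner_suppLE _) (ofCorner_suppLE _).star ?_
    rw [corner_ofCorner, corner_star, corner_ofCorner]

theorem cornerHom_corner {N : ℕ} {x : FinSuppMatrix A} (hx : x.SuppLE N) :
    cornerHom A N (corner N x) = Stabilization.of x := by
  change Stabilization.of (ofCorner (corner N x)) = _
  rw [ofCorner_corner hx]

theorem cornerHom_injective (N : ℕ) : Function.Injective (cornerHom A N) := by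
  intro X Y h
  have h1 : ofCorner X = ofCorner Y := Stabilization.of.injective h
  rw [← corner_ofCorner X, ← corner_ofCorner Y, h1]

theorem NonUnitalStarAlgHom.isClosed_range_of_injective {C D : Type*} [NonUnitalCStarAlgebra C]
    [NonUnitalCStarAlgebra D] (f : C →⋆ₙₐ[ℂ] D) (hf : Function.Injective f) :
    IsClosed (Set.range f) := by
  have h : Isometry f := AddMonoidHomClass.isometry_of_norm f
    fun x => NonUnitalStarAlgHom.norm_map f hf x
  exact h.isClosedEmbedding.isClosed_range

/-- For the negative part c of x one has cxc = −c³, so f(c³) is both positive and negative, and c³ =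
0. -/
theorem NonUnitalStarAlgHom.nonneg_of_map_nonneg {C D : Type*} [NonUnitalCStarAlgebra C]
    [PartialOrder C] [StarOrderedRing C] [NonUnitalCStarAlgebra D] [PartialOrder D]
    [StarOrderedRing D] {f : C →⋆ₙₐ[ℂ] D} (hf : Function.Injective f) {x : C} (hx : 0 ≤ f x) :
    0 ≤ x := by
  have hxs : IsSelfAdjoint x := hf (by
    rw [StarHomClass.map_star, (IsSelfAdjoint.of_nonneg hx).star_eq])
  obtain ⟨c, hc⟩ : ∃ c, c = x⁻ := ⟨_, rfl⟩
  have hc0 : 0 ≤ c := hc ▸ CFC.negPart_nonneg x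
  have hcs : IsSelfAdjoint c := .of_nonneg hc0
  have hxc : x * c = -(c * c) := by
    conv_lhs => rw [← CFC.posPart_sub_negPart x hxs, ← hc]
    rw [sub_mul, hc, CFC.posPart_mul_negPart, zero_sub]
  have h1 : 0 ≤ f (c * (x * c)) := by
    have := star_left_conjugate_nonneg hx (f c)
    rwa [← StarHomClass.map_star, hcs.star_eq, mul_assoc, ← map_mul, ← map_mul] at this
  have h2 : 0 ≤ f (c * c * c) := by
    have := star_left_conjugate_nonneg hc0 c
    rw [hcs.star_eq] at this
    exact map_nonneg f this
  have h3 : c * c * c = 0 := by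
    refine hf ?_
    rw [map_zero]
    refine le_antisymm ?_ h2
    rw [hxc, mul_neg, map_neg, ← mul_assoc] at h1
    exact neg_nonneg.1 h1
  have h4 : c * c = 0 := by
    rw [← CStarRing.star_mul_self_eq_zero_iff, star_mul, hcs.star_eq, ← mul_assoc, h3, zero_mul]
  have h5 : c = 0 := by
    rw [← CStarRing.star_mul_self_eq_zero_iff, hcs.star_eq, h4]
  rw [← CFC.posPart_sub_negPart x hxs, ← hc, h5, sub_zero]
  exact CFC.posPart_nonneg x

theorem isClosed_range_cornerHom (N : ℕ) : IsClosed (Set.range (cornerHom A N)) :=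
  NonUnitalStarAlgHom.isClosed_range_of_injective _ (cornerHom_injective N)

/-- The corners of `A ⊗ 𝒦` are hereditary. -/
theorem cornerHom_mul_mul_mem_range {N : ℕ} (X Y : CStarMatrix (Fin N) (Fin N) A)
    (b : Stabilization A) : cornerHom A N X * b * cornerHom A N Y ∈ Set.range (cornerHom A N) := by
  induction b using Stabilization.denseRange_of.induction_on with
  | hp =>
    exact (isClosed_range_cornerHom N).preimage
      ((continuous_const.mul continuous_id).mul continuous_const)
  | ih y =>
    have hX : (ofCorner X).SuppLE N := ofCorner_suppLE X
    have hY : (ofCorner Y).SuppLE N := ofCorner_suppLE Y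
    have h : (ofCorner X * y * ofCorner Y).SuppLE N := by
      intro i j hij
      obtain ⟨K, hK⟩ := (ofCorner X * y).exists_suppLE
      rw [entry_mul hK]
      refine Finset.sum_eq_zero fun c _ => ?_
      rcases hij with hi | hj
      · rw [entry_mul hX, Finset.sum_eq_zero, zero_mul]
        intro d _
        rw [hX i d (Or.inl hi), zero_mul]
      · rw [hY c j (Or.inr hj), mul_zero]
    refine ⟨corner N (ofCorner X * y * ofCorner Y), ?_⟩
    rw [cornerHom_corner h, Stabilization.of_mul, Stabilization.of_mul]
    rfl

/-- Nearly closest points are chosen in each corner, with slack 1/(N + 1). The corners increase to a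
dense subset, so the distances tend to 0; this gives a full sequence in N, which lets several
elements be approximated at the same N. -/
theorem exists_tendsto_cornerHom (b : Stabilization A) :
    ∃ X : ∀ N, CStarMatrix (Fin N) (Fin N) A,
      Tendsto (fun N => cornerHom A N (X N)) atTop (𝓝 b) := by
  have h : ∀ N : ℕ, ∃ X : CStarMatrix (Fin N) (Fin N) A, dist b (cornerHom A N X) <
      Metric.infDist b (Set.range (cornerHom A N)) + 1 / ((N : ℝ) + 1) := by
    intro N
    obtain ⟨_, ⟨X, rfl⟩, hX⟩ := (Metric.infDist_lt_iff (Set.range_nonempty (cornerHom A N))).1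
      (lt_add_of_pos_right (Metric.infDist b (Set.range (cornerHom A N)))
        (Nat.one_div_pos_of_nat (n := N)))
    exact ⟨X, hX⟩
  choose X hX using h
  refine ⟨X, Metric.tendsto_atTop.2 fun ε hε => ?_⟩
  obtain ⟨x, hx⟩ := Stabilization.denseRange_of.exists_dist_lt b (half_pos hε)
  obtain ⟨N, hN⟩ := x.exists_suppLE
  obtain ⟨M, hM⟩ := exists_nat_one_div_lt (half_pos hε)
  refine ⟨max N M, fun K hK => ?_⟩
  rw [dist_comm]
  refine (hX K).trans_le ?_
  have h1 : Metric.infDist b (Set.range (cornerHom A K)) ≤ dist b (Stabilization.of x) :=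
    Metric.infDist_le_dist_of_mem ⟨_, cornerHom_corner (hN.mono ((le_max_left _ _).trans hK))⟩
  have h2 : 1 / ((K : ℝ) + 1) ≤ 1 / ((M : ℝ) + 1) := by
    gcongr
    exact (le_max_right _ _).trans hK
  linarith

/-- The block of a matrix at position `(s, t)`. -/
def blockAt {τ ρ : Type} {N : ℕ} (e : τ × Fin N ≃ ρ) (X : CStarMatrix ρ ρ A) (s t : τ) :
    CStarMatrix (Fin N) (Fin N) A :=
  CStarMatrix.ofMatrix fun p q => X (e (s, p)) (e (t, q))

theorem blockAt_mul {τ ρ : Type} [Fintype τ] [Fintype ρ] {N : ℕ} (e : τ × Fin N ≃ ρ)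
    (X Y : CStarMatrix ρ ρ A) (s t : τ) :
    blockAt e (X * Y) s t = ∑ c, blockAt e X s c * blockAt e Y c t := by
  ext p q
  have h : ∀ T : Finset τ, (∑ c ∈ T, blockAt e X s c * blockAt e Y c t) p q =
      ∑ c ∈ T, ∑ d, X (e (s, p)) (e (c, d)) * Y (e (c, d)) (e (t, q)) := by
    intro T
    induction T using Finset.cons_induction with
    | empty => rfl
    | cons c T hc ih =>
      rw [Finset.sum_cons, Finset.sum_cons, CStarMatrix.add_apply, ih, CStarMatrix.mul_apply]
      rfl
  rw [h, ← Fintype.sum_prod_type fun c : τ × Fin N => X (e (s, p)) (e c) * Y (e c) (e (t, q)),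
    e.sum_comp fun c => X (e (s, p)) c * Y c (e (t, q))]
  exact CStarMatrix.mul_apply

/-- The inclusion of the matrices of `N × N` blocks over `A` in the matrices over `A ⊗ 𝒦`. -/
def blockHom (A : Type u) [NonUnitalCStarAlgebra A] [PartialOrder A] [StarOrderedRing A]
    {τ ρ : Type} [Fintype τ] [Fintype ρ] {N : ℕ} (e : τ × Fin N ≃ ρ) :
    CStarMatrix ρ ρ A →⋆ₙₐ[ℂ] CStarMatrix τ τ (Stabilization A) where
  toFun X := CStarMatrix.ofMatrix fun s t => cornerHom A N (blockAt e X s t)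
  map_smul' c X := by
    ext s t
    exact map_smul (cornerHom A N) c (blockAt e X s t)
  map_zero' := by
    ext s t
    exact map_zero (cornerHom A N)
  map_add' X Y := by
    ext s t
    exact map_add (cornerHom A N) (blockAt e X s t) (blockAt e Y s t)
  map_mul' X Y := by
    ext s t
    rw [CStarMatrix.mul_apply]
    change cornerHom A N (blockAt e (X * Y) s t) =
      ∑ c, cornerHom A N (blockAt e X s c) * cornerHom A N (blockAt e Y c t)
    rw [blockAt_mul, map_sum]
    simp only [map_mul]
  map_star' X := by
    ext s t
    exact StarHomClass.map_star (cornerHom A N) (blockAt e X t s)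

variable {τ ρ : Type} [Fintype τ] [Fintype ρ] {N : ℕ} (e : τ × Fin N ≃ ρ)

theorem blockHom_apply (X : CStarMatrix ρ ρ A) (s t : τ) :
    blockHom A e X s t = cornerHom A N (blockAt e X s t) := rfl

theorem blockHom_injective : Function.Injective (blockHom A e) := by
  intro X Y h
  ext p q
  obtain ⟨⟨s, p⟩, rfl⟩ := e.surjective p
  obtain ⟨⟨t, q⟩, rfl⟩ := e.surjective q
  have h1 : blockAt e X s t = blockAt e Y s t :=
    cornerHom_injective N (congrFun (congrFun h s) t)
  exact congrFun (congrFun h1 p) q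

theorem mem_range_blockHom {b : CStarMatrix τ τ (Stabilization A)}
    (h : ∀ s t, b s t ∈ Set.range (cornerHom A N)) : b ∈ Set.range (blockHom A e) := by
  choose X hX using h
  refine ⟨CStarMatrix.ofMatrix fun p q =>
    X (e.symm p).1 (e.symm q).1 (e.symm p).2 (e.symm q).2, ?_⟩
  ext s t
  rw [blockHom_apply, ← hX]
  congr 1
  ext p q
  change X (e.symm (e (s, p))).1 (e.symm (e (t, q))).1 (e.symm (e (s, p))).2
    (e.symm (e (t, q))).2 = _
  simp only [Equiv.symm_apply_apply]

theorem blockHom_mul_mul_mem_range (X Y : CStarMatrix ρ ρ A)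
    (b : CStarMatrix τ τ (Stabilization A)) :
    blockHom A e X * b * blockHom A e Y ∈ Set.range (blockHom A e) := by
  refine mem_range_blockHom e fun s t => ?_
  let S := LinearMap.range (cornerHom A N : CStarMatrix (Fin N) (Fin N) A →ₗ[ℂ] Stabilization A)
  change _ ∈ S
  rw [CStarMatrix.mul_apply]
  refine Submodule.sum_mem _ fun c _ => ?_
  rw [CStarMatrix.mul_apply, Finset.sum_mul]
  exact Submodule.sum_mem _ fun d _ => cornerHom_mul_mul_mem_range _ _ _

/-- Conjugating by block matrices compresses positive matrices over A ⊗ 𝒦 into matrices over A: the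
image is hereditary, and positivity is reflected by injective *-homomorphisms. -/
theorem exists_nonneg_blockHom_eq_conj (X : CStarMatrix ρ ρ A)
    {b : CStarMatrix τ τ (Stabilization A)} (hb : 0 ≤ b) :
    ∃ Y, 0 ≤ Y ∧ blockHom A e Y = star (blockHom A e X) * b * blockHom A e X := by
  obtain ⟨Y, hY⟩ : star (blockHom A e X) * b * blockHom A e X ∈
      Set.range (blockHom A e) := by
    rw [← StarHomClass.map_star]
    exact blockHom_mul_mul_mem_range e _ _ _
  refine ⟨Y, NonUnitalStarAlgHom.nonneg_of_map_nonneg (blockHom_injective e) ?_, hY⟩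
  rw [hY]
  exact star_left_conjugate_nonneg hb _

theorem exists_tendsto_blockHom (τ : Type) [Fintype τ] (b : CStarMatrix τ τ (Stabilization A))
    (ρ : ℕ → Type) [∀ N, Fintype (ρ N)] (e : ∀ N, τ × Fin N ≃ ρ N) :
    ∃ X : ∀ N, CStarMatrix (ρ N) (ρ N) A,
      Tendsto (fun N => blockHom A (e N) (X N)) atTop (𝓝 b) := by
  choose X hX using fun s t => exists_tendsto_cornerHom (b s t)
  have h : ∀ N, ∃ Y, blockHom A (e N) Y =
      CStarMatrix.ofMatrix fun s t => cornerHom A N (X s t N) :=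
    fun N => mem_range_blockHom (e N) fun s t => ⟨X s t N, rfl⟩
  choose Y hY using h
  refine ⟨Y, ?_⟩
  simp only [hY]
  rw [CuntzLE.tendsto_iff]
  exact hX

/-- The indexing of the larger block matrix is chosen so that taking copies commutes with the
inclusion. The conjugators for the κ-fold copies then live over the same N. -/
theorem blockHom_diagCopies {κ : Type} [Fintype κ] [DecidableEq κ] (X : CStarMatrix ρ ρ A) :
    blockHom A ((Equiv.prodAssoc κ τ (Fin N)).trans ((Equiv.refl κ).prodCongr e))
      (diagCopies κ X) = diagCopies κ (blockHom A e X) := by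
  ext s t
  rw [blockHom_apply, diagCopies_apply, blockHom_apply]
  have h : blockAt ((Equiv.prodAssoc κ τ (Fin N)).trans ((Equiv.refl κ).prodCongr e))
      (diagCopies κ X) s t = if s.1 = t.1 then blockAt e X s.2 t.2 else 0 := by
    ext p q
    change (if s.1 = t.1 then X (e (s.2, p)) (e (t.2, q)) else 0) = _
    split_ifs <;> rfl
  rw [h, apply_ite (cornerHom A N), map_zero]

end Stable

/-! ### Comparison in the stabilization -/

theorem NonUnitalStarAlgHom.continuous_of_cstarAlgebra {C D : Type*} [NonUnitalCStarAlgebra C]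
    [NonUnitalCStarAlgebra D] (f : C →⋆ₙₐ[ℂ] D) : Continuous f :=
  AddMonoidHomClass.continuous_of_bound f 1 fun x => by
    simpa using NonUnitalStarAlgHom.norm_apply_le f x

theorem tendsto_conj_approximateUnit {C : Type*} [NonUnitalCStarAlgebra C] [PartialOrder C]
    [StarOrderedRing C] (c : C) :
    Tendsto (fun e => star e * c * e) (CStarAlgebra.approximateUnit C) (𝓝 c) := by
  have hl := CStarAlgebra.increasingApproximateUnit C
  have hR := tendsto_iff_norm_sub_tendsto_zero.1 (hl.tendsto_mul_right c)
  have hL := tendsto_iff_norm_sub_tendsto_zero.1 (hl.tendsto_mul_left c)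
  rw [tendsto_iff_norm_sub_tendsto_zero]
  refine squeeze_zero' (Eventually.of_forall fun _ => norm_nonneg _) ?_
    (by simpa using hR.add hL)
  filter_upwards [hl.eventually_norm, hl.eventually_star_eq] with e he hes
  have : star e * c * e - c = (e * c - c) * e + (c * e - c) := by
    rw [hes, sub_mul]
    abel
  rw [this]
  refine (norm_add_le _ _).trans ?_
  have h2 : ‖(e * c - c) * e‖ ≤ ‖e * c - c‖ :=
    (norm_mul_le _ _).trans (mul_le_of_le_one_right (norm_nonneg _) he)
  linarith

section Final

variable {A : Type u} [NonUnitalCStarAlgebra A] [PartialOrder A] [StarOrderedRing A]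

theorem exists_sum_conj_approx_stabilization {n : ℕ} (hA : HasDecomposableApproximations A n)
    {τ : Type} [Fintype τ] [DecidableEq τ] {a : CStarMatrix τ τ (Stabilization A)}
    {b : Fin (n + 1) → CStarMatrix τ τ (Stabilization A)} (ha : 0 ≤ a) (hb : ∀ i, 0 ≤ b i)
    {k : Fin (n + 1) → ℕ} (hk : ∀ i, 0 < k i)
    (h : ∀ i, ∀ ε > 0,
      ∃ V : CStarMatrix (Fin (k i) × τ) (Fin (k i) × τ) (Stabilization A), ‖diagCopies (Fin (k i)) a -
      star V * diagCopies (Fin (k i)) (b i) * V‖ < ε) {ε : ℝ} (hε : 0 < ε) :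
    ∃ x : Fin (n + 1) → CStarMatrix τ τ (Stabilization A),
      ‖a - ∑ i, star (x i) * b i * x i‖ ≤ ε := by
  -- The factor 4(n + 1) + 1 is the error of the comparison over A; one more δ pays for compressing
  -- a.
  obtain ⟨δ, hδ, hδε⟩ := exists_pos_mul_le (4 * (n + 1) + 1 + 1) hε
  choose V hV using fun i => h i (δ / 16) (by positivity)
  have hdc : ∀ i, Continuous (diagCopies (Fin (k i)) : CStarMatrix τ τ (Stabilization A) → _) :=
    fun i => NonUnitalStarAlgHom.continuous_of_cstarAlgebra _
  have hl := CStarAlgebra.increasingApproximateUnit (CStarMatrix τ τ (Stabilization A))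
  have := hl.neBot
  have hu := fun c : CStarMatrix τ τ (Stabilization A) => tendsto_conj_approximateUnit c
  -- The same u compresses a and all bᵢ. The inequalities are strict, so they persist when u and the
  -- Vᵢ are replaced by nearby block matrices.
  obtain ⟨u, hua, huV⟩ : ∃ u : CStarMatrix τ τ (Stabilization A), ‖a - star u * a * u‖ < δ ∧
      ∀ i, ‖diagCopies (Fin (k i)) (star u * a * u) -
        star (V i) * diagCopies (Fin (k i)) (star u * b i * u) * V i‖ < δ / 16 := by
    have t1 := (tendsto_const_nhds (x := a)).sub (hu a) |>.norm
    rw [sub_self, norm_zero] at t1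
    have t2 := fun i => ((((hdc i).tendsto _).comp (hu a)).sub
      ((((hdc i).tendsto _).comp (hu (b i))).const_mul (star (V i)) |>.mul_const (V i))).norm
    exact ((t1.eventually_lt_const hδ).and
      (eventually_all.2 fun i => (t2 i).eventually_lt_const (hV i))).exists
  obtain ⟨X, hX⟩ := exists_tendsto_blockHom τ u (fun N => τ × Fin N) fun N => Equiv.refl _
  choose v hv using fun i => exists_tendsto_blockHom (Fin (k i) × τ) (V i)
    (fun N => Fin (k i) × (τ × Fin N))
    fun N => (Equiv.prodAssoc _ τ (Fin N)).trans ((Equiv.refl _).prodCongr (Equiv.refl _))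
  have hconj := fun c : CStarMatrix τ τ (Stabilization A) => (hX.star.mul_const c).mul hX
  have t1 := (tendsto_const_nhds (x := a)).sub (hconj a) |>.norm
  have t2 := fun i => ((((hdc i).tendsto _).comp (hconj a)).sub
    (((hv i).star.mul (((hdc i).tendsto _).comp (hconj (b i)))).mul (hv i))).norm
  obtain ⟨N, hN1, hN2⟩ := ((t1.eventually_lt_const hua).and
      (eventually_all.2 fun i => (t2 i).eventually_lt_const (huV i))).exists
  let e : τ × Fin N ≃ τ × Fin N := Equiv.refl _
  obtain ⟨a', ha', haX⟩ := exists_nonneg_blockHom_eq_conj e (X N) ha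
  choose b' hb' hbX using fun i => exists_nonneg_blockHom_eq_conj e (X N) (hb i)
  have hvN : ∀ i, ‖diagCopies (Fin (k i)) a' -
      star (v i N) * diagCopies (Fin (k i)) (b' i) * v i N‖ ≤ δ / 16 := by
    intro i
    let e' := (Equiv.prodAssoc (Fin (k i)) τ (Fin N)).trans ((Equiv.refl _).prodCongr e)
    rw [← NonUnitalStarAlgHom.norm_map (blockHom A e') (blockHom_injective e'), map_sub, map_mul,
      map_mul, StarHomClass.map_star, blockHom_diagCopies, blockHom_diagCopies, haX, hbX]
    exact (hN2 i).le
  obtain ⟨x, hx⟩ := exists_sum_conj_approx hA hδ ha' hb' hk (fun i => v i N) hvN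
  -- The compressed bᵢ is X* bᵢ X, so the compressing matrix X is absorbed into the conjugator.
  refine ⟨fun i => blockHom A e (X N) * blockHom A e (x i), ?_⟩
  have key : a - ∑ i, star (blockHom A e (X N) * blockHom A e (x i)) * b i *
      (blockHom A e (X N) * blockHom A e (x i)) =
      (a - star (blockHom A e (X N)) * a * blockHom A e (X N)) +
        blockHom A e (a' - ∑ i, star (x i) * b' i * x i) := by
    rw [map_sub, map_sum, haX]
    simp only [map_mul, StarHomClass.map_star, hbX, star_mul, mul_assoc]
    abel
  rw [key]
  refine (norm_add_le _ _).trans ?_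
  have n1 : ‖a - star (blockHom A e (X N)) * a * blockHom A e (X N)‖ ≤ δ := hN1.le
  have n2 := (NonUnitalStarAlgHom.norm_apply_le (blockHom A e)
    (a' - ∑ i, star (x i) * b' i * x i)).trans hx
  linarith

end Final

/-! ### Multiples and sums in the Cuntz semigroup -/

section Semigroup

variable {B : Type u} [NonUnitalCStarAlgebra B] [PartialOrder B] [StarOrderedRing B]

theorem CuntzLE.zero_left {m n : Type} [Fintype m] [Fintype n] (b : CStarMatrix n n B) :
    CuntzLE (0 : CStarMatrix m m B) b := by
  refine ⟨fun _ => 0, CuntzLE.tendsto_iff.2 fun i j => ?_⟩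
  simp only [CuntzLE.conj_apply, CStarMatrix.zero_apply, mul_zero, Finset.sum_const_zero]
  exact tendsto_const_nhds

namespace CuntzSemigroup

theorem zero_le (x : CuntzSemigroup B) : 0 ≤ x := by
  induction x using ind with | _ a
  exact CuntzLE.zero_left a.mat

theorem exists_mk_eq_of_size_le (a : PosMatrix B) {M : ℕ} (hM : a.size ≤ M) :
    ∃ (c : CStarMatrix (Fin M) (Fin M) B) (hc : 0 ≤ c), mk ⟨M, c, hc⟩ = mk a := by
  obtain ⟨d, rfl⟩ := Nat.exists_eq_add_of_le hM
  refine ⟨(a + ⟨d, 0, le_rfl⟩ : PosMatrix B).mat, (a + ⟨d, 0, le_rfl⟩ : PosMatrix B).nonneg, ?_⟩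
  have h : mk (⟨d, 0, le_rfl⟩ : PosMatrix B) = 0 :=
    le_antisymm (CuntzLE.zero_left _) (zero_le _)
  change mk (a + ⟨d, 0, le_rfl⟩) = mk a
  rw [mk_add, h, add_zero]

/-- Identifies the iterated sum, indexed by nested reindexings, with k uniform diagonal copies. A
comparison of multiples then becomes one between copies of matrices. -/
theorem exists_mk_eq_nsmul (a : PosMatrix B) (k : ℕ) :
    ∃ P : PosMatrix B, mk P = k • mk a ∧ CuntzLE (diagCopies (Fin k) a.mat) P.mat ∧
      CuntzLE P.mat (diagCopies (Fin k) a.mat) := by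
  induction k with
  | zero =>
    refine ⟨0, by rw [zero_nsmul, mk_zero], ?_, CuntzLE.zero_left _⟩
    have : diagCopies (Fin 0) a.mat = 0 := by
      ext s t
      exact s.1.elim0
    rw [this]
    exact CuntzLE.zero_left _
  | succ k ih =>
    obtain ⟨P, hP, h1, h2⟩ := ih
    let f : (Fin k × Fin a.size) ⊕ Fin a.size ≃ Fin (k + 1) × Fin a.size :=
      ((Equiv.refl _).sumCongr (Equiv.uniqueProd (Fin a.size) (Fin 1)).symm).trans
        ((Equiv.sumProdDistrib (Fin k) (Fin 1) (Fin a.size)).symm.trans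
          (finSumFinEquiv.prodCongr (Equiv.refl _)))
    have hf : ∀ s t, blockSum (diagCopies (Fin k) a.mat) a.mat s t =
        diagCopies (Fin (k + 1)) a.mat (f s) (f t) := by
      have hl : ∀ s : Fin k × Fin a.size, f (Sum.inl s) = (Fin.castSucc s.1, s.2) := fun s => rfl
      have hr : ∀ s : Fin a.size, f (Sum.inr s) = (Fin.last k, s) := fun s => rfl
      rintro (s | s) (t | t)
      · rw [blockSum_inl_inl, hl, hl, diagCopies_apply, diagCopies_apply]
        simp only [Fin.castSucc_inj]
      · rw [blockSum_inl_inr, hl, hr, diagCopies_apply, if_neg (Fin.castSucc_ne_last _)]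
      · rw [blockSum_inr_inl, hl, hr, diagCopies_apply, if_neg (Fin.castSucc_ne_last _).symm]
      · rw [blockSum_inr_inr, hr, hr, diagCopies_apply, if_pos rfl]
    have hadd := PosMatrix.add_mat_apply P a
    refine ⟨P + a, by rw [mk_add, hP, succ_nsmul], ?_, ?_⟩
    · refine ((CuntzLE.of_equiv f (Equiv.refl _) fun s t => (hf s t).symm).trans
        (CuntzLE.blockSum_mono h1 (CuntzLE.refl a.mat))).trans ?_
      exact CuntzLE.of_equiv (Equiv.refl _) finSumFinEquiv fun i j => (hadd i j).symm
    · refine CuntzLE.trans ?_ ((CuntzLE.blockSum_mono h2 (CuntzLE.refl a.mat)).trans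
        (CuntzLE.of_equiv (Equiv.refl _) f hf))
      exact CuntzLE.of_equiv finSumFinEquiv (Equiv.refl _) hadd

theorem cuntzLE_diagCopies_of_nsmul_le {a b : PosMatrix B} {k : ℕ} (h : k • mk a ≤ k • mk b) :
    CuntzLE (diagCopies (Fin k) a.mat) (diagCopies (Fin k) b.mat) := by
  obtain ⟨P, hP, h1, -⟩ := exists_mk_eq_nsmul a k
  obtain ⟨Q, hQ, -, h2⟩ := exists_mk_eq_nsmul b k
  rw [← hP, ← hQ] at h
  exact (h1.trans (mk_le_mk.1 h)).trans h2

/-- The column with entries xᵢ conjugates the block diagonal matrix of the bᵢ to ∑ xᵢ* bᵢ xᵢ. An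
arbitrary index type for Q keeps the induction free of reindexing. -/
theorem exists_mk_eq_sum {m : Type} [Fintype m] {β : Type*} [DecidableEq β] (T : Finset β)
    (b : β → PosMatrix B) :
    ∃ P : PosMatrix B, mk P = ∑ i ∈ T, mk (b i) ∧
      ∃ (σ : Type) (_ : Fintype σ) (Q : CStarMatrix σ σ B), CuntzLE Q P.mat ∧
        ∀ x : ∀ i, CStarMatrix (Fin (b i).size) m B, ∃ y : CStarMatrix σ m B,
          y.conjTranspose * Q * y = ∑ i ∈ T, (x i).conjTranspose * (b i).mat * x i := by
  induction T using Finset.cons_induction with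
  | empty =>
    refine ⟨0, by rw [Finset.sum_empty, mk_zero], Empty, inferInstance, 0, CuntzLE.zero_left _,
      fun x => ⟨0, ?_⟩⟩
    ext i j
    rw [CuntzLE.conj_apply]
    rfl
  | cons i T hi ih =>
    obtain ⟨P, hP, σ, _, Q, hQ, hy⟩ := ih
    refine ⟨b i + P, by rw [mk_add, hP, Finset.sum_cons], Fin (b i).size ⊕ σ, inferInstance,
      blockSum (b i).mat Q, ?_, fun x => ?_⟩
    · refine (CuntzLE.blockSum_mono (CuntzLE.refl _) hQ).trans ?_
      exact CuntzLE.of_equiv (Equiv.refl _) finSumFinEquiv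
        fun i' j => (PosMatrix.add_mat_apply (b i) P i' j).symm
    · obtain ⟨y, hy⟩ := hy x
      refine ⟨CStarMatrix.ofMatrix (Sum.elim (x i) y), ?_⟩
      rw [Finset.sum_cons, ← hy]
      ext s t
      have hl : ∀ p, (CStarMatrix.ofMatrix (Sum.elim (x i) y) :
        CStarMatrix (Fin (b i).size ⊕ σ) m B) (Sum.inl p) = x i p := fun _ => rfl
      have hr : ∀ p, (CStarMatrix.ofMatrix (Sum.elim (x i) y) :
        CStarMatrix (Fin (b i).size ⊕ σ) m B) (Sum.inr p) = y p := fun _ => rfl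
      rw [CStarMatrix.add_apply]
      simp only [CuntzLE.conj_apply, Fintype.sum_sum_type, blockSum_inl_inl, blockSum_inl_inr,
        blockSum_inr_inl, blockSum_inr_inr, hl, hr, mul_zero, add_zero, zero_add,
        Finset.sum_const_zero]

theorem mk_le_sum_of_approx {M n : ℕ} {a : CStarMatrix (Fin M) (Fin M) B} (ha : 0 ≤ a)
    {b : Fin n → CStarMatrix (Fin M) (Fin M) B} (hb : ∀ i, 0 ≤ b i)
    (h : ∀ ε > 0, ∃ x : Fin n → CStarMatrix (Fin M) (Fin M) B,
      ‖a - ∑ i, star (x i) * b i * x i‖ ≤ ε) :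
    mk ⟨M, a, ha⟩ ≤ ∑ i, mk ⟨M, b i, hb i⟩ := by
  obtain ⟨P, hP, σ, _, Q, hQ, hy⟩ := exists_mk_eq_sum (m := Fin M) Finset.univ
    fun i => (⟨M, b i, hb i⟩ : PosMatrix B)
  rw [← hP, mk_le_mk]
  refine CuntzLE.trans (CuntzLE.iff_mem_closure.2 ?_) hQ
  rw [Metric.mem_closure_iff]
  intro ε hε
  obtain ⟨x, hx⟩ := h (ε / 2) (half_pos hε)
  obtain ⟨y, hxy⟩ := hy x
  refine ⟨_, ⟨y, rfl⟩, ?_⟩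
  rw [dist_eq_norm]
  refine lt_of_le_of_lt ?_ (half_lt_self hε)
  simp only [hxy]
  exact hx

end CuntzSemigroup

end Semigroup

/-! ### The comparison theorem -/

theorem le_sum_of_nsmul_le_nsmul {A : Type u} [NonUnitalCStarAlgebra A] [PartialOrder A]
    [StarOrderedRing A] {n : ℕ} (hA : HasDecomposableApproximations A n) (x : Cu A)
    (y : Fin (n + 1) → Cu A) (k : Fin (n + 1) → ℕ) (hk : ∀ i, 0 < k i)
    (h : ∀ i, k i • x ≤ k i • y i) : x ≤ ∑ i, y i := by
  induction x using CuntzSemigroup.ind with | _ a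
  obtain ⟨b, rfl⟩ : ∃ b : Fin (n + 1) → PosMatrix (Stabilization A), y = fun i => CuntzSemigroup.mk (b i) := by
    choose b hb using fun i => CuntzSemigroup.ind (p := fun z => ∃ b, z = CuntzSemigroup.mk b)
      (fun b => ⟨b, rfl⟩) (y i)
    exact ⟨b, funext hb⟩
  -- All representatives are padded by zeros to one common size.
  let M := a.size + ∑ i, (b i).size
  obtain ⟨a', ha', haa⟩ := CuntzSemigroup.exists_mk_eq_of_size_le a (Nat.le_add_right _ _ : _ ≤ M)
  choose b' hb' hbb using fun i => CuntzSemigroup.exists_mk_eq_of_size_le (b i) (M := M)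
    ((Finset.single_le_sum (f := fun i => (b i).size) (fun _ _ => Nat.zero_le _)
      (Finset.mem_univ i)).trans (Nat.le_add_left _ _))
  simp only [← haa, ← hbb] at h ⊢
  refine CuntzSemigroup.mk_le_sum_of_approx ha' hb' fun ε hε =>
    exists_sum_conj_approx_stabilization hA ha' hb' hk (fun i ε hε => ?_) hε
  have := CuntzLE.iff_mem_closure.1 (CuntzSemigroup.cuntzLE_diagCopies_of_nsmul_le (h i))
  obtain ⟨_, ⟨V, rfl⟩, hV⟩ := Metric.mem_closure_iff.1 this ε hε
  rw [dist_eq_norm] at hV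
  exact ⟨V, hV⟩

end

theorem theorem1p3 {A : Type*} [NonUnitalCStarAlgebra A] [PartialOrder A] [StarOrderedRing A]
    (n : ℕ) (hA : HasNuclearDimension A n) :
    HasNComparison (Cu A) n ∧
      ∀ (x : Cu A) (y : Fin (n + 1) → Cu A) (k : Fin (n + 1) → ℕ),
        (∀ i, 0 < k i) → (∀ i, k i • x ≤ k i • y i) → x ≤ ∑ i, y i := by
  refine ⟨fun x y h => ?_, le_sum_of_nsmul_le_nsmul hA.1⟩
  choose k hk h using h
  refine le_sum_of_nsmul_le_nsmul hA.1 x y k hk fun i => le_trans ?_ (h i)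
  -- Since 0 ≤ x, kx ≤ (k + 1)x, and the hypothesis of n-comparison implies the weaker one.
  rw [succ_nsmul]
  exact le_add_of_nonneg_right (CuntzSemigroup.zero_le x)
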